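/- **Objects.** Both categories below have the objects $[n]$, $n\in\mathbb N\cup\{0+,0-\}$, where $\mathbb N=\{1,2,\dots\}$; put $|n|=n$ for $n\in\mathbb N$ and $|0\pm|=0$. **The category $\mathsf{Atl}$.** An annular $(m,n)$-tangle lives in the annulus between an internal circle $D_1$ with $2|m|$ marked points and an external circle $D_0$ with $2|n|$ marked points. It consists of finitely many disjoint strings and closed curves (loops) such that each marked point is the end of exactly one string; the complementary regions are checkerboard shaded. On each circle with marked points an interval $*$ between two adjacent marked points which meets an unshaded region is distinguished, and the points are numbered clockwise from $*$. A circle without marked points meets an unshaded region if it is of type $0+$ and a shaded region if it is of type $0-$. Tangles are taken up to orientation-preserving diffeomorphisms of the annulus that preserve each boundary circle and this structure. An *Atl tangle* is a tangle without contractible loops. It is recorded by (a) its strings, lifted to the universal cover (a strip) of the annulus, i.e. a fixed-point-free involution of the lifted marked points which commutes with deck transformations and is non-crossing, taken up to full twists of one boundary circle, and (b) its number of non-contractible loops, which is $0$ if some string connects $D_1$ with $D_0$; these data have to be compatible with the shading. A morphism $[m]\to[n]$ of $\mathsf{Atl}$ is a triple $(T,c_+,c_-)$ with an Atl $(m,n)$-tangle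 $T$ and integers $c_\pm\ge 0$. The composite $(S,a_+,a_-)\circ(T,b_+,b_-)=(R,c_+,c_-)$ is obtained by gluing $T$ inside $S$ along the common circle such that marked points and $*$ match; $R$ is the result of removing all contractible loops, and $c_\pm=a_\pm+b_\pm+d_\pm$, where $d_+$ (resp. $d_-$) is the number of removed contractible loops that are shaded (resp. unshaded) inside. The identities are $(\mathrm{id}_{[n]},0,0)$, and the involution is $(T,c_+,c_-)^*=(T^*,c_+,c_-)$, where $T^*$ is the reflection of $T$ that exchanges $D_0$ and $D_1$. Write $T$ for $(T,0,0)$. Let $a_1\colon[1]\to[0+]$ and $a_2\colon[1]\to[0-]$ be the unique such tangles without loops. For $n\ge2$ and $1\le i\le 2n$ let $a_i\colon[n]\to[n-1]$ be the tangle whose internal points $i$ and $i+1$ (mod $2n$) are joined by a string, all other internal points being joined to external points such that the first external point is joined to the internal point $3$ if $i=1$, $1$ if $1<i<2n$, and $2n-1$ if $i=2n$. Let $b_i=a_i^*$, so $b_1\colon[0+]\to[1]$, $b_2\colon[0-]\to[1]$ and $b_i\colon[n]\to[n+1]$ for $n\ge1$, $1\le i\le 2n+2$. For $n\geq 1$ let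 $t\colon[n]\to[n]$ be the tangle in which all internal points are joined to external points and the first internal point is joined to the third external point (for $n=1$, $t$ is the identity). **The category $\mathsf{a}\Delta$** is given by the generators $\alpha_1\colon[1]\to[0+]$, $\alpha_2\colon[1]\to[0-]$, $\alpha_i\colon[n]\to[n-1]$ ($n\ge2$, $1\le i\le 2n$), $\beta_1\colon[0+]\to[1]$, $\beta_2\colon[0-]\to[1]$, $\beta_i\colon[n]\to[n+1]$ ($n\ge1$, $1\le i\le 2n+2$), $\tau\colon[n]\to[n]$ ($n\ge 1$), $\delta_\pm\colon[n]\to[n]$ (all $n\in\mathbb N\cup\{0\pm\}$) and the following relations, whenever both sides are defined. In (1) and (2), $[n]$ is the source of the two sides, and $n$ is read as $0$ in $2n+2$ if the source is $[0\pm]$. 1. $\alpha_i\alpha_j=\alpha_{j-2}\alpha_i$ for $i<j-1$, $(i,j)\ne(1,2n)$; 2. $\beta_i\beta_j=\beta_{j+2}\beta_i$ for $i\le j$, $(i,j)\ne(1,2n+2)$; 3. $\tau^n=\mathrm{id}_{[n]}$; 4. $\alpha_i\tau=\tau\alpha_{i-2}$ for $i\ge3$; 5. $\beta_i\tau=\tau\beta_{i-2}$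 for $i\ge3$; 6. $\alpha_1\beta_1=\delta_+$ on $[0+]$, $\alpha_2\beta_2=\delta_-$ on $[0-]$, and for $\alpha_i\beta_j\colon[n]\to[n]$ with $n\ge1$: $\alpha_i\beta_j=\tau^{-1}$ if $(i,j)=(1,2n+2)$; $\;\beta_{j-2}\alpha_i$ if $i<j-1$, $(i,j)\ne(1,2n+2)$; $\;\mathrm{id}_{[n]}$ if $i=j\pm1$; $\;\delta_+$ if $i=j$ is odd; $\;\delta_-$ if $i=j$ is even; $\;\beta_j\alpha_{i-2}$ if $i>j+1$, $(i,j)\ne(2n+2,1)$; $\;\tau$ if $(i,j)=(2n+2,1)$; 7. $\delta_+$ and $\delta_-$ commute with all generators. Its involution is the contravariant functor which fixes the objects and satisfies $\alpha_i^*=\beta_i$, $\beta_i^*=\alpha_i$, $\tau^*=\tau^{-1}$, $\delta_\pm^*=\delta_\pm$. **Theorem.** The composition of $\mathsf{Atl}$ is well defined and makes $\mathsf{Atl}$ an involutive category. The assignments $[n]\mapsto[n]$, $\alpha_i\mapsto a_i$, $\beta_i\mapsto b_i$, $\tau\mapsto t$, $\delta_+\mapsto(\mathrm{id}_{[n]},1,0)$,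 $\delta_-\mapsto(\mathrm{id}_{[n]},0,1)$ respect the relations of $\mathsf{a}\Delta$ and hence define a functor $F\colon\mathsf{a}\Delta\to\mathsf{Atl}$. This functor is an isomorphism of involutive categories: there is a functor $G\colon\mathsf{Atl}\to\mathsf{a}\Delta$ with $F\circ G=\mathrm{id}$ and $G\circ F=\mathrm{id}$, and $F(\varphi^*)=F(\varphi)^*$ for all morphisms $\varphi$. Hence $\mathsf{a}\Delta$ is a presentation of $\mathsf{Atl}$ by generators and relations. -/

import Mathlib

open CategoryTheory

namespace AnnularTL

/-! ## Objects -/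

/-- The two signs, used both for the objects `[0+]`, `[0-]` and for the morphisms `δ₊`, `δ₋`. -/
inductive Sign : Type
  | plus
  | minus

/-- The objects: `num k` is `[k + 1]`, and `zero plus`, `zero minus` are `[0+]`, `[0-]`. -/
inductive Obj : Type
  | num (k : ℕ)
  | zero (s : Sign)

/-- Half of the number of marked points of a boundary circle of type `x`. -/
def Obj.size : Obj → ℕ
  | .num k => k + 1
  | .zero _ => 0

/-! ## Annular tangles -/

/-- A marked point on the universal cover of a circle with `2 * n` marked points. The marked
points of the circle are numbered clockwise from the distinguished interval `*`; here `idx` is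
this number minus one, and `sheet` tells the lifts of one marked point apart. -/
@[ext]
structure Pt (n : ℕ) : Type where
  sheet : ℤ
  idx : ℕ
  idx_lt : idx < 2 * n

/-- The deck transformation of the universal cover. -/
def Pt.shift {n : ℕ} (k : ℤ) (p : Pt n) : Pt n := ⟨p.sheet + k, p.idx, p.idx_lt⟩

/-- The order of the points along the universal cover of the circle, in the clockwise
direction. -/
def Pt.lt {n : ℕ} (p q : Pt n) : Prop :=
  p.sheet < q.sheet ∨ (p.sheet = q.sheet ∧ p.idx < q.idx)

/-- The marked points on the boundary of the universal cover (an infinite strip) of the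
annulus: `inl` is the internal boundary `D₁`, `inr` the external boundary `D₀`. -/
abbrev Bd (m n : ℕ) : Type := Pt m ⊕ Pt n

/-- The deck transformation of the strip. -/
def Bd.shift {m n : ℕ} (k : ℤ) : Bd m n → Bd m n := Sum.map (Pt.shift k) (Pt.shift k)

/-- The lift of a Dehn twist (`k` full turns of the external boundary only). -/
def Bd.twist {m n : ℕ} (k : ℤ) : Bd m n → Bd m n := Sum.map id (Pt.shift k)

/-- The order in which one meets the marked points when one runs around the boundary of the
strip: along the internal line forwards, then along the external line backwards. -/
def Bd.lt {m n : ℕ} : Bd m n → Bd m n → Prop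
  | .inl p, .inl q => p.lt q
  | .inl _, .inr _ => True
  | .inr _, .inl _ => False
  | .inr p, .inr q => q.lt p

/-- `IsExposed x arc b`: on a boundary circle of type `x`, some simple interval which is not cut
off by any of the strings `arc` (the strings with both ends on this circle) meets a shaded region
(`b = true`), respectively an unshaded region (`b = false`). The interval just before the marked
point `p` is shaded iff `p.idx` is odd, since `*`, before the point with `idx = 0`, is
unshaded. The region at a circle without marked points is unshaded for `0+`, shaded for `0-`. -/
def IsExposed : (x : Obj) → (Pt x.size → Pt x.size → Prop) → Bool → Prop
  | .zero .plus, _, b => b = false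
  | .zero .minus, _, b => b = true
  | .num k, arc, b => ∃ p : Pt (k + 1), (∀ q r : Pt (k + 1), arc q r → q.lt p → r.lt p) ∧
      (b = true ↔ Odd p.idx)

/-- A shaded annular tangle without contractible loops, from `x` (internal) to `y` (external),
lifted to the universal cover of the annulus. -/
structure LiftedTangle (x y : Obj) : Type where
  /-- the other end of the string that starts at a given marked point -/
  other : Bd x.size y.size → Bd x.size y.size
  /-- the number of non-contractible loops -/
  loops : ℕ
  other_other : ∀ u, other (other u) = u
  other_ne : ∀ u, other u ≠ u
  other_shift : ∀ (k : ℤ) u, other (u.shift k) = (other u).shift k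
  /-- strings are pairwise disjoint -/
  planar : ∀ u v, u.lt v → v.lt (other u) → ¬ (other u).lt (other v)
  /-- a non-contractible loop is disjoint from all strings, so it excludes through strings -/
  loops_eq_zero : ∀ p q, other (.inl p) = .inr q → loops = 0
  /-- the two sides of a through string are shaded in the same way at both of its ends -/
  through_shading : ∀ p q, other (.inl p) = .inr q → (Even p.idx ↔ Even q.idx)
  /-- without through strings, the outermost regions at the two boundary circles are separated
  by exactly the non-contractible loops, and the shading alternates -/
  loop_shading : (∀ p q, other (.inl p) ≠ .inr q) → ∀ b c : Bool,
    IsExposed x (fun p q => other (.inl p) = .inl q) b →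
    IsExposed y (fun p q => other (.inr p) = .inr q) c → (Odd loops ↔ b ≠ c)

/-- Two lifted tangles describe the same tangle, up to diffeomorphism of the annulus, iff they
differ by a power of the Dehn twist. -/
def LiftedTangle.Equivalent {x y : Obj} (T U : LiftedTangle x y) : Prop :=
  T.loops = U.loops ∧ ∃ k : ℤ, ∀ u, U.other (u.twist k) = (T.other u).twist k

theorem Pt.shift_shift {n : ℕ} (j k : ℤ) (p : Pt n) : (p.shift j).shift k = p.shift (j + k) := by
  ext <;> simp [Pt.shift, add_assoc]

theorem Pt.shift_zero {n : ℕ} (p : Pt n) : p.shift 0 = p := by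
  ext <;> simp [Pt.shift]

theorem Bd.twist_twist {m n : ℕ} (j k : ℤ) (u : Bd m n) :
    (u.twist j).twist k = u.twist (j + k) := by
  rcases u with p | p <;> simp [Bd.twist, Pt.shift_shift]

theorem Bd.twist_zero {m n : ℕ} (u : Bd m n) : u.twist 0 = u := by
  rcases u with p | p <;> simp [Bd.twist, Pt.shift_zero]

theorem LiftedTangle.equivalent_equivalence (x y : Obj) :
    Equivalence (LiftedTangle.Equivalent (x := x) (y := y)) where
  refl T := ⟨rfl, 0, fun u => by simp only [Bd.twist_zero]⟩
  symm := by
    rintro T U ⟨hl, k, hk⟩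
    refine ⟨hl.symm, -k, fun u => ?_⟩
    have h := hk (u.twist (-k))
    rw [Bd.twist_twist, neg_add_cancel, Bd.twist_zero] at h
    rw [h, Bd.twist_twist, add_neg_cancel, Bd.twist_zero]
  trans := by
    rintro T U V ⟨hl, k, hk⟩ ⟨hl2, k2, hk2⟩
    refine ⟨hl.trans hl2, k + k2, fun u => ?_⟩
    rw [← Bd.twist_twist, hk2, hk, Bd.twist_twist]

instance LiftedTangle.setoid (x y : Obj) : Setoid (LiftedTangle x y) :=
  ⟨LiftedTangle.Equivalent, LiftedTangle.equivalent_equivalence x y⟩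

/-- An `Atl` `(x, y)`-tangle: a diffeomorphism class of annular tangles without contractible
loops. -/
def Tangle (x y : Obj) : Type := Quotient (LiftedTangle.setoid x y)

/-! ### Identity -/

theorem not_odd_zero_iff_of_exposed {s : Sign} {b c : Bool}
    {arc arc2 : Pt (Obj.zero s).size → Pt (Obj.zero s).size → Prop}
    (hb : IsExposed (.zero s) arc b) (hc : IsExposed (.zero s) arc2 c) : (Odd 0 ↔ b ≠ c) := by
  cases s <;> simp_all [IsExposed]

/-- The identity tangle: the `i`-th internal point is joined to the `i`-th external point. -/
def LiftedTangle.idt (x : Obj) : LiftedTangle x x where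
  other := Sum.swap
  loops := 0
  other_other u := Sum.swap_swap u
  other_ne u := by rcases u with p | p <;> simp
  other_shift k u := by rcases u with p | p <;> simp [Bd.shift]
  planar u v := by
    rcases u with p | p <;> rcases v with q | q <;> (simp [Bd.lt, Pt.lt]; try omega)
  loops_eq_zero _ _ _ := rfl
  through_shading p q h := by simp at h; simp [h]
  loop_shading := by
    intro h b c hb hc
    cases x with
    | num k =>
      exact absurd rfl (h (⟨0, 0, by simp [Obj.size]⟩ : Pt _) ⟨0, 0, by simp [Obj.size]⟩)
    | zero s => exact not_odd_zero_iff_of_exposed hb hc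

/-! ### Reflection -/

/-- The reflection of a tangle that exchanges the two boundary circles. -/
def LiftedTangle.star {x y : Obj} (T : LiftedTangle x y) : LiftedTangle y x where
  other u := (T.other u.swap).swap
  loops := T.loops
  other_other u := by simp [T.other_other]
  other_ne u h := T.other_ne u.swap (by
    have := congrArg Sum.swap h
    simpa using this)
  other_shift k u := by
    have h : ∀ {m n : ℕ} (w : Bd m n), Sum.swap (w.shift k) = Bd.shift k (Sum.swap w) := by
      rintro m n (p | p) <;> rfl
    rw [h, T.other_shift, h]
  planar := by
    have h : ∀ {m n : ℕ} (w z : Bd m n), Bd.lt w z ↔ Bd.lt (Sum.swap z) (Sum.swap w) := by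
      rintro m n (p | p) (q | q) <;> simp [Bd.lt]
    intro u v h1 h2 h3
    rw [h] at h1 h2 h3
    simp only [Sum.swap_swap] at h1 h2 h3
    have h4 := T.planar (T.other v.swap) (T.other u.swap) h3
    simp only [T.other_other] at h4
    exact h4 h2 h1
  loops_eq_zero p q h := T.loops_eq_zero q p (by
    have h2 : T.other (.inr p) = .inl q := by
      have := congrArg Sum.swap h
      simpa using this
    rw [← h2, T.other_other])
  through_shading p q h := (T.through_shading q p (by
    have h2 : T.other (.inr p) = .inl q := by
      have := congrArg Sum.swap h
      simpa using this
    rw [← h2, T.other_other])).symm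
  loop_shading := by
    intro h b c hb hc
    have e : ∀ (w : Bd x.size y.size) (z : Bd y.size x.size), w.swap = z ↔ w = z.swap := by
      rintro (w | w) (z | z) <;> simp
    rw [ne_comm]
    refine T.loop_shading (fun p q hpq => h q p ?_) c b ?_ ?_
    · rw [e]
      change T.other (.inr q) = .inl p
      rw [← hpq, T.other_other]
    · simpa [e] using hc
    · simpa [e] using hb

theorem LiftedTangle.star_equivalent {x y : Obj} (T U : LiftedTangle x y)
    (h : T.Equivalent U) : T.star.Equivalent U.star := by
  obtain ⟨hl, k, hk⟩ := h
  refine ⟨hl, -k, fun u => ?_⟩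
  have e : ∀ {m n : ℕ} (w : Bd m n),
      Sum.swap (w.twist (-k)) = Bd.shift (-k) (Bd.twist k (Sum.swap w)) := by
    rintro m n (p | p) <;> simp [Bd.twist, Bd.shift, Pt.shift_shift, Pt.shift_zero]
  have e2 : ∀ {m n : ℕ} (w : Bd m n),
      Sum.swap (Bd.shift (-k) (Bd.twist k w)) = Bd.twist (-k) (Sum.swap w) := by
    rintro m n (p | p) <;> simp [Bd.twist, Bd.shift, Pt.shift_shift, Pt.shift_zero]
  change (U.other (u.twist (-k)).swap).swap = _
  rw [e, U.other_shift, hk, e2]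
  rfl

/-- The reflection of (a diffeomorphism class of) tangles. -/
def Tangle.star {x y : Obj} (T : Tangle x y) : Tangle y x :=
  Quotient.map LiftedTangle.star LiftedTangle.star_equivalent T

/-! ### The tangles `a_i`, `b_i` and `t` -/

/-- There is a generator `α_i : x ⟶ y`: either `x = [1]` and `(i, y)` is `(1, [0+])` or
`(2, [0-])`, or `x = [n]`, `y = [n - 1]` with `n ≥ 2` and `1 ≤ i ≤ 2 n`. -/
def IsAlpha (i : ℕ) : Obj → Obj → Prop
  | .num 0, .zero .plus => i = 1
  | .num 0, .zero .minus => i = 2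
  | .num (k + 1), .num l => l = k ∧ 1 ≤ i ∧ i ≤ 2 * (k + 2)
  | _, _ => False

theorem IsAlpha.bounds {i : ℕ} {x y : Obj} (h : IsAlpha i x y) :
    x.size = y.size + 1 ∧ 1 ≤ i ∧ i ≤ 2 * x.size := by
  rcases x with (_ | k) | s <;> rcases y with l | (_ | _) <;>
    simp_all [IsAlpha, Obj.size]

/-- The strings of `a_i`: the `i`-th and the `(i + 1)`-th (modulo `2 m`) internal points are
joined. All other internal points are joined to the external points in clockwise order such that
the first external point is joined to the internal point with number `3` if `i = 1`, number `1`
if `1 < i < 2 m`, and number `2 m - 1` if `i = 2 m`. -/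
def capOther {m n : ℕ} (i : ℕ) (hm : m = n + 1) (h1 : 1 ≤ i) :
    Bd m n → Bd m n
  | .inl ⟨s, j, hj⟩ =>
    if hi : i < 2 * m then
      if ha : j + 1 = i then .inl ⟨s, i, hi⟩
      else if hb : j = i then .inl ⟨s, i - 1, by omega⟩
      else if hlt : j + 1 < i then .inr ⟨s, j, by omega⟩
      else .inr ⟨s, j - 2, by omega⟩
    else
      if ha : j + 1 = 2 * m then .inl ⟨s + 1, 0, by omega⟩
      else if hb : j = 0 then .inl ⟨s - 1, 2 * m - 1, by omega⟩
      else if hj2 : j + 2 = 2 * m then .inr ⟨s + 1, 0, by omega⟩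
      else .inr ⟨s, j, by omega⟩
  | .inr ⟨s, j, hj⟩ =>
    if hi : i < 2 * m then
      if hlt : j + 1 < i then .inl ⟨s, j, by omega⟩
      else .inl ⟨s, j + 2, by omega⟩
    else
      if hz : j = 0 then .inl ⟨s - 1, 2 * m - 2, by omega⟩
      else .inl ⟨s, j, by omega⟩

theorem capOther_capOther {m n : ℕ} (i : ℕ) (hm : m = n + 1) (h1 : 1 ≤ i) (u : Bd m n) :
    capOther i hm h1 (capOther i hm h1 u) = u := by
  rcases u with ⟨s, j, hj⟩ | ⟨s, j, hj⟩ <;> rw [capOther] <;> split_ifs <;>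
    rw [capOther] <;> split_ifs <;>
    first
    | rfl
    | omega
    | (simp only [Sum.inl.injEq, Sum.inr.injEq, Pt.mk.injEq, true_and]; omega)

theorem exists_capOther_inr {m n : ℕ} (i : ℕ) (hm : m = n + 1) (h1 : 1 ≤ i) (q : Pt n) :
    ∃ p, capOther i hm h1 (.inl p) = .inr q := by
  have h : ∃ p, capOther i hm h1 (.inr q) = .inl p := by
    rcases q with ⟨s, j, hj⟩
    simp only [capOther]
    split_ifs <;> exact ⟨_, rfl⟩
  obtain ⟨p, hp⟩ := h
  exact ⟨p, by rw [← hp, capOther_capOther]⟩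

/-- The tangle `a_i`. -/
def LiftedTangle.a {i : ℕ} {x y : Obj} (h : IsAlpha i x y) : LiftedTangle x y where
  other := capOther i h.bounds.1 h.bounds.2.1
  loops := 0
  other_other := capOther_capOther i _ _
  other_ne u := by
    obtain ⟨hm, h1, h2⟩ := h.bounds
    rcases u with ⟨s, j, hj⟩ | ⟨s, j, hj⟩ <;> rw [capOther] <;> split_ifs <;>
      simp only [ne_eq, Sum.inl.injEq, Pt.mk.injEq, reduceCtorEq, not_false_eq_true] <;> omega
  other_shift k u := by
    obtain ⟨hm, h1, h2⟩ := h.bounds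
    rcases u with ⟨s, j, hj⟩ | ⟨s, j, hj⟩ <;>
      simp only [Bd.shift, Pt.shift, Sum.map_inl, Sum.map_inr] <;> simp only [capOther] <;>
      split_ifs <;> simp only [Sum.map_inl, Sum.map_inr, Pt.shift, Sum.inl.injEq, Sum.inr.injEq,
        Pt.mk.injEq, and_true] <;> omega
  planar u v := by
    obtain ⟨hm, h1, h2⟩ := h.bounds
    rcases u with ⟨s, j, hj⟩ | ⟨s, j, hj⟩ <;> rcases v with ⟨s2, j2, hj2⟩ | ⟨s2, j2, hj2⟩ <;>
      simp only [capOther] <;> split_ifs <;> simp only [Bd.lt, Pt.lt] <;> intro c1 c2 c3 <;> omega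
  loops_eq_zero _ _ _ := rfl
  through_shading := by
    obtain ⟨hm, h1, h2⟩ := h.bounds
    rintro ⟨s, j, hj⟩ ⟨s2, j2, hj2⟩ h3
    simp only [capOther] at h3
    split_ifs at h3 <;> simp at h3 <;> simp only [Nat.even_iff] <;> omega
  loop_shading := by
    intro h0 b c hb hc
    rcases x with (_ | k) | s
    · rcases y with l | s
      · exact absurd h (by simp [IsAlpha])
      · obtain ⟨⟨s0, j, hj⟩, hp, hodd⟩ := hb
        have hi : (s = .plus ∧ i = 1) ∨ (s = .minus ∧ i = 2) := by
          cases s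
          · exact Or.inl ⟨rfl, h⟩
          · exact Or.inr ⟨rfl, h⟩
        have hj2 : j = 0 ∨ j = 1 := by omega
        rcases hi with ⟨rfl, rfl⟩ | ⟨rfl, rfl⟩
        · have hc2 : c = false := hc
          rcases hj2 with rfl | rfl
          · simp_all
          · exfalso
            have := hp ⟨s0, 0, by omega⟩ ⟨s0, 1, by omega⟩ rfl (Or.inr ⟨rfl, by simp⟩)
            simp [Pt.lt] at this
        · have hc2 : c = true := hc
          rcases hj2 with rfl | rfl
          · exfalso
            have := hp ⟨s0 - 1, 1, by omega⟩ ⟨s0, 0, by omega⟩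
              (by simp [capOther, Obj.size]) (Or.inl (by simp))
            simp [Pt.lt] at this
          · simp_all
    · rcases y with l | s
      · exfalso
        obtain ⟨rfl, h1, h2⟩ := h
        have hs : 0 < 2 * (Obj.num l).size := by simp [Obj.size]
        obtain ⟨p, hp⟩ := exists_capOther_inr (m := (Obj.num (l + 1)).size) i rfl h1 ⟨0, 0, hs⟩
        exact h0 _ _ hp
      · exact absurd h (by simp [IsAlpha])
    · exact absurd h (by simp [IsAlpha])

/-- The strings of `t`: the internal point number `j` is joined to the external point number
`j + 2` (modulo `2 n`). For `n = 1` this is the identity up to a full twist. -/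
def rotOther {n : ℕ} : Bd n n → Bd n n
  | .inl ⟨s, j, hj⟩ =>
    if h : j + 2 < 2 * n then .inr ⟨s, j + 2, h⟩ else .inr ⟨s + 1, j + 2 - 2 * n, by omega⟩
  | .inr ⟨s, j, hj⟩ =>
    if h : 2 ≤ j then .inl ⟨s, j - 2, by omega⟩ else .inl ⟨s - 1, j + 2 * n - 2, by omega⟩

/-- The tangle `t` on `[n]`, `n ≥ 1`. -/
def LiftedTangle.t (x : Obj) (hx : 1 ≤ x.size) : LiftedTangle x x where
  other := rotOther
  loops := 0
  other_other u := by
    rcases u with ⟨s, j, hj⟩ | ⟨s, j, hj⟩ <;> rw [rotOther] <;> split_ifs <;>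
      rw [rotOther] <;> split_ifs <;>
      first
      | rfl
      | omega
      | (simp only [Sum.inl.injEq, Sum.inr.injEq, Pt.mk.injEq, true_and]; omega)
  other_ne u := by
    rcases u with ⟨s, j, hj⟩ | ⟨s, j, hj⟩ <;> rw [rotOther] <;> split_ifs <;> simp
  other_shift k u := by
    rcases u with ⟨s, j, hj⟩ | ⟨s, j, hj⟩ <;>
      simp only [Bd.shift, Pt.shift, Sum.map_inl, Sum.map_inr] <;> simp only [rotOther] <;>
      split_ifs <;> simp only [Sum.map_inl, Sum.map_inr, Pt.shift, Sum.inl.injEq, Sum.inr.injEq,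
        Pt.mk.injEq, and_true] <;> omega
  planar u v := by
    rcases u with ⟨s, j, hj⟩ | ⟨s, j, hj⟩ <;> rcases v with ⟨s2, j2, hj2⟩ | ⟨s2, j2, hj2⟩ <;>
      simp only [rotOther] <;> split_ifs <;> simp only [Bd.lt, Pt.lt] <;> intro c1 c2 c3 <;> omega
  loops_eq_zero _ _ _ := rfl
  through_shading := by
    rintro ⟨s, j, hj⟩ ⟨s2, j2, hj2⟩ h3
    simp only [rotOther] at h3
    split_ifs at h3 <;> simp at h3 <;> simp only [Nat.even_iff] <;> omega
  loop_shading := by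
    intro h0
    exfalso
    have h : ∃ q, rotOther (.inl (⟨0, 0, by omega⟩ : Pt x.size)) = .inr q := by
      simp only [rotOther]
      split_ifs <;> exact ⟨_, rfl⟩
    obtain ⟨q, hq⟩ := h
    exact h0 _ _ hq

/-! ## Composition of tangles -/

/-- The marked points of `S ∘ T` on the universal cover before the common circle of `T` and `S`
is removed, where the circles have `2 l`, `2 m`, `2 n` marked points. -/
inductive Node (l m n : ℕ) : Type
  | inner (p : Pt l)
  | mid (p : Pt m)
  | outer (p : Pt n)

/-- The boundary points of the inside tangle. -/
def Node.ofInside {l m : ℕ} (n : ℕ) : Bd l m → Node l m n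
  | .inl p => .inner p
  | .inr p => .mid p

/-- The boundary points of the outside tangle. -/
def Node.ofOutside (l : ℕ) {m n : ℕ} : Bd m n → Node l m n
  | .inl p => .mid p
  | .inr p => .outer p

/-- The boundary points of the composite. -/
def Node.ofBoundary {l : ℕ} (m : ℕ) {n : ℕ} : Bd l n → Node l m n
  | .inl p => .inner p
  | .inr p => .outer p

section Composition

variable {x y z : Obj} (T : LiftedTangle x y) (S : LiftedTangle y z)

/-- Two points of the picture of `S ∘ T` are the two ends of a string of `T` or of `S`. -/
inductive Joined : Node x.size y.size z.size → Node x.size y.size z.size → Prop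
  | inside (u : Bd x.size y.size) :
      Joined (.ofInside _ u) (.ofInside _ (T.other u))
  | outside (u : Bd y.size z.size) :
      Joined (.ofOutside _ u) (.ofOutside _ (S.other u))

/-- Two points lie on the same curve of `S ∘ T` (on the universal cover). -/
def Connected : Node x.size y.size z.size → Node x.size y.size z.size → Prop :=
  Relation.ReflTransGen (Joined T S)

/-- The curve of `S ∘ T` through the point `p` of the common circle is (the lift of) a loop: it
does not reach the boundary of `S ∘ T`. -/
def OnLoop (p : Pt y.size) : Prop :=
  ∀ u : Bd x.size z.size, ¬ Connected T S (.mid p) (.ofBoundary _ u)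

/-- The curve of `S ∘ T` through `p` connects `p` with a different lift of the same point of the
annulus, i.e. it winds around the annulus. -/
def Winds (p : Pt y.size) : Prop :=
  ∃ k : ℤ, k ≠ 0 ∧ Connected T S (.mid p) (.mid (p.shift k))

/-- The points of the common circle of the annulus through which the curve through `p` passes;
for a loop, this set determines the loop. -/
def loopThrough (p : Pt y.size) : Set ℕ :=
  {j | ∃ q : Pt y.size, q.idx = j ∧ Connected T S (.mid p) (.mid q)}

/-- The new non-contractible loops of `S ∘ T`. -/
def nonContractibleLoops : Set (Set ℕ) :=
  {L | ∃ p : Pt y.size, OnLoop T S p ∧ Winds T S p ∧ L = loopThrough T S p}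

/-- `p` is the leftmost (first in clockwise direction) point at which a contractible loop of
`S ∘ T`, lifted to the universal cover, passes through the common circle. The loop encloses the
interval just after `p`. -/
def IsStart (p : Pt y.size) : Prop :=
  OnLoop T S p ∧ ¬ Winds T S p ∧ ∀ q, Connected T S (.mid p) (.mid q) → ¬ q.lt p

/-- The shaded contractible loops of `S ∘ T`: the interval just after `p` is shaded iff `p.idx`
is even. -/
def shadedLoops : Set (Set ℕ) :=
  {L | ∃ p : Pt y.size, IsStart T S p ∧ Even p.idx ∧ L = loopThrough T S p}

/-- The unshaded contractible loops of `S ∘ T`. -/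
def unshadedLoops : Set (Set ℕ) :=
  {L | ∃ p : Pt y.size, IsStart T S p ∧ Odd p.idx ∧ L = loopThrough T S p}

/-- `R` is obtained from `S ∘ T` (with `T` inside `S`) by removal of the common circle and of all
contractible loops. -/
def IsReducedComposite (R : LiftedTangle x z) : Prop :=
  (∀ u v, R.other u = v ↔ u ≠ v ∧ Connected T S (.ofBoundary _ u) (.ofBoundary _ v)) ∧
    R.loops = T.loops + S.loops + (nonContractibleLoops T S).ncard

end Composition

/-! ## The category `Atl` -/

/-- A morphism of `Atl`: a triple `(T, c₊, c₋)`. -/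
@[ext]
structure AtlHom (x y : Obj) : Type where
  tangle : Tangle x y
  cPlus : ℕ
  cMinus : ℕ

/-- `h = g ∘ f` in `Atl`: the tangle of `h` is the composite of the tangles with all contractible
loops removed; the removed loops are counted, the shaded ones in `c₊` and the unshaded ones in
`c₋`. -/
def AtlHom.IsComposite {x y z : Obj} (f : AtlHom x y) (g : AtlHom y z) (h : AtlHom x z) : Prop :=
  ∃ (T : LiftedTangle x y) (S : LiftedTangle y z) (R : LiftedTangle x z),
    f.tangle = ⟦T⟧ ∧ g.tangle = ⟦S⟧ ∧ h.tangle = ⟦R⟧ ∧ IsReducedComposite T S R ∧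
    h.cPlus = f.cPlus + g.cPlus + (shadedLoops T S).ncard ∧
    h.cMinus = f.cMinus + g.cMinus + (unshadedLoops T S).ncard

/-- The identity morphism. -/
def AtlHom.idm (x : Obj) : AtlHom x x := ⟨⟦.idt x⟧, 0, 0⟩

/-- The involution `(T, c₊, c₋)* = (T*, c₊, c₋)`. -/
def AtlHom.star {x y : Obj} (f : AtlHom x y) : AtlHom y x := ⟨f.tangle.star, f.cPlus, f.cMinus⟩

/-- A category with an involution that fixes the objects. -/
class InvolutiveCategory (A : Type) [Category.{0} A] where
  star : ∀ {X Y : A}, (X ⟶ Y) → (Y ⟶ X)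
  star_id : ∀ X : A, star (𝟙 X) = 𝟙 X
  star_star : ∀ {X Y : A} (f : X ⟶ Y), star (star f) = f
  star_comp : ∀ {X Y Z : A} (f : X ⟶ Y) (g : Y ⟶ Z), star (f ≫ g) = star g ≫ star f

/-- The composition of `Atl`, as an operation that satisfies the laws of an involutive
category. -/
structure AtlComposition : Type where
  comp : ∀ {x y z : Obj}, AtlHom x y → AtlHom y z → AtlHom x z
  isComposite_iff : ∀ {x y z : Obj} (f : AtlHom x y) (g : AtlHom y z) (h : AtlHom x z),
    f.IsComposite g h ↔ h = comp f g
  id_comp : ∀ {x y : Obj} (f : AtlHom x y), comp (.idm x) f = f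
  comp_id : ∀ {x y : Obj} (f : AtlHom x y), comp f (.idm y) = f
  assoc : ∀ {w x y z : Obj} (f : AtlHom w x) (g : AtlHom x y) (h : AtlHom y z),
    comp (comp f g) h = comp f (comp g h)
  star_id : ∀ x : Obj, (AtlHom.idm x).star = .idm x
  star_star : ∀ {x y : Obj} (f : AtlHom x y), f.star.star = f
  star_comp : ∀ {x y z : Obj} (f : AtlHom x y) (g : AtlHom y z),
    (comp f g).star = comp g.star f.star

/-- The objects of the category `Atl`. -/
def Atl (_C : AtlComposition) : Type := Obj

instance (C : AtlComposition) : Category.{0} (Atl C) where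
  Hom x y := AtlHom x y
  id x := AtlHom.idm x
  comp f g := C.comp f g
  id_comp f := C.id_comp f
  comp_id f := C.comp_id f
  assoc f g h := C.assoc f g h

instance (C : AtlComposition) : InvolutiveCategory (Atl C) where
  star f := AtlHom.star f
  star_id x := C.star_id x
  star_star f := C.star_star f
  star_comp f g := C.star_comp f g

/-! ## The annular category `aΔ` -/

/-- There is a generator `β_i : x ⟶ y`: either `y = [1]` and `(i, x)` is `(1, [0+])` or
`(2, [0-])`, or `x = [n]`, `y = [n + 1]` with `n ≥ 1` and `1 ≤ i ≤ 2 n + 2`. -/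
abbrev IsBeta (i : ℕ) (x y : Obj) : Prop := IsAlpha i y x

/-- The generating morphisms of `aΔ`. -/
inductive Gen : Obj → Obj → Type
  | alpha {x y : Obj} (i : ℕ) (h : IsAlpha i x y) : Gen x y
  | beta {x y : Obj} (i : ℕ) (h : IsBeta i x y) : Gen x y
  | tau (k : ℕ) : Gen (.num k) (.num k)
  | delta (s : Sign) (x : Obj) : Gen x x

/-- The quiver of generators. -/
def GenQuiver : Type := Obj

instance : Quiver.{0} GenQuiver := ⟨fun x y => Gen x y⟩

/-- An object, as an object of the free category on the generators. -/
def Word.obj (x : Obj) : Paths GenQuiver := (Paths.of GenQuiver).obj x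

/-- A generator, as a morphism of the free category on the generators. -/
def Word.gen {x y : Obj} (g : Gen x y) : Word.obj x ⟶ Word.obj y := (Paths.of GenQuiver).map g

/-- The word `α_i`. -/
def Word.α {x y : Obj} (i : ℕ) (h : IsAlpha i x y) : Word.obj x ⟶ Word.obj y := gen (.alpha i h)

/-- The word `β_i`. -/
def Word.β {x y : Obj} (i : ℕ) (h : IsBeta i x y) : Word.obj x ⟶ Word.obj y := gen (.beta i h)

/-- The word `τ` on `[k + 1]`. -/
def Word.τ (k : ℕ) : Word.obj (.num k) ⟶ Word.obj (.num k) := gen (.tau k)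

/-- The words `δ₊` and `δ₋`. -/
def Word.δ (s : Sign) (x : Obj) : Word.obj x ⟶ Word.obj x := gen (.delta s x)

/-- The word `τ ^ r` on `[k + 1]`. -/
def Word.τpow (k : ℕ) : ℕ → (Word.obj (.num k) ⟶ Word.obj (.num k))
  | 0 => 𝟙 _
  | r + 1 => τpow k r ≫ τ k

open Word in
/-- The defining relations of `aΔ`. Note that `f ≫ g` is the composite `g ∘ f`, written `g f`. -/
inductive Rel : ∀ ⦃X Y : Paths GenQuiver⦄, (X ⟶ Y) → (X ⟶ Y) → Prop
  /-- `α_i α_j = α_{j-2} α_i` on `[n]` if `i < j - 1` and `(i, j) ≠ (1, 2 n)` -/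
  | alpha_alpha {x y z : Obj} (i j : ℕ) (hj : IsAlpha j x y) (hi : IsAlpha i y z)
      (hi2 : IsAlpha i x y) (hj2 : IsAlpha (j - 2) y z) (hij : i + 1 < j)
      (hne : ¬ (i = 1 ∧ j = 2 * x.size)) :
      Rel (α j hj ≫ α i hi) (α i hi2 ≫ α (j - 2) hj2)
  /-- `β_i β_j = β_{j+2} β_i` on `[n]` if `i ≤ j` and `(i, j) ≠ (1, 2 n + 2)` -/
  | beta_beta {x y z : Obj} (i j : ℕ) (hj : IsBeta j x y) (hi : IsBeta i y z)
      (hi2 : IsBeta i x y) (hj2 : IsBeta (j + 2) y z) (hij : i ≤ j)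
      (hne : ¬ (i = 1 ∧ j = 2 * x.size + 2)) :
      Rel (β j hj ≫ β i hi) (β i hi2 ≫ β (j + 2) hj2)
  /-- `τ ^ n = id` on `[n]` -/
  | tau_pow (k : ℕ) : Rel (τpow k (k + 1)) (𝟙 _)
  /-- `α_i τ = τ α_{i-2}` if `i ≥ 3` -/
  | alpha_tau (k i : ℕ) (hi : IsAlpha i (.num (k + 1)) (.num k))
      (hi2 : IsAlpha (i - 2) (.num (k + 1)) (.num k)) (h3 : 3 ≤ i) :
      Rel (τ (k + 1) ≫ α i hi) (α (i - 2) hi2 ≫ τ k)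
  /-- `β_i τ = τ β_{i-2}` if `i ≥ 3` -/
  | beta_tau (k i : ℕ) (hi : IsBeta i (.num k) (.num (k + 1)))
      (hi2 : IsBeta (i - 2) (.num k) (.num (k + 1))) (h3 : 3 ≤ i) :
      Rel (τ k ≫ β i hi) (β (i - 2) hi2 ≫ τ (k + 1))
  /-- `α_1 β_1 = δ₊` on `[0+]` -/
  | alpha_beta_plus (ha : IsAlpha 1 (.num 0) (.zero .plus)) (hb : IsBeta 1 (.zero .plus) (.num 0)) :
      Rel (β 1 hb ≫ α 1 ha) (δ .plus (.zero .plus))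
  /-- `α_2 β_2 = δ₋` on `[0-]` -/
  | alpha_beta_minus (ha : IsAlpha 2 (.num 0) (.zero .minus))
      (hb : IsBeta 2 (.zero .minus) (.num 0)) :
      Rel (β 2 hb ≫ α 2 ha) (δ .minus (.zero .minus))
  /-- `α_1 β_{2n+2} = τ⁻¹ = τ ^ (n - 1)` on `[n]`, `n = k + 1` -/
  | alpha_beta_first (k : ℕ) (ha : IsAlpha 1 (.num (k + 1)) (.num k))
      (hb : IsBeta (2 * (k + 1) + 2) (.num k) (.num (k + 1))) :
      Rel (β (2 * (k + 1) + 2) hb ≫ α 1 ha) (τpow k k)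
  /-- `α_i β_j = β_{j-2} α_i` on `[n]`, `n = k + 1`, if `i < j - 1` and
  `(i, j) ≠ (1, 2 n + 2)` -/
  | alpha_beta_lt (k i j : ℕ) {y : Obj} (ha : IsAlpha i (.num (k + 1)) (.num k))
      (hb : IsBeta j (.num k) (.num (k + 1))) (ha2 : IsAlpha i (.num k) y)
      (hb2 : IsBeta (j - 2) y (.num k)) (hij : i + 1 < j)
      (hne : ¬ (i = 1 ∧ j = 2 * (k + 1) + 2)) :
      Rel (β j hb ≫ α i ha) (α i ha2 ≫ β (j - 2) hb2)
  /-- `α_i β_j = id` on `[n]`, `n ≥ 1`, if `i = j - 1` -/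
  | alpha_beta_pred (k i j : ℕ) (ha : IsAlpha i (.num (k + 1)) (.num k))
      (hb : IsBeta j (.num k) (.num (k + 1))) (hij : i + 1 = j) :
      Rel (β j hb ≫ α i ha) (𝟙 _)
  /-- `α_i β_i = δ₊` on `[n]`, `n ≥ 1`, if `i` is odd -/
  | alpha_beta_odd (k i : ℕ) (ha : IsAlpha i (.num (k + 1)) (.num k))
      (hb : IsBeta i (.num k) (.num (k + 1))) (hi : Odd i) :
      Rel (β i hb ≫ α i ha) (δ .plus (.num k))
  /-- `α_i β_i = δ₋` on `[n]`, `n ≥ 1`, if `i` is even -/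
  | alpha_beta_even (k i : ℕ) (ha : IsAlpha i (.num (k + 1)) (.num k))
      (hb : IsBeta i (.num k) (.num (k + 1))) (hi : Even i) :
      Rel (β i hb ≫ α i ha) (δ .minus (.num k))
  /-- `α_i β_j = id` on `[n]`, `n ≥ 1`, if `i = j + 1` -/
  | alpha_beta_succ (k i j : ℕ) (ha : IsAlpha i (.num (k + 1)) (.num k))
      (hb : IsBeta j (.num k) (.num (k + 1))) (hij : i = j + 1) :
      Rel (β j hb ≫ α i ha) (𝟙 _)
  /-- `α_i β_j = β_j α_{i-2}` on `[n]`, `n = k + 1`, if `i > j + 1` and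
  `(i, j) ≠ (2 n + 2, 1)` -/
  | alpha_beta_gt (k i j : ℕ) {y : Obj} (ha : IsAlpha i (.num (k + 1)) (.num k))
      (hb : IsBeta j (.num k) (.num (k + 1))) (ha2 : IsAlpha (i - 2) (.num k) y)
      (hb2 : IsBeta j y (.num k)) (hij : j + 1 < i)
      (hne : ¬ (i = 2 * (k + 1) + 2 ∧ j = 1)) :
      Rel (β j hb ≫ α i ha) (α (i - 2) ha2 ≫ β j hb2)
  /-- `α_{2n+2} β_1 = τ` on `[n]`, `n = k + 1` -/
  | alpha_beta_last (k : ℕ) (ha : IsAlpha (2 * (k + 1) + 2) (.num (k + 1)) (.num k))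
      (hb : IsBeta 1 (.num k) (.num (k + 1))) :
      Rel (β 1 hb ≫ α (2 * (k + 1) + 2) ha) (τ k)
  /-- `δ₊` and `δ₋` commute with all generators -/
  | delta_comm (s : Sign) {x y : Obj} (g : Gen x y) :
      Rel (gen g ≫ δ s y) (δ s x ≫ gen g)

/-- The relations of `aΔ`. -/
def relations : HomRel (Paths GenQuiver) := fun _ _ v w => Rel v w

/-- The annular category: the category with the generators `Gen` and the relations `Rel`. -/
abbrev aΔ : Type := CategoryTheory.Quotient relations

/-- An object of `aΔ`. -/
def aΔ.obj (x : Obj) : aΔ := ⟨Word.obj x⟩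

/-- The morphism of `aΔ` that is represented by a word. -/
def aΔ.mk {x y : Obj} (w : Word.obj x ⟶ Word.obj y) : aΔ.obj x ⟶ aΔ.obj y :=
  (CategoryTheory.Quotient.functor relations).map w

theorem aΔ.mk_comp {x y z : Obj} (v : Word.obj x ⟶ Word.obj y) (w : Word.obj y ⟶ Word.obj z) :
    aΔ.mk (v ≫ w) = aΔ.mk v ≫ aΔ.mk w := rfl

theorem aΔ.mk_id (x : Obj) : aΔ.mk (𝟙 (Word.obj x)) = 𝟙 (aΔ.obj x) := rfl

theorem aΔ.sound {x y : Obj} {v w : Word.obj x ⟶ Word.obj y} (h : Rel v w) :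
    aΔ.mk v = aΔ.mk w := CategoryTheory.Quotient.sound relations h

/-! ### The involution of `aΔ` -/

theorem Word.τpow_add (k r s : ℕ) : Word.τpow k (r + s) = Word.τpow k r ≫ Word.τpow k s := by
  induction s with
  | zero => exact (Category.comp_id _).symm
  | succ s ih =>
    change Word.τpow k (r + s) ≫ Word.τ k = _ ≫ (Word.τpow k s ≫ Word.τ k)
    rw [ih, Category.assoc]

theorem Word.τpow_one (k : ℕ) : Word.τpow k 1 = Word.τ k := Category.id_comp _

theorem aΔ.τpow_mul (k r : ℕ) : aΔ.mk (Word.τpow k ((k + 1) * r)) = 𝟙 _ := by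
  induction r with
  | zero => rfl
  | succ r ih =>
    rw [Nat.mul_succ, Word.τpow_add, aΔ.mk_comp, ih, Category.id_comp, aΔ.sound (.tau_pow k)]
    rfl

theorem aΔ.τpow_sq (k : ℕ) : aΔ.mk (Word.τpow k (k * k)) = aΔ.mk (Word.τ k) := by
  have h1 : aΔ.mk (Word.τpow k (k * k + (k + 1))) = aΔ.mk (Word.τpow k (k * k)) := by
    rw [Word.τpow_add, aΔ.mk_comp, aΔ.sound (.tau_pow k), aΔ.mk_id, Category.comp_id]
  have h2 : k * k + (k + 1) = (k + 1) * k + 1 := by ring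
  rw [← h1, h2, Word.τpow_add, aΔ.mk_comp, aΔ.τpow_mul, Category.id_comp, Word.τpow_one]

theorem aΔ.τ_inv (k : ℕ) : aΔ.mk (Word.τ k) ≫ aΔ.mk (Word.τpow k k) = 𝟙 _ := by
  rw [← Word.τpow_one, ← aΔ.mk_comp, ← Word.τpow_add, Nat.add_comm, aΔ.sound (.tau_pow k)]
  rfl

theorem aΔ.inv_τ (k : ℕ) : aΔ.mk (Word.τpow k k) ≫ aΔ.mk (Word.τ k) = 𝟙 _ :=
  aΔ.sound (.tau_pow k)

/-- The word `g*` for a generator `g`: `α_i* = β_i`, `β_i* = α_i`, `τ* = τ⁻¹ = τ ^ (n - 1)` on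
`[n]`, and `δ* = δ`. -/
def Word.starGen {x y : Obj} : Gen x y → (Word.obj y ⟶ Word.obj x)
  | .alpha i h => Word.β i h
  | .beta i h => Word.α i h
  | .tau k => Word.τpow k k
  | .delta s x => Word.δ s x

theorem aΔ.delta_starGen (s : Sign) {x y : Obj} (g : Gen x y) :
    aΔ.mk (Word.δ s y) ≫ aΔ.mk (Word.starGen g) =
      aΔ.mk (Word.starGen g) ≫ aΔ.mk (Word.δ s x) := by
  have h : ∀ {x y : Obj} (g : Gen x y), aΔ.mk (Word.δ s x) ≫ aΔ.mk (Word.gen g) =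
      aΔ.mk (Word.gen g) ≫ aΔ.mk (Word.δ s y) := fun g => (aΔ.sound (.delta_comm s g)).symm
  have h2 : ∀ k r, aΔ.mk (Word.δ s (.num k)) ≫ aΔ.mk (Word.τpow k r) =
      aΔ.mk (Word.τpow k r) ≫ aΔ.mk (Word.δ s (.num k)) := by
    intro k r
    induction r with
    | zero => exact (Category.comp_id _).trans (Category.id_comp _).symm
    | succ r ih =>
      change _ ≫ aΔ.mk (Word.τpow k r) ≫ aΔ.mk (Word.gen (.tau k)) =
        (aΔ.mk (Word.τpow k r) ≫ aΔ.mk (Word.gen (.tau k))) ≫ _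
      rw [← Category.assoc, ih, Category.assoc, h, Category.assoc]
  cases g with
  | alpha i hi => exact h (.beta i hi)
  | beta i hi => exact h (.alpha i hi)
  | tau k => exact h2 k k
  | delta r x => exact h (.delta r x)

/-- The contravariant functor on words with `(h_r ⋯ h_1)* = h_1* ⋯ h_r*`. -/
def Word.star : Paths GenQuiver ⥤ aΔᵒᵖ :=
  Paths.lift
    { obj := fun (x : GenQuiver) => Opposite.op (aΔ.obj x)
      map := fun {x y : GenQuiver} (g : x ⟶ y) =>
        (aΔ.mk (Word.starGen (x := x) (y := y) g)).op }

theorem Word.star_gen {x y : Obj} (g : Gen x y) :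
    Word.star.map (Word.gen g) = (aΔ.mk (Word.starGen g)).op :=
  Category.id_comp _

theorem Word.star_comp {x y z : Obj} (v : Word.obj x ⟶ Word.obj y)
    (w : Word.obj y ⟶ Word.obj z) :
    (Word.star.map (v ≫ w)).unop = (Word.star.map w).unop ≫ (Word.star.map v).unop := by
  rw [Functor.map_comp]
  rfl

theorem Word.star_τpow (k r : ℕ) :
    Word.star.map (Word.τpow k r) = (aΔ.mk (Word.τpow k (k * r))).op := by
  induction r with
  | zero => rfl
  | succ r ih =>
    apply Quiver.Hom.unop_inj
    change (Word.star.map (Word.τpow k r ≫ Word.gen (.tau k))).unop = _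
    rw [Word.star_comp, Word.star_gen, ih, Nat.mul_succ, Nat.add_comm, Word.τpow_add]
    rfl

theorem Word.star_rel (X Y : Paths GenQuiver) (v w : X ⟶ Y) (h : relations v w) :
    Word.star.map v = Word.star.map w := by
  apply Quiver.Hom.unop_inj
  have hα : ∀ {x y : Obj} (i : ℕ) (h : IsAlpha i x y),
    Word.star.map (Word.α i h) = (aΔ.mk (Word.β i h)).op := fun i h => Word.star_gen (.alpha i h)
  have hβ : ∀ {x y : Obj} (i : ℕ) (h : IsBeta i x y),
    Word.star.map (Word.β i h) = (aΔ.mk (Word.α i h)).op := fun i h => Word.star_gen (.beta i h)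
  have hδ : ∀ (s : Sign) (x : Obj),
    Word.star.map (Word.δ s x) = (aΔ.mk (Word.δ s x)).op := fun s x => Word.star_gen (.delta s x)
  have hτ : ∀ k, Word.star.map (Word.τ k) = (aΔ.mk (Word.τpow k k)).op :=
    fun k => Word.star_gen (.tau k)
  cases h with
  | alpha_alpha i j hj hi hi2 hj2 hij hne =>
    obtain ⟨j, rfl⟩ : ∃ l, j = l + 2 := ⟨j - 2, by omega⟩
    have b1 := hi.bounds
    have b2 := hi2.bounds
    rw [Word.star_comp, Word.star_comp, hα, hα, hα, hα]
    exact (aΔ.sound (.beta_beta i j hj2 hi2 hi hj (by omega) (by omega))).symm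
  | beta_beta i j hj hi hi2 hj2 hij hne =>
    have b1 := hi.bounds
    have b2 := hi2.bounds
    rw [Word.star_comp, Word.star_comp, hβ, hβ, hβ, hβ]
    exact (aΔ.sound (.alpha_alpha i (j + 2) hj2 hi2 hi hj (by omega) (by omega))).symm
  | tau_pow k =>
    rw [Word.star_τpow, Nat.mul_comm]
    exact aΔ.τpow_mul k k
  | alpha_tau k i hi hi2 h3 =>
    rw [Word.star_comp, Word.star_comp, hα, hα, hτ, hτ]
    have h := aΔ.sound (.beta_tau k i hi hi2 h3)
    rw [aΔ.mk_comp, aΔ.mk_comp] at h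
    change aΔ.mk (Word.β i hi) ≫ aΔ.mk (Word.τpow (k + 1) (k + 1)) =
      aΔ.mk (Word.τpow k k) ≫ aΔ.mk (Word.β (i - 2) hi2)
    rw [← Category.id_comp (aΔ.mk (Word.β i hi)), ← aΔ.inv_τ k, Category.assoc, Category.assoc,
      ← Category.assoc (aΔ.mk (Word.τ k)), h, Category.assoc, aΔ.τ_inv, Category.comp_id]
  | beta_tau k i hi hi2 h3 =>
    rw [Word.star_comp, Word.star_comp, hβ, hβ, hτ, hτ]
    have h := aΔ.sound (.alpha_tau k i hi hi2 h3)
    rw [aΔ.mk_comp, aΔ.mk_comp] at h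
    change aΔ.mk (Word.α i hi) ≫ aΔ.mk (Word.τpow k k) =
      aΔ.mk (Word.τpow (k + 1) (k + 1)) ≫ aΔ.mk (Word.α (i - 2) hi2)
    rw [← Category.id_comp (aΔ.mk (Word.α i hi)), ← aΔ.inv_τ (k + 1), Category.assoc,
      Category.assoc, ← Category.assoc (aΔ.mk (Word.τ (k + 1))), h, Category.assoc, aΔ.τ_inv,
      Category.comp_id]
  | alpha_beta_plus ha hb =>
    rw [Word.star_comp, hα, hβ, hδ]
    exact aΔ.sound (.alpha_beta_plus ha hb)
  | alpha_beta_minus ha hb =>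
    rw [Word.star_comp, hα, hβ, hδ]
    exact aΔ.sound (.alpha_beta_minus ha hb)
  | alpha_beta_first k ha hb =>
    rw [Word.star_comp, hα, hβ, Word.star_τpow]
    exact (aΔ.sound (.alpha_beta_last k hb ha)).trans (aΔ.τpow_sq k).symm
  | alpha_beta_lt k i j ha hb ha2 hb2 hij hne =>
    rw [Word.star_comp, Word.star_comp, hα, hβ, hα, hβ]
    exact aΔ.sound (.alpha_beta_gt k j i hb ha hb2 ha2 hij (by tauto))
  | alpha_beta_pred k i j ha hb hij =>
    rw [Word.star_comp, hα, hβ]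
    exact aΔ.sound (.alpha_beta_succ k j i hb ha hij.symm)
  | alpha_beta_odd k i ha hb hi =>
    rw [Word.star_comp, hα, hβ, hδ]
    exact aΔ.sound (.alpha_beta_odd k i hb ha hi)
  | alpha_beta_even k i ha hb hi =>
    rw [Word.star_comp, hα, hβ, hδ]
    exact aΔ.sound (.alpha_beta_even k i hb ha hi)
  | alpha_beta_succ k i j ha hb hij =>
    rw [Word.star_comp, hα, hβ]
    exact aΔ.sound (.alpha_beta_pred k j i hb ha hij.symm)
  | alpha_beta_gt k i j ha hb ha2 hb2 hij hne =>
    rw [Word.star_comp, Word.star_comp, hα, hβ, hα, hβ]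
    exact aΔ.sound (.alpha_beta_lt k j i hb ha hb2 ha2 hij (by tauto))
  | alpha_beta_last k ha hb =>
    rw [Word.star_comp, hα, hβ, hτ]
    exact aΔ.sound (.alpha_beta_first k hb ha)
  | delta_comm s g =>
    rw [Word.star_comp, Word.star_comp, Word.star_gen, hδ, hδ]
    exact aΔ.delta_starGen s g

/-- The involution of `aΔ`, as a contravariant functor. -/
def aΔ.starFunctor : aΔ ⥤ aΔᵒᵖ := CategoryTheory.Quotient.lift relations Word.star Word.star_rel

theorem aΔ.starFunctor_star {X Y : aΔ} (f : X ⟶ Y) :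
    (aΔ.starFunctor.map (aΔ.starFunctor.map f).unop).unop = f := by
  have key : ∀ {x y : Obj} (g : Gen x y),
      (aΔ.starFunctor.map (aΔ.mk (Word.starGen g))).unop = aΔ.mk (Word.gen g) := by
    intro x y g
    change (Word.star.map (Word.starGen g)).unop = _
    cases g with
    | alpha i h => exact congrArg Quiver.Hom.unop (Word.star_gen (.beta i h))
    | beta i h => exact congrArg Quiver.Hom.unop (Word.star_gen (.alpha i h))
    | tau k =>
      change (Word.star.map (Word.τpow k k)).unop = _
      rw [Word.star_τpow]
      exact aΔ.τpow_sq k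
    | delta s x => exact congrArg Quiver.Hom.unop (Word.star_gen (.delta s x))
  have hcomp : ∀ {X Y Z : aΔ} (f : X ⟶ Y) (g : Y ⟶ Z), (aΔ.starFunctor.map (f ≫ g)).unop =
      (aΔ.starFunctor.map g).unop ≫ (aΔ.starFunctor.map f).unop :=
    fun f g => congrArg Quiver.Hom.unop (aΔ.starFunctor.map_comp f g)
  have main : ∀ {x y : Obj} (w : @Quiver.Path GenQuiver _ x y),
      (aΔ.starFunctor.map (aΔ.starFunctor.map (aΔ.mk (x := x) (y := y) w)).unop).unop =
        aΔ.mk w := by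
    intro x y w
    induction w with
    | nil => rfl
    | @cons b c p g ih =>
      have h1 : (aΔ.starFunctor.map (aΔ.mk (Word.gen (x := b) (y := c) g))).unop =
          aΔ.mk (Word.starGen (x := b) (y := c) g) := congrArg Quiver.Hom.unop (Word.star_gen _)
      change (aΔ.starFunctor.map (aΔ.starFunctor.map
        (aΔ.mk (x := x) (y := b) p ≫ aΔ.mk (Word.gen (x := b) (y := c) g))).unop).unop =
          aΔ.mk (x := x) (y := b) p ≫ aΔ.mk (Word.gen (x := b) (y := c) g)
      rw [hcomp, h1]
      refine (hcomp (aΔ.mk (Word.starGen (x := b) (y := c) g)) _).trans ?_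
      rw [key]
      exact congrArg (· ≫ _) ih
  obtain ⟨X⟩ := X
  obtain ⟨Y⟩ := Y
  obtain ⟨w⟩ := f
  exact main w

/-- The involution of `aΔ`. -/
instance : InvolutiveCategory aΔ where
  star f := (aΔ.starFunctor.map f).unop
  star_id X := congrArg Quiver.Hom.unop (aΔ.starFunctor.map_id X)
  star_star f := aΔ.starFunctor_star f
  star_comp f g := congrArg Quiver.Hom.unop (aΔ.starFunctor.map_comp f g)

/-! ## The functor `F` -/

/-- The images in `Atl` of the generators of `aΔ`: `α_i ↦ a_i`, `β_i ↦ b_i = a_i*`, `τ ↦ t`,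
`δ₊ ↦ (id, 1, 0)` and `δ₋ ↦ (id, 0, 1)`. For `b_i` from `[n]` to `[n + 1]`, the `i`-th and the
`(i + 1)`-th (modulo `2 n + 2`) external points are joined, and all internal points are joined to
external points such that the first internal point is joined to the external point with number `3`
if `i = 1`, number `1` if `1 < i < 2 n + 2`, and number `2 n + 1` if `i = 2 n + 2`. -/
def genImage {x y : Obj} : Gen x y → AtlHom x y
  | .alpha _ h => ⟨⟦.a h⟧, 0, 0⟩
  | .beta _ h => ⟨⟦(LiftedTangle.a h).star⟧, 0, 0⟩
  | .tau k => ⟨⟦.t (.num k) (Nat.le_add_left 1 k)⟧, 0, 0⟩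
  | .delta .plus x => ⟨⟦.idt x⟧, 1, 0⟩
  | .delta .minus x => ⟨⟦.idt x⟧, 0, 1⟩

/-- The functor from words to `Atl` which is given on generators by `genImage` and fixes the
objects. -/
def wordFunctor (C : AtlComposition) : Paths GenQuiver ⥤ Atl C :=
  Paths.lift
    { obj := fun (x : GenQuiver) => x
      map := fun {x y : GenQuiver} (g : x ⟶ y) => genImage (x := x) (y := y) g }

/-- The relations of `aΔ` hold in `Atl`. -/
def RelationsHold (C : AtlComposition) : Prop :=
  ∀ (X Y : Paths GenQuiver) (v w : X ⟶ Y), Rel v w →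
    (wordFunctor C).map v = (wordFunctor C).map w

/-- The functor `F : aΔ ⥤ Atl`. -/
def functorF (C : AtlComposition) (H : RelationsHold C) : aΔ ⥤ Atl C :=
  CategoryTheory.Quotient.lift relations (wordFunctor C) H

/-- A functor is an isomorphism of categories. -/
def IsIsomorphism {A B : Type} [Category.{0} A] [Category.{0} B] (F : A ⥤ B) : Prop :=
  ∃ G : B ⥤ A, F ⋙ G = 𝟭 A ∧ G ⋙ F = 𝟭 B

/-- A functor preserves the involutions. -/
def IsInvolutive {A B : Type} [Category.{0} A] [Category.{0} B] [InvolutiveCategory A]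
    [InvolutiveCategory B] (F : A ⥤ B) : Prop :=
  ∀ {X Y : A} (f : X ⟶ Y),
    F.map (InvolutiveCategory.star f) = InvolutiveCategory.star (F.map f)

end AnnularTL

namespace AnnularTL

/-! ## Orders and shifts -/

/-! The strings of a composite are the paths in the union of two matchings: the strings of `T` and
those of `S`, on the lifted points of three circles. A component of such a graph has at most two
ends (`eq_of_ends`), so the composite is determined by connectivity alone, and twists of the factors
act on the whole picture (`IsReducedComposite.equivalent`). This gives uniqueness and independence
of representatives.

Associativity compares both bracketings with the graph of all three tangles
(`isReducedComposite_iff_connected₃`, `isReducedComposite_assoc`). A loop of that graph either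
misses the second circle, and is removed in the first composition, or meets it, and is removed in
the second (`ncard_loopSet_add`). The shading of a contractible loop is read off its leftmost
intersection with a circle, so both circles must give the same answer. This is a parity argument
(`even_first_iff`): the rank of an intersection point plus its number, modulo 2, is constant along
the loop.

Existence of composites is not shown by checking planarity of paths. Instead, tangles are cut into
pieces: a string that returns to its circle encloses an innermost one, which joins neighbours and
can be peeled off (`exists_cap`), and a tangle with only through strings is a rotation, or consists
of loops between circles without points (`LiftedTangle.IsThrough.exists_add`). Composition with
`b_i` is insertion of a cap, and composition with a rotation is explicit. For `a_i` one needs the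
table of the products of `b_j` with `a_i`, which is also the main part of the relations.
Associativity propagates existence to products (`IsReducedComposite.isComposable`), and induction on
the number of marked points gives all composites (`LiftedTangle.isComposable`).

For the presentation, the relations rewrite every morphism of `aΔ` as some `α`s, then a core
(factors `τ`, `δ` and loop factors on `[0±]`), then some `β`s (`aΔ.isNormal`). No unique normal form
is needed. If the image of a morphism has an external cap, the commutation of the `β`s produces a
factorization that ends in the corresponding `β` (`aΔ.IsNormal.exists_comp_β`), and composition with
`b_i` can be cancelled (`comp_b_injective`). With reflection for internal caps, faithfulness reduces
to cores, which are classified by the exponents of `δ₊`, `δ₋` and by a rotation number or a number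
of loops. Fullness is the peeling of caps again. Since `F` is the identity on objects, its inverse
consists of the unique preimages. -/

theorem Pt.lt_irrefl {n : ℕ} (p : Pt n) : ¬ p.lt p := by simp [Pt.lt]

theorem Pt.lt_trans {n : ℕ} {p q r : Pt n} (h1 : p.lt q) (h2 : q.lt r) : p.lt r := by
  simp only [Pt.lt] at *; omega

theorem Pt.lt_trichotomy {n : ℕ} (p q : Pt n) : p.lt q ∨ p = q ∨ q.lt p := by
  simp only [Pt.lt, Pt.ext_iff]; omega

theorem Pt.shift_lt_shift {n : ℕ} (k : ℤ) (p q : Pt n) : (p.shift k).lt (q.shift k) ↔ p.lt q := by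
  simp [Pt.lt, Pt.shift]

theorem Pt.shift_neg_shift {n : ℕ} (k : ℤ) (p : Pt n) : (p.shift (-k)).shift k = p := by
  rw [Pt.shift_shift, neg_add_cancel, Pt.shift_zero]

theorem Pt.shift_shift_neg {n : ℕ} (k : ℤ) (p : Pt n) : (p.shift k).shift (-k) = p := by
  rw [Pt.shift_shift, add_neg_cancel, Pt.shift_zero]

theorem Pt.eq_shift_of_idx_eq {n : ℕ} {p q : Pt n} (h : p.idx = q.idx) :
    q = p.shift (q.sheet - p.sheet) := by
  ext
  · simp [Pt.shift]
  · exact h.symm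

theorem Bd.lt_irrefl {m n : ℕ} (u : Bd m n) : ¬ u.lt u := by
  rcases u with p | p <;> exact Pt.lt_irrefl p

theorem Bd.lt_trans {m n : ℕ} {u v w : Bd m n} (h1 : u.lt v) (h2 : v.lt w) : u.lt w := by
  rcases u with p | p <;> rcases v with q | q <;> rcases w with r | r <;>
    simp only [Bd.lt] at * <;> first | exact Pt.lt_trans h1 h2 | exact Pt.lt_trans h2 h1

theorem Bd.lt_trichotomy {m n : ℕ} (u v : Bd m n) : u.lt v ∨ u = v ∨ v.lt u := by
  rcases u with p | p <;> rcases v with q | q <;> simp only [Bd.lt] <;> try simp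
  · exact Pt.lt_trichotomy p q
  · rcases Pt.lt_trichotomy p q with h | h | h <;> simp [h]

theorem LiftedTangle.other_injective {x y : Obj} (T : LiftedTangle x y) :
    Function.Injective T.other := fun u v h => by rw [← T.other_other u, h, T.other_other]

theorem LiftedTangle.other_eq_comm {x y : Obj} (T : LiftedTangle x y) {u v : Bd x.size y.size} :
    T.other u = v ↔ T.other v = u :=
  ⟨fun h => by rw [← h, T.other_other], fun h => by rw [← h, T.other_other]⟩

@[ext]
theorem LiftedTangle.ext {x y : Obj} {T U : LiftedTangle x y} (h : T.other = U.other)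
    (hl : T.loops = U.loops) : T = U := by
  cases T; cases U; cases h; cases hl; rfl

/-- A string that starts between the ends of another string also ends there. -/
theorem LiftedTangle.other_between {x y : Obj} (T : LiftedTangle x y) {u v : Bd x.size y.size}
    (h1 : u.lt v) (h2 : v.lt (T.other u)) : u.lt (T.other v) ∧ (T.other v).lt (T.other u) := by
  constructor
  · rcases Bd.lt_trichotomy u (T.other v) with h | h | h
    · exact h
    · rw [h, T.other_other] at h2
      exact absurd h2 (Bd.lt_irrefl _)
    · have := T.planar (T.other v) u h (by rwa [T.other_other])
      rw [T.other_other] at this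
      exact absurd h2 this
  · rcases Bd.lt_trichotomy (T.other v) (T.other u) with h | h | h
    · exact h
    · rw [T.other_injective h] at h1
      exact absurd h1 (Bd.lt_irrefl _)
    · exact absurd h (T.planar u v h1 h2)

/-! ## Components of the picture of a composite -/

theorem reflTransGen_map {V W : Type} {r : V → V → Prop} {s : W → W → Prop} (f : V → W)
    (h : ∀ a b, r a b → s (f a) (f b)) {a b : V} (hab : Relation.ReflTransGen r a b) :
    Relation.ReflTransGen s (f a) (f b) := by
  induction hab with
  | refl => exact .refl
  | tail _ h2 ih => exact ih.tail (h _ _ h2)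

/-- A component of the union of two partial matchings has at most two ends. -/
theorem eq_of_ends {V : Type} {f g : V → V} (hf : ∀ v, f (f v) = v) (hg : ∀ v, g (g v) = v)
    {u v w : V} (hu : f u = u ∨ g u = u) (hv : f v = v ∨ g v = v) (hw : f w = w ∨ g w = w)
    (huv : Relation.ReflTransGen (fun a b => b = f a ∨ b = g a) u v)
    (huw : Relation.ReflTransGen (fun a b => b = f a ∨ b = g a) u w)
    (hvu : v ≠ u) (hwu : w ≠ u) : v = w := by
  wlog hgu : g u = u generalizing f g
  · have e : (fun a b => b = f a ∨ b = g a) = (fun a b => b = g a ∨ b = f a) := by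
      funext a b; exact propext or_comm
    rw [e] at huv huw
    exact this hg hf hu.symm hv.symm hw.symm huv huw (by tauto)
  -- The walk from `u` that applies `f` and `g` in turn. It starts with `f` because `g` fixes `u`.
  let s : ℕ → V := fun k => Nat.rec u (fun k a => if Even k then f a else g a) k
  have s0 : s 0 = u := rfl
  have se : ∀ k, Even k → s (k + 1) = f (s k) := fun k hk => if_pos hk
  have so : ∀ k, ¬ Even k → s (k + 1) = g (s k) := fun k hk => if_neg hk
  have key : ∀ W : Set V, u ∈ W → (∀ a ∈ W, f a ∈ W) → (∀ a ∈ W, g a ∈ W) →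
      ∀ a, Relation.ReflTransGen (fun a b => b = f a ∨ b = g a) u a → a ∈ W := by
    intro W h0 h1 h2 a ha
    induction ha with
    | refl => exact h0
    | tail _ h ih => rcases h with rfl | rfl <;> [exact h1 _ ih; exact h2 _ ih]
  have stepf : ∀ k, f (s k) = s (k + 1) ∨ ∃ j, k = j + 1 ∧ f (s k) = s j := by
    intro k
    by_cases hk : Even k
    · exact Or.inl (se k hk).symm
    · obtain ⟨j, rfl⟩ : ∃ j, k = j + 1 := ⟨k - 1, by rcases k with _ | k <;> simp_all⟩
      exact Or.inr ⟨j, rfl, by rw [se j (by simpa [Nat.even_add_one] using hk), hf]⟩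
  have stepg : ∀ k, g (s k) = s (k + 1) ∨ g (s k) = s k ∧ k = 0 ∨ ∃ j, k = j + 1 ∧ g (s k) = s j := by
    intro k
    by_cases hk : Even k
    · rcases k with _ | j
      · exact Or.inr (Or.inl ⟨hgu, rfl⟩)
      · exact Or.inr (Or.inr ⟨j, rfl, by rw [so j (by simpa [Nat.even_add_one] using hk), hg]⟩)
    · exact Or.inl (so k hk).symm
  have hr : ∀ a, Relation.ReflTransGen (fun a b => b = f a ∨ b = g a) u a → ∃ k, s k = a := by
    refine key {a | ∃ k, s k = a} ⟨0, rfl⟩ ?_ ?_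
    · rintro _ ⟨k, rfl⟩
      rcases stepf k with h | ⟨j, -, h⟩
      exacts [⟨k + 1, h.symm⟩, ⟨j, h.symm⟩]
    · rintro _ ⟨k, rfl⟩
      rcases stepg k with h | ⟨h, -⟩ | ⟨j, -, h⟩
      exacts [⟨k + 1, h.symm⟩, ⟨k, h.symm⟩, ⟨j, h.symm⟩]
  have hex : ∃ k, s k ≠ u ∧ (f (s k) = s k ∨ g (s k) = s k) := by
    obtain ⟨k, rfl⟩ := hr v huv
    exact ⟨k, hvu, hv⟩
  -- The first time the walk reaches an end other than `u`.
  obtain ⟨k, ⟨hku, hkb⟩, hmin0⟩ : ∃ k, (s k ≠ u ∧ (f (s k) = s k ∨ g (s k) = s k)) ∧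
      ∀ j < k, ¬ (s j ≠ u ∧ (f (s j) = s j ∨ g (s j) = s j)) :=
    let ⟨k, hk, hm⟩ := Nat.lt_wfRel.wf.has_min
      {k | s k ≠ u ∧ (f (s k) = s k ∨ g (s k) = s k)} hex
    ⟨k, hk, fun j hj h => hm j h hj⟩
  have hmin : ∀ j, j < k → s j ≠ u → ¬ (f (s j) = s j ∨ g (s j) = s j) := fun j hj h1 h2 =>
    hmin0 j hj ⟨h1, h2⟩
  obtain ⟨l, hl⟩ : ∃ l, k = l + 1 := ⟨k - 1, by
    rcases hk0 : k with _ | k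
    · rw [hk0] at hku; exact absurd rfl hku
    · rfl⟩
  -- The walk stands still at `s k`: if the involution by which it arrived fixed `s k`, then `s k`
  -- would equal its predecessor, against minimality. So the other involution, which is the next
  -- one, fixes it.
  have hnext : s (k + 1) = s k := by
    by_cases hke : Even k
    · rw [se k hke]
      rcases hkb with h | h
      · exact h
      · have h2 : s k = s l := by
          rw [← h]; nth_rw 1 [hl]; rw [so l (by rw [hl] at hke; simpa [Nat.even_add_one] using hke), hg]
        exact absurd (Or.inr (h2 ▸ h)) (hmin l (by omega) (h2 ▸ hku))
    · rw [so k hke]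
      rcases hkb with h | h
      · have h2 : s k = s l := by
          rw [← h]; nth_rw 1 [hl]; rw [se l (by rw [hl] at hke; simpa [Nat.even_add_one] using hke), hf]
        exact absurd (Or.inl (h2 ▸ h)) (hmin l (by omega) (h2 ▸ hku))
      · exact h
  -- Hence the first `k + 1` positions are closed under `f` and `g` and exhaust the component. By
  -- minimality `s k` is its only end besides `u`.
  have hW := key {a | ∃ j ≤ k, s j = a} ⟨0, by omega, rfl⟩ (by
    rintro _ ⟨j, hj, rfl⟩
    rcases stepf j with h | ⟨i, rfl, h⟩
    · rcases Nat.lt_or_ge j k with h2 | h2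
      · exact ⟨j + 1, h2, h.symm⟩
      · obtain rfl : j = k := le_antisymm hj h2
        exact ⟨_, le_rfl, by rw [h, hnext]⟩
    · exact ⟨i, by omega, h.symm⟩) (by
    rintro _ ⟨j, hj, rfl⟩
    rcases stepg j with h | ⟨h, -⟩ | ⟨i, rfl, h⟩
    · rcases Nat.lt_or_ge j k with h2 | h2
      · exact ⟨j + 1, h2, h.symm⟩
      · obtain rfl : j = k := le_antisymm hj h2
        exact ⟨_, le_rfl, by rw [h, hnext]⟩
    · exact ⟨j, hj, h.symm⟩
    · exact ⟨i, by omega, h.symm⟩)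
  have hfin : ∀ a, Relation.ReflTransGen (fun a b => b = f a ∨ b = g a) u a → a ≠ u →
      (f a = a ∨ g a = a) → a = s k := by
    intro a h1 h2 h3
    obtain ⟨j, hj, rfl⟩ := hW a h1
    rcases Nat.lt_or_ge j k with h4 | h4
    · exact absurd h3 (hmin j h4 h2)
    · rw [le_antisymm hj h4]
  rw [hfin v huv hvu hv, hfin w huw hwu hw]

/-! ### The picture of a composite as two involutions of one set of points -/

section Composition

variable {x y z : Obj} (T : LiftedTangle x y) (S : LiftedTangle y z)

/-- The strings of the inside tangle as an involution of all points. -/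
def Node.actInside : Node x.size y.size z.size → Node x.size y.size z.size
  | .inner p => .ofInside _ (T.other (.inl p))
  | .mid p => .ofInside _ (T.other (.inr p))
  | .outer p => .outer p

/-- The strings of the outside tangle as an involution of all points. -/
def Node.actOutside : Node x.size y.size z.size → Node x.size y.size z.size
  | .inner p => .inner p
  | .mid p => .ofOutside _ (S.other (.inl p))
  | .outer p => .ofOutside _ (S.other (.inr p))

theorem Node.actInside_ofInside (u : Bd x.size y.size) :
    Node.actInside (z := z) T (.ofInside _ u) = .ofInside _ (T.other u) := by
  rcases u with p | p <;> rfl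

theorem Node.actOutside_ofOutside (u : Bd y.size z.size) :
    Node.actOutside (x := x) S (.ofOutside _ u) = .ofOutside _ (S.other u) := by
  rcases u with p | p <;> rfl

theorem Node.actInside_actInside (a : Node x.size y.size z.size) :
    Node.actInside T (Node.actInside T a) = a := by
  rcases a with p | p | p
  · exact (Node.actInside_ofInside T _).trans (by rw [T.other_other]; rfl)
  · exact (Node.actInside_ofInside T _).trans (by rw [T.other_other]; rfl)
  · rfl

theorem Node.actOutside_actOutside (a : Node x.size y.size z.size) :
    Node.actOutside S (Node.actOutside S a) = a := by
  rcases a with p | p | p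
  · rfl
  · exact (Node.actOutside_ofOutside S _).trans (by rw [S.other_other]; rfl)
  · exact (Node.actOutside_ofOutside S _).trans (by rw [S.other_other]; rfl)

variable {T S}

theorem Joined.symm {a b : Node x.size y.size z.size} (h : Joined T S a b) : Joined T S b a := by
  cases h with
  | inside u => simpa only [T.other_other] using Joined.inside (T := T) (S := S) (T.other u)
  | outside u => simpa only [S.other_other] using Joined.outside (T := T) (S := S) (S.other u)

theorem Connected.symm {a b : Node x.size y.size z.size} (h : Connected T S a b) :
    Connected T S b a := by
  induction h with
  | refl => exact .refl
  | tail _ h ih => exact .head h.symm ih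

theorem Connected.trans {a b c : Node x.size y.size z.size} (h : Connected T S a b)
    (h2 : Connected T S b c) : Connected T S a c := Relation.ReflTransGen.trans h h2

theorem Connected.refl (a : Node x.size y.size z.size) : Connected T S a a :=
  Relation.ReflTransGen.refl

theorem Connected.inside (u : Bd x.size y.size) :
    Connected T S (.ofInside _ u) (.ofInside _ (T.other u)) := .single (.inside u)

theorem Connected.outside (u : Bd y.size z.size) :
    Connected T S (.ofOutside _ u) (.ofOutside _ (S.other u)) := .single (.outside u)

/-- Internal points are fixed by `actOutside` and external ones by `actInside`, so the boundary
points are ends of components of the union of the two matchings. -/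
theorem Connected.eq_of_ends {u v w : Bd x.size z.size}
    (h1 : Connected T S (.ofBoundary _ u) (.ofBoundary _ v))
    (h2 : Connected T S (.ofBoundary _ u) (.ofBoundary _ w)) (hv : v ≠ u) (hw : w ≠ u) :
    v = w := by
  have inj : ∀ {v w : Bd x.size z.size},
      Node.ofBoundary y.size v = Node.ofBoundary y.size w → v = w := by
    rintro (v | v) (w | w) h <;> cases h <;> rfl
  have e : ∀ v : Bd x.size z.size, Node.actInside T (.ofBoundary y.size v) = .ofBoundary _ v ∨
      Node.actOutside S (.ofBoundary y.size v) = .ofBoundary _ v := by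
    rintro (v | v)
    · exact Or.inr rfl
    · exact Or.inl rfl
  have m : ∀ a b, Joined T S a b → b = Node.actInside T a ∨ b = Node.actOutside S a := by
    intro a b h
    cases h with
    | inside u => exact Or.inl (Node.actInside_ofInside T u).symm
    | outside u => exact Or.inr (Node.actOutside_ofOutside S u).symm
  exact inj (AnnularTL.eq_of_ends (Node.actInside_actInside T) (Node.actOutside_actOutside S)
    (e u) (e v) (e w) (reflTransGen_map id m h1) (reflTransGen_map id m h2)
    (fun h => hv (inj h)) (fun h => hw (inj h)))

/-- A tangle is the reduced composite as soon as its strings lie on the curves of the picture. -/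
theorem IsReducedComposite.of_connected {R : LiftedTangle x z}
    (h : ∀ u, Connected T S (.ofBoundary _ u) (.ofBoundary _ (R.other u)))
    (hl : R.loops = T.loops + S.loops + (nonContractibleLoops T S).ncard) :
    IsReducedComposite T S R := by
  refine ⟨fun u v => ⟨?_, ?_⟩, hl⟩
  · rintro rfl
    exact ⟨(R.other_ne u).symm, h u⟩
  · rintro ⟨h1, h2⟩
    exact (h u).eq_of_ends h2 (R.other_ne u) h1.symm

theorem IsReducedComposite.connected {R : LiftedTangle x z} (h : IsReducedComposite T S R)
    (u : Bd x.size z.size) : Connected T S (.ofBoundary _ u) (.ofBoundary _ (R.other u)) :=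
  ((h.1 u _).1 rfl).2

/-- The deck transformation of the picture of a composite. -/
def Node.shift {l m n : ℕ} (k : ℤ) : Node l m n → Node l m n
  | .inner p => .inner (p.shift k)
  | .mid p => .mid (p.shift k)
  | .outer p => .outer (p.shift k)

theorem Joined.shift (k : ℤ) {a b : Node x.size y.size z.size} (h : Joined T S a b) :
    Joined T S (a.shift k) (b.shift k) := by
  have e1 : ∀ u : Bd x.size y.size,
      (Node.ofInside z.size u).shift k = .ofInside _ (u.shift k) := by rintro (u | u) <;> rfl
  have e2 : ∀ u : Bd y.size z.size,
      (Node.ofOutside x.size u).shift k = .ofOutside _ (u.shift k) := by rintro (u | u) <;> rfl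
  cases h with
  | inside u => rw [e1, e1, ← T.other_shift]; exact .inside _
  | outside u => rw [e2, e2, ← S.other_shift]; exact .outside _

theorem Connected.shift (k : ℤ) {a b : Node x.size y.size z.size} (h : Connected T S a b) :
    Connected T S (a.shift k) (b.shift k) :=
  reflTransGen_map _ (fun _ _ => Joined.shift k) h

end Composition

/-! ### Kinds of loops -/

section Loops

variable {x y z : Obj} (T : LiftedTangle x y) (S : LiftedTangle y z)

/-- The three kinds of loops: non-contractible (`none`), shaded (`some true`) and unshaded
(`some false`) contractible loops. -/
def loopSet : Option Bool → Set (Set ℕ)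
  | none => nonContractibleLoops T S
  | some true => shadedLoops T S
  | some false => unshadedLoops T S

/-- The condition that singles out the points (for a contractible loop: the leftmost point) of the
loops of a given kind. -/
def HasKind : Option Bool → Pt y.size → Prop
  | none, p => Winds T S p
  | some b, p => ¬ Winds T S p ∧ (∀ q, Connected T S (.mid p) (.mid q) → ¬ q.lt p) ∧
      (Even p.idx ↔ b = true)

/-- One description of the three sets of loops, so that every invariance statement is proved once
for all kinds. -/
theorem mem_loopSet (κ : Option Bool) (L : Set ℕ) :
    L ∈ loopSet T S κ ↔ ∃ p, OnLoop T S p ∧ HasKind T S κ p ∧ L = loopThrough T S p := by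
  rcases κ with _ | (_ | _)
  · exact Iff.rfl
  · simp only [loopSet, unshadedLoops, IsStart, HasKind, Set.mem_ofPred_eq, ← Nat.not_even_iff_odd]
    simp only [Bool.false_eq_true, iff_false, and_assoc]
  · simp only [loopSet, shadedLoops, IsStart, HasKind, Set.mem_ofPred_eq]
    simp only [iff_true, and_assoc]

variable {T S}

/-- A shift keeps the order and the numbers of the points, so the kind and the trace of a loop
depend only on connectivity. An inclusion is enough: reflections (`k = 0`) and twists are
invertible, and the inverse gives the other inclusion. -/
theorem loopSet_subset_of_map {x' z' : Obj} {T' : LiftedTangle x' y} {S' : LiftedTangle y z'}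
    (k : ℤ)
    (hc : ∀ p q : Pt y.size, Connected T S (.mid p) (.mid q) ↔
      Connected T' S' (.mid (p.shift k)) (.mid (q.shift k)))
    (hl : ∀ p : Pt y.size, OnLoop T S p → OnLoop T' S' (p.shift k)) (κ : Option Bool) :
    loopSet T S κ ⊆ loopSet T' S' κ := by
  have hw : ∀ p, Winds T S p ↔ Winds T' S' (p.shift k) := by
    intro p
    unfold Winds
    simp only [hc, Pt.shift_shift, add_comm k]
  have hx : ∀ q : Pt y.size, ∃ r : Pt y.size, q = r.shift k := fun q => ⟨_, (q.shift_neg_shift k).symm⟩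
  intro L hL
  rw [mem_loopSet] at hL ⊢
  obtain ⟨p, h1, h2, rfl⟩ := hL
  refine ⟨p.shift k, hl p h1, ?_, ?_⟩
  · rcases κ with _ | b
    · exact (hw p).1 h2
    · refine ⟨fun h => h2.1 ((hw p).2 h), fun q hq => ?_, h2.2.2⟩
      obtain ⟨r, rfl⟩ := hx q
      rw [Pt.shift_lt_shift]
      exact h2.2.1 r ((hc _ _).2 hq)
  · ext j
    constructor
    · rintro ⟨q, hq, h⟩
      exact ⟨q.shift k, hq, (hc _ _).1 h⟩
    · rintro ⟨q, hq, h⟩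
      obtain ⟨r, rfl⟩ := hx q
      exact ⟨r, hq, (hc _ _).2 h⟩

/-! ### Reflection of a composite -/

/-- The reflection of the picture of a composite. -/
def Node.flip {l m n : ℕ} : Node l m n → Node n m l
  | .inner p => .outer p
  | .mid p => .mid p
  | .outer p => .inner p

theorem Node.flip_flip {l m n : ℕ} (a : Node l m n) : a.flip.flip = a := by cases a <;> rfl

theorem LiftedTangle.star_star {x y : Obj} (T : LiftedTangle x y) : T.star.star = T := by
  ext1
  · funext u
    change (T.other u.swap.swap).swap.swap = _
    simp
  · rfl

theorem Joined.flip {a b : Node x.size y.size z.size} (h : Joined T S a b) :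
    Joined S.star T.star a.flip b.flip := by
  have e1 : ∀ u : Bd x.size y.size,
      (Node.ofInside z.size u).flip = .ofOutside _ u.swap := by rintro (u | u) <;> rfl
  have e2 : ∀ u : Bd y.size z.size,
      (Node.ofOutside x.size u).flip = .ofInside _ u.swap := by rintro (u | u) <;> rfl
  cases h with
  | inside u =>
    have := Joined.outside (T := S.star) (S := T.star) u.swap
    rw [e1, e1]
    simpa only [LiftedTangle.star, Sum.swap_swap] using this
  | outside u =>
    have := Joined.inside (T := S.star) (S := T.star) u.swap
    rw [e2, e2]
    simpa only [LiftedTangle.star, Sum.swap_swap] using this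

theorem Connected.flip {a b : Node x.size y.size z.size} (h : Connected T S a b) :
    Connected S.star T.star a.flip b.flip :=
  reflTransGen_map _ (fun _ _ => Joined.flip) h

theorem Connected.of_flip {a b : Node x.size y.size z.size}
    (h : Connected S.star T.star a.flip b.flip) : Connected T S a b := by
  have := h.flip
  rwa [Node.flip_flip, Node.flip_flip, T.star_star, S.star_star] at this

theorem Node.flip_ofBoundary {l m n : ℕ} (u : Bd l n) :
    (Node.ofBoundary m u).flip = .ofBoundary m u.swap := by rcases u with u | u <;> rfl

variable (T S)

/-- The reflection exchanges the two outer circles but fixes the common circle with its numbering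
and direction, so a loop keeps its leftmost point and its shading. -/
theorem loopSet_star_subset (κ : Option Bool) : loopSet T S κ ⊆ loopSet S.star T.star κ := by
  refine loopSet_subset_of_map 0 (fun p q => ?_) (fun p hp u hu => hp u.swap ?_) κ
  · simp only [Pt.shift_zero]
    exact ⟨fun h => h.flip, fun h => Connected.of_flip h⟩
  · rw [Pt.shift_zero] at hu
    apply Connected.of_flip
    rw [Node.flip_ofBoundary, Sum.swap_swap]
    exact hu

theorem loopSet_star (κ : Option Bool) : loopSet S.star T.star κ = loopSet T S κ := by
  refine Set.Subset.antisymm ?_ (loopSet_star_subset T S κ)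
  have := loopSet_star_subset S.star T.star κ
  rwa [T.star_star, S.star_star] at this

variable {T S}

theorem IsReducedComposite.star {R : LiftedTangle x z} (h : IsReducedComposite T S R) :
    IsReducedComposite S.star T.star R.star := by
  refine .of_connected (fun u => ?_) ?_
  · have := (h.connected u.swap).flip
    rw [Node.flip_ofBoundary, Node.flip_ofBoundary, Sum.swap_swap] at this
    exact this
  · have := loopSet_star T S none
    simp only [loopSet] at this
    rw [this]
    exact h.2.trans (by rw [Nat.add_comm T.loops]; rfl)

theorem IsReducedComposite.of_star {R : LiftedTangle x z}
    (h : IsReducedComposite S.star T.star R.star) : IsReducedComposite T S R := by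
  have := h.star
  rwa [T.star_star, S.star_star, R.star_star] at this

/-! ### Dehn twists of a composite -/

/-- The full twists of `S ∘ T` which induce `k` full twists of `T` and `j` of `S`. -/
def Node.twist {l m n : ℕ} (k j : ℤ) : Node l m n → Node l m n
  | .inner p => .inner p
  | .mid p => .mid (p.shift k)
  | .outer p => .outer (p.shift (k + j))

theorem Node.twist_twist_neg {l m n : ℕ} (k j : ℤ) (a : Node l m n) :
    (a.twist k j).twist (-k) (-j) = a := by
  rcases a with p | p | p <;> simp only [Node.twist, Pt.shift_shift]
  · rw [add_neg_cancel, Pt.shift_zero]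
  · rw [show k + j + (-k + -j) = 0 by ring, Pt.shift_zero]

theorem Node.twist_ofBoundary {l m n : ℕ} (k j : ℤ) (u : Bd l n) :
    (Node.ofBoundary m u).twist k j = .ofBoundary m (u.twist (k + j)) := by
  rcases u with u | u <;> rfl

/-- `U` is the lift of `T` twisted by `k` full turns. -/
def LiftedTangle.IsTwist {x y : Obj} (k : ℤ) (T U : LiftedTangle x y) : Prop :=
  ∀ u, U.other (u.twist k) = (T.other u).twist k

theorem LiftedTangle.IsTwist.symm {x y : Obj} {k : ℤ} {T U : LiftedTangle x y}
    (h : T.IsTwist k U) : U.IsTwist (-k) T := by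
  intro u
  have h := h (u.twist (-k))
  rw [Bd.twist_twist, neg_add_cancel, Bd.twist_zero] at h
  rw [h, Bd.twist_twist, add_neg_cancel, Bd.twist_zero]

variable {T' : LiftedTangle x y} {S' : LiftedTangle y z} {k j : ℤ}

theorem Joined.twist (hT : T.IsTwist k T') (hS : S.IsTwist j S')
    {a b : Node x.size y.size z.size} (h : Joined T S a b) :
    Joined T' S' (a.twist k j) (b.twist k j) := by
  have e1 : ∀ u : Bd x.size y.size,
      (Node.ofInside z.size u).twist k j = .ofInside _ (u.twist k) := by rintro (u | u) <;> rfl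
  -- Twisting `T` by `k` turns the common circle. For `S` this is a deck transformation by `k` on
  -- top of its own twist by `j`, which explains the `k + j` on the external circle.
  have e2 : ∀ u : Bd y.size z.size,
      (Node.ofOutside x.size u).twist k j = .ofOutside _ ((u.twist j).shift k) := by
    rintro (u | u)
    · rfl
    · simp [Node.ofOutside, Node.twist, Bd.twist, Bd.shift, Pt.shift_shift, add_comm]
  cases h with
  | inside u => rw [e1, e1, ← hT]; exact .inside _
  | outside u => rw [e2, e2, ← hS, ← S'.other_shift]; exact .outside _

theorem Connected.twist (hT : T.IsTwist k T') (hS : S.IsTwist j S')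
    {a b : Node x.size y.size z.size} (h : Connected T S a b) :
    Connected T' S' (a.twist k j) (b.twist k j) :=
  reflTransGen_map (Node.twist k j) (fun _ _ => Joined.twist hT hS) h

theorem Connected.of_twist (hT : T.IsTwist k T') (hS : S.IsTwist j S')
    {a b : Node x.size y.size z.size} (h : Connected T' S' (a.twist k j) (b.twist k j)) :
    Connected T S a b := by
  have := h.twist hT.symm hS.symm
  rwa [Node.twist_twist_neg, Node.twist_twist_neg] at this

theorem loopSet_twist_subset (hT : T.IsTwist k T') (hS : S.IsTwist j S') (κ : Option Bool) :
    loopSet T S κ ⊆ loopSet T' S' κ := by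
  refine loopSet_subset_of_map k (fun p q => ⟨fun h => h.twist hT hS, fun h => Connected.of_twist hT hS h⟩)
    (fun p hp u hu => hp (u.twist (-(k + j))) ?_) κ
  refine Connected.of_twist hT hS ?_
  rw [Node.twist_ofBoundary, Bd.twist_twist, neg_add_cancel, Bd.twist_zero]
  exact hu

theorem loopSet_twist (hT : T.IsTwist k T') (hS : S.IsTwist j S') (κ : Option Bool) :
    loopSet T' S' κ = loopSet T S κ :=
  (loopSet_twist_subset hT.symm hS.symm κ).antisymm (loopSet_twist_subset hT hS κ)

/-- The twists of the factors come from one map of the whole picture, which carries curves to curves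
and twists the composite by `k + j`. This is the independence of representatives, and also the
uniqueness of the composite up to equivalence. -/
theorem IsReducedComposite.equivalent {R R' : LiftedTangle x z} (hT : T.Equivalent T')
    (hS : S.Equivalent S') (h : IsReducedComposite T S R) (h' : IsReducedComposite T' S' R') :
    R.Equivalent R' ∧ ∀ κ, loopSet T' S' κ = loopSet T S κ := by
  obtain ⟨lT, k, hT⟩ := hT
  obtain ⟨lS, j, hS⟩ := hS
  refine ⟨⟨?_, k + j, fun u => ?_⟩, loopSet_twist hT hS⟩
  · rw [h.2, h'.2, lT, lS]
    exact congrArg (fun s => _ + Set.ncard s) (loopSet_twist hT hS none).symm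
  · rw [h'.1]
    constructor
    · intro e
      refine R.other_ne u ?_
      have := congrArg (Bd.twist (-(k + j))) e
      simpa [Bd.twist_twist, Bd.twist_zero] using this.symm
    · have := (h.connected u).twist hT hS
      rwa [Node.twist_ofBoundary, Node.twist_ofBoundary] at this

end Loops

/-! ## Parity of ranks in a non-crossing matching -/

/-- The position of a marked point on the universal cover of its circle. -/
def Pt.toInt {n : ℕ} (p : Pt n) : ℤ := p.sheet * (2 * n) + p.idx

/-- The marked point at a given position. -/
def Pt.ofInt {n : ℕ} (hn : 0 < n) (z : ℤ) : Pt n :=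
  ⟨z / (2 * n), (z % (2 * n)).toNat, by
    have h1 := Int.emod_lt_of_pos z (b := 2 * n) (by omega)
    have h2 := Int.emod_nonneg z (b := 2 * n) (by omega)
    omega⟩

theorem Pt.pos {n : ℕ} (p : Pt n) : 0 < n := by have := p.idx_lt; omega

theorem Pt.toInt_ofInt {n : ℕ} (hn : 0 < n) (z : ℤ) : (Pt.ofInt hn z).toInt = z := by
  simp only [Pt.toInt, Pt.ofInt]
  rw [Int.toNat_of_nonneg (Int.emod_nonneg z (by omega)), mul_comm]
  exact Int.mul_ediv_add_emod z (2 * n)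

theorem Pt.lt_iff_toInt {n : ℕ} (p q : Pt n) : p.lt q ↔ p.toInt < q.toInt := by
  obtain ⟨s, i, hi⟩ := p
  obtain ⟨t, j, hj⟩ := q
  simp only [Pt.lt, Pt.toInt]
  constructor
  · rintro (h | ⟨rfl, h⟩)
    · have : s * (2 * n) + (2 * n) ≤ t * (2 * n) := by nlinarith
      omega
    · omega
  · intro h
    rcases _root_.lt_trichotomy s t with h1 | h1 | h1
    · exact Or.inl h1
    · subst h1; exact Or.inr ⟨rfl, by omega⟩
    · have : t * (2 * n) + (2 * n) ≤ s * (2 * n) := by nlinarith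
      omega

theorem Pt.toInt_injective {n : ℕ} : Function.Injective (Pt.toInt (n := n)) := by
  intro p q h
  rcases Pt.lt_trichotomy p q with h1 | h1 | h1
  · rw [Pt.lt_iff_toInt] at h1; omega
  · exact h1
  · rw [Pt.lt_iff_toInt] at h1; omega

theorem Pt.toInt_shift {n : ℕ} (k : ℤ) (p : Pt n) : (p.shift k).toInt = p.toInt + k * (2 * n) := by
  simp only [Pt.toInt, Pt.shift]; ring

theorem Pt.cast_toInt {n : ℕ} (p : Pt n) : ((p.toInt : ℤ) : ZMod 2) = (p.idx : ZMod 2) := by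
  simp only [Pt.toInt]
  push_cast
  rw [show (2 : ZMod 2) = 0 from rfl]
  simp

theorem even_iff_of_cast_eq {i j : ℕ} (h : (i : ZMod 2) = j) : Even i ↔ Even j := by
  rw [← ZMod.natCast_eq_zero_iff_even, h, ZMod.natCast_eq_zero_iff_even]

theorem Bd.inl_lt_inl {m n : ℕ} (p q : Pt m) : Bd.lt (Sum.inl p : Bd m n) (.inl q) ↔ p.lt q :=
  Iff.rfl

theorem Bd.inl_lt_inr {m n : ℕ} (p : Pt m) (q : Pt n) : Bd.lt (Sum.inl p : Bd m n) (.inr q) :=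
  trivial

theorem Bd.inr_lt_inl {m n : ℕ} (p : Pt n) (q : Pt m) : ¬ Bd.lt (Sum.inr p : Bd m n) (.inl q) :=
  id

theorem Bd.inr_lt_inr {m n : ℕ} (p q : Pt n) : Bd.lt (Sum.inr p : Bd m n) (.inr q) ↔ q.lt p :=
  Iff.rfl

section Rank

variable {x y : Obj} (T : LiftedTangle x y)

open Classical in
-- The strings pair off the points of `D` without fixed points.
theorem LiftedTangle.card_eq_zero (D : Finset (Bd x.size y.size))
    (hD : ∀ u ∈ D, T.other u ∈ D) : (D.card : ZMod 2) = 0 := by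
  have := Finset.sum_involution (s := D) (f := fun _ => (1 : ZMod 2)) (fun u _ => T.other u)
    (fun _ _ => rfl) (fun u _ _ => T.other_ne u) (fun u hu => hD u hu) (fun u _ => T.other_other u)
  simpa using this

open Classical in
-- The points of `D` strictly between the ends of a string are matched among themselves by
-- planarity, so their number is even. The ranks of the two ends differ by this number plus one.
theorem LiftedTangle.rank_other (D : Finset (Bd x.size y.size)) (hD : ∀ u ∈ D, T.other u ∈ D)
    {u : Bd x.size y.size} (hu : u ∈ D) :
    ((D.filter (·.lt (T.other u))).card : ZMod 2) = (D.filter (·.lt u)).card + 1 := by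
  have main : ∀ u ∈ D, u.lt (T.other u) →
      ((D.filter (·.lt (T.other u))).card : ZMod 2) = (D.filter (·.lt u)).card + 1 := by
    intro u hu h
    have e : D.filter (·.lt (T.other u)) = (D.filter (·.lt u)).disjUnion
        ((D.filter fun v => u.lt v ∧ v.lt (T.other u)).disjUnion {u} (by
          simp only [Finset.disjoint_singleton_right, Finset.mem_filter]
          exact fun h => Bd.lt_irrefl _ h.2.1)) (by
        rw [Finset.disjoint_left]
        intro v h1 h2
        simp only [Finset.mem_disjUnion, Finset.mem_filter, Finset.mem_singleton] at h1 h2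
        rcases h2 with h2 | rfl
        · exact Bd.lt_irrefl _ (Bd.lt_trans h1.2 h2.2.1)
        · exact Bd.lt_irrefl _ h1.2) := by
      ext v
      simp only [Finset.mem_disjUnion, Finset.mem_filter, Finset.mem_singleton]
      constructor
      · rintro ⟨h1, h2⟩
        rcases Bd.lt_trichotomy u v with h3 | h3 | h3
        · exact Or.inr (Or.inl ⟨h1, h3, h2⟩)
        · exact Or.inr (Or.inr h3.symm)
        · exact Or.inl ⟨h1, h3⟩
      · rintro (⟨h1, h2⟩ | ⟨h1, h2, h3⟩ | rfl)
        · exact ⟨h1, Bd.lt_trans h2 h⟩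
        · exact ⟨h1, h3⟩
        · exact ⟨hu, h⟩
    rw [e, Finset.card_disjUnion, Finset.card_disjUnion, Finset.card_singleton]
    push_cast
    rw [T.card_eq_zero (D.filter fun v => u.lt v ∧ v.lt (T.other u)), zero_add]
    intro v hv
    simp only [Finset.mem_filter] at hv ⊢
    exact ⟨hD v hv.1, T.other_between hv.2.1 hv.2.2⟩
  rcases Bd.lt_trichotomy u (T.other u) with h | h | h
  · exact main u hu h
  · exact absurd h.symm (T.other_ne u)
  · have := main (T.other u) (hD u hu) (by rwa [T.other_other])
    rw [T.other_other] at this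
    -- What remains is `1 + 1 = 0` in `ZMod 2`, which holds by computation.
    rw [this, add_assoc]
    exact (add_zero _).symm

/-- The closed interval between the ends is stable under the strings, hence has even length. A full
turn consists of `2 * n` places, so number and position agree modulo 2. Thus the shading condition
for strings that return to their circle follows from planarity and need not be part of
`LiftedTangle`. -/
theorem LiftedTangle.cast_idx_of_inl {p q : Pt x.size} (h : T.other (.inl p) = .inl q) :
    (q.idx : ZMod 2) = p.idx + 1 := by
  classical
  have main : ∀ {p q : Pt x.size}, T.other (.inl p) = .inl q → p.lt q →
      (q.idx : ZMod 2) = p.idx + 1 := by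
    intro p q h hpq
    have hn := p.pos
    have hpq' := (Pt.lt_iff_toInt p q).1 hpq
    set D : Finset (Bd x.size y.size) :=
      (Finset.Icc p.toInt q.toInt).image (fun z => Sum.inl (Pt.ofInt hn z)) with hDdef
    have hD : ∀ u, u ∈ D ↔ (u = .inl p ∨ u = .inl q) ∨
        (Bd.lt (Sum.inl p) u ∧ Bd.lt u (Sum.inl q)) := by
      rintro (r | r)
      · simp only [hDdef, Finset.mem_image, Finset.mem_Icc, Sum.inl.injEq, Bd.lt, Pt.lt_iff_toInt,
          ← Pt.toInt_injective.eq_iff, Pt.toInt_ofInt]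
        constructor
        · rintro ⟨a, h, rfl⟩; omega
        · intro h; exact ⟨r.toInt, by omega, rfl⟩
      · simp [hDdef, Bd.lt]
    have hst : ∀ u ∈ D, T.other u ∈ D := by
      intro u hu
      rw [hD] at hu ⊢
      rcases hu with (rfl | rfl) | ⟨h1, h2⟩
      · exact Or.inl (Or.inr h)
      · exact Or.inl (Or.inl (T.other_eq_comm.1 h))
      · rw [← h] at h2 ⊢
        exact Or.inr (T.other_between h1 h2)
    have hr := T.card_eq_zero D hst
    rw [hDdef, Finset.card_image_of_injective] at hr
    · rw [← Pt.cast_toInt, ← Pt.cast_toInt]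
      rw [Int.card_Icc] at hr
      have h3 : (((q.toInt + 1 - p.toInt).toNat : ℤ) : ZMod 2) = 0 := by exact_mod_cast hr
      rw [Int.toNat_of_nonneg (by omega)] at h3
      push_cast at h3
      have h4 : (q.toInt : ZMod 2) = p.toInt - 1 := by linear_combination h3
      rw [h4, sub_eq_add_neg]
      rfl
    · intro a b hab
      have := congrArg (Sum.elim Pt.toInt Pt.toInt) hab
      simpa [Pt.toInt_ofInt] using this
  rcases Pt.lt_trichotomy p q with h1 | h1 | h1
  · exact main h h1
  · subst h1; exact absurd h (T.other_ne _)
  · rw [main (T.other_eq_comm.1 h) h1, add_assoc]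
    exact (add_zero _).symm

theorem LiftedTangle.cast_idx_of_inr {p q : Pt y.size} (h : T.other (.inr p) = .inr q) :
    (q.idx : ZMod 2) = p.idx + 1 := by
  refine T.star.cast_idx_of_inl (p := p) (q := q) ?_
  change (T.other (.inr p)).swap = _
  rw [h]; rfl

theorem LiftedTangle.cast_idx_of_through {p : Pt x.size} {q : Pt y.size}
    (h : T.other (.inl p) = .inr q) : (q.idx : ZMod 2) = p.idx := by
  have := T.through_shading p q h
  rw [ZMod.natCast_eq_natCast_iff']
  simp only [Nat.even_iff] at this
  omega

open Classical in
/-- The rank of a point in a finite set plus its number, modulo 2. -/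
noncomputable def Pt.rankParity {n : ℕ} (A : Finset (Pt n)) (p : Pt n) : ZMod 2 :=
  (A.filter (·.lt p)).card + p.idx

theorem Pt.rankParity_of_first {n : ℕ} {A : Finset (Pt n)} {p : Pt n}
    (h : ∀ q ∈ A, ¬ q.lt p) : Pt.rankParity A p = p.idx := by
  classical
  rw [Pt.rankParity, Finset.filter_false_of_mem h]
  simp

open Classical in
theorem Bd.card_filter_inl {m n : ℕ} (A : Finset (Pt m)) (B : Finset (Pt n)) (p : Pt m) :
    ((A.disjSum B).filter (Bd.lt · (Sum.inl p))).card = (A.filter (·.lt p)).card := by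
  have : (A.disjSum B).filter (Bd.lt · (Sum.inl p)) = (A.filter (·.lt p)).disjSum ∅ := by
    ext (v | v) <;> simp [Finset.mem_filter, Bd.inl_lt_inl, Bd.inr_lt_inl]
  rw [this]; simp

open Classical in
-- The external line is run through backwards: before `q` come all of `A` and the points of `B`
-- beyond `q`. As `B` has an even number of points, counting from the other side costs only the
-- point `q` itself.
theorem Bd.card_filter_inr {m n : ℕ} (A : Finset (Pt m)) (B : Finset (Pt n)) {q : Pt n}
    (hq : q ∈ B) (hA : (A.card : ZMod 2) = 0) (hB : (B.card : ZMod 2) = 0) :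
    (((A.disjSum B).filter (Bd.lt · (Sum.inr q))).card : ZMod 2) =
      (B.filter (·.lt q)).card + 1 := by
  have h1 : (A.disjSum B).filter (Bd.lt · (Sum.inr q)) = A.disjSum (B.filter (q.lt ·)) := by
    ext (v | v) <;> simp [Finset.mem_filter, Bd.inl_lt_inr, Bd.inr_lt_inr]
  have h2 : B = (B.filter (·.lt q)).disjUnion ((B.filter (q.lt ·)).disjUnion {q} (by
      simp [Pt.lt_irrefl])) (by
      rw [Finset.disjoint_left]
      intro v h1 h2
      simp only [Finset.mem_disjUnion, Finset.mem_filter, Finset.mem_singleton] at h1 h2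
      rcases h2 with h2 | rfl
      · exact Pt.lt_irrefl _ (Pt.lt_trans h1.2 h2.2)
      · exact Pt.lt_irrefl _ h1.2) := by
    ext v
    simp only [Finset.mem_disjUnion, Finset.mem_filter, Finset.mem_singleton]
    constructor
    · intro hv
      rcases Pt.lt_trichotomy v q with h | h | h <;> tauto
    · rintro (h | h | rfl) <;> tauto
  have h3 := congrArg (fun s : Finset (Pt n) => (s.card : ZMod 2)) h2
  simp only [Finset.card_disjUnion, Finset.card_singleton] at h3
  rw [hB] at h3
  push_cast at h3
  rw [h1, Finset.card_disjSum]
  push_cast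
  rw [hA, zero_add]
  generalize ((B.filter (q.lt ·)).card : ZMod 2) = a at *
  generalize ((B.filter (·.lt q)).card : ZMod 2) = b at *
  revert a b; decide

/-- A string that returns to its circle changes both the parity of the rank and the parity of the
number. A through string changes neither: the change of rank along the boundary of the strip is
cancelled by the reversed direction of the external line. So the sum is an invariant of curves. -/
theorem LiftedTangle.rankParity_other (A : Finset (Pt x.size)) (B : Finset (Pt y.size))
    (hA : (A.card : ZMod 2) = 0) (hB : (B.card : ZMod 2) = 0)
    (hD : ∀ u ∈ A.disjSum B, T.other u ∈ A.disjSum B) {u : Bd x.size y.size}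
    (hu : u ∈ A.disjSum B) :
    Sum.elim (Pt.rankParity A) (Pt.rankParity B) (T.other u) =
      Sum.elim (Pt.rankParity A) (Pt.rankParity B) u := by
  classical
  have h1 := T.rank_other _ hD hu
  have hu' := hD u hu
  have fin : ∀ a b c d : ZMod 2, a = b + 1 → c = d + 1 → a + c = b + d := by decide
  have fin2 : ∀ a b c d : ZMod 2, a + 1 = b + 1 → c = d → a + c = b + d := by decide
  have fin3 : ∀ a b c d : ZMod 2, a = b + 1 + 1 → c = d → a + c = b + d := by decide
  have fin4 : ∀ a b c d : ZMod 2, a + 1 = b + 1 + 1 → c = d + 1 → a + c = b + d := by decide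
  rcases u with p | p <;> rcases h : T.other _ with q | q <;> rw [h] at h1 hu'
  · rw [Bd.card_filter_inl, Bd.card_filter_inl] at h1
    exact fin _ _ _ _ h1 (T.cast_idx_of_inl h)
  · rw [Bd.card_filter_inl, Bd.card_filter_inr A B (by simpa using hu') hA hB] at h1
    exact fin2 _ _ _ _ h1 (T.cast_idx_of_through h)
  · rw [Bd.card_filter_inl, Bd.card_filter_inr A B (by simpa using hu) hA hB] at h1
    exact fin3 _ _ _ _ h1 (T.cast_idx_of_through (T.other_eq_comm.1 h)).symm
  · rw [Bd.card_filter_inr A B (by simpa using hu') hA hB,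
      Bd.card_filter_inr A B (by simpa using hu) hA hB] at h1
    exact fin4 _ _ _ _ h1 (T.cast_idx_of_inr h)

end Rank

/-! ## Associativity -/

/-- The marked points of a picture that consists of three tangles. -/
inductive Node₃ (k l m n : ℕ) : Type
  | inner (p : Pt k)
  | mid₁ (p : Pt l)
  | mid₂ (p : Pt m)
  | outer (p : Pt n)

/-- The boundary points of the first (innermost) tangle. -/
def Node₃.ofFirst {k l : ℕ} (m n : ℕ) : Bd k l → Node₃ k l m n
  | .inl p => .inner p
  | .inr p => .mid₁ p

/-- The boundary points of the second tangle. -/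
def Node₃.ofSecond (k : ℕ) {l m : ℕ} (n : ℕ) : Bd l m → Node₃ k l m n
  | .inl p => .mid₁ p
  | .inr p => .mid₂ p

/-- The boundary points of the third (outermost) tangle. -/
def Node₃.ofThird (k l : ℕ) {m n : ℕ} : Bd m n → Node₃ k l m n
  | .inl p => .mid₂ p
  | .inr p => .outer p

/-- The boundary points of the composite. -/
def Node₃.ofBoundary {k : ℕ} (l m : ℕ) {n : ℕ} : Bd k n → Node₃ k l m n
  | .inl p => .inner p
  | .inr p => .outer p

/-- The deck transformation. -/
def Node₃.shift {k l m n : ℕ} (j : ℤ) : Node₃ k l m n → Node₃ k l m n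
  | .inner p => .inner (p.shift j)
  | .mid₁ p => .mid₁ (p.shift j)
  | .mid₂ p => .mid₂ (p.shift j)
  | .outer p => .outer (p.shift j)

/-- The reflection. -/
def Node₃.flip {k l m n : ℕ} : Node₃ k l m n → Node₃ n m l k
  | .inner p => .outer p
  | .mid₁ p => .mid₂ p
  | .mid₂ p => .mid₁ p
  | .outer p => .inner p

/-- The points of the picture of the two inner tangles. -/
def Node₃.ofLower {k l m : ℕ} (n : ℕ) : Node k l m → Node₃ k l m n
  | .inner p => .inner p
  | .mid p => .mid₁ p
  | .outer p => .mid₂ p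

/-- The points that remain after composition of the two inner tangles. -/
def Node₃.ofReduced {k : ℕ} (l : ℕ) {m n : ℕ} : Node k m n → Node₃ k l m n
  | .inner p => .inner p
  | .mid p => .mid₂ p
  | .outer p => .outer p

section Triple

variable {w x y z : Obj} (T : LiftedTangle w x) (S : LiftedTangle x y) (U : LiftedTangle y z)

/-- Two points are the two ends of a string of one of three tangles. -/
inductive Joined₃ : Node₃ w.size x.size y.size z.size → Node₃ w.size x.size y.size z.size → Prop
  | first (u : Bd w.size x.size) : Joined₃ (.ofFirst _ _ u) (.ofFirst _ _ (T.other u))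
  | second (u : Bd x.size y.size) : Joined₃ (.ofSecond _ _ u) (.ofSecond _ _ (S.other u))
  | third (u : Bd y.size z.size) : Joined₃ (.ofThird _ _ u) (.ofThird _ _ (U.other u))

/-- Two points lie on the same curve of a picture of three tangles. -/
def Connected₃ : Node₃ w.size x.size y.size z.size → Node₃ w.size x.size y.size z.size → Prop :=
  Relation.ReflTransGen (Joined₃ T S U)

variable {T S U}

theorem Joined₃.symm {a b : Node₃ w.size x.size y.size z.size} (h : Joined₃ T S U a b) :
    Joined₃ T S U b a := by
  cases h with
  | first u => simpa only [T.other_other] using Joined₃.first (T := T) (S := S) (U := U) (T.other u)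
  | second u =>
    simpa only [S.other_other] using Joined₃.second (T := T) (S := S) (U := U) (S.other u)
  | third u => simpa only [U.other_other] using Joined₃.third (T := T) (S := S) (U := U) (U.other u)

theorem Connected₃.symm {a b : Node₃ w.size x.size y.size z.size} (h : Connected₃ T S U a b) :
    Connected₃ T S U b a := by
  induction h with
  | refl => exact .refl
  | tail _ h ih => exact .head h.symm ih

theorem Connected₃.trans {a b c : Node₃ w.size x.size y.size z.size} (h : Connected₃ T S U a b)
    (h2 : Connected₃ T S U b c) : Connected₃ T S U a c := Relation.ReflTransGen.trans h h2

theorem Connected₃.refl (a : Node₃ w.size x.size y.size z.size) : Connected₃ T S U a a :=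
  Relation.ReflTransGen.refl

theorem Joined₃.shift (j : ℤ) {a b : Node₃ w.size x.size y.size z.size}
    (h : Joined₃ T S U a b) : Joined₃ T S U (a.shift j) (b.shift j) := by
  have e1 : ∀ u : Bd w.size x.size,
      (Node₃.ofFirst y.size z.size u).shift j = .ofFirst _ _ (u.shift j) := by rintro (u | u) <;> rfl
  have e2 : ∀ u : Bd x.size y.size,
      (Node₃.ofSecond w.size z.size u).shift j = .ofSecond _ _ (u.shift j) := by
    rintro (u | u) <;> rfl
  have e3 : ∀ u : Bd y.size z.size,
      (Node₃.ofThird w.size x.size u).shift j = .ofThird _ _ (u.shift j) := by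
    rintro (u | u) <;> rfl
  cases h with
  | first u => rw [e1, e1, ← T.other_shift]; exact .first _
  | second u => rw [e2, e2, ← S.other_shift]; exact .second _
  | third u => rw [e3, e3, ← U.other_shift]; exact .third _

theorem Connected₃.shift (j : ℤ) {a b : Node₃ w.size x.size y.size z.size}
    (h : Connected₃ T S U a b) : Connected₃ T S U (a.shift j) (b.shift j) :=
  reflTransGen_map (Node₃.shift j) (fun _ _ => Joined₃.shift j) h

theorem Node₃.shift_shift {k l m n : ℕ} (i j : ℤ) (a : Node₃ k l m n) :
    (a.shift i).shift j = a.shift (i + j) := by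
  cases a <;> simp only [Node₃.shift, Pt.shift_shift]

theorem Node₃.shift_zero {k l m n : ℕ} (a : Node₃ k l m n) : a.shift 0 = a := by
  cases a <;> simp only [Node₃.shift, Pt.shift_zero]

theorem Node₃.flip_flip {k l m n : ℕ} (a : Node₃ k l m n) : a.flip.flip = a := by cases a <;> rfl

theorem Joined₃.flip {a b : Node₃ w.size x.size y.size z.size} (h : Joined₃ T S U a b) :
    Joined₃ U.star S.star T.star a.flip b.flip := by
  have e1 : ∀ u : Bd w.size x.size,
      (Node₃.ofFirst y.size z.size u).flip = .ofThird _ _ u.swap := by rintro (u | u) <;> rfl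
  have e2 : ∀ u : Bd x.size y.size,
      (Node₃.ofSecond w.size z.size u).flip = .ofSecond _ _ u.swap := by rintro (u | u) <;> rfl
  have e3 : ∀ u : Bd y.size z.size,
      (Node₃.ofThird w.size x.size u).flip = .ofFirst _ _ u.swap := by rintro (u | u) <;> rfl
  cases h with
  | first u =>
    have := Joined₃.third (T := U.star) (S := S.star) (U := T.star) u.swap
    rw [e1, e1]
    simpa only [LiftedTangle.star, Sum.swap_swap] using this
  | second u =>
    have := Joined₃.second (T := U.star) (S := S.star) (U := T.star) u.swap
    rw [e2, e2]
    simpa only [LiftedTangle.star, Sum.swap_swap] using this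
  | third u =>
    have := Joined₃.first (T := U.star) (S := S.star) (U := T.star) u.swap
    rw [e3, e3]
    simpa only [LiftedTangle.star, Sum.swap_swap] using this

theorem Connected₃.flip {a b : Node₃ w.size x.size y.size z.size} (h : Connected₃ T S U a b) :
    Connected₃ U.star S.star T.star a.flip b.flip :=
  reflTransGen_map Node₃.flip (fun _ _ => Joined₃.flip) h

theorem Connected₃.of_flip {a b : Node₃ w.size x.size y.size z.size}
    (h : Connected₃ U.star S.star T.star a.flip b.flip) : Connected₃ T S U a b := by
  have := h.flip
  rwa [Node₃.flip_flip, Node₃.flip_flip, T.star_star, S.star_star, U.star_star] at this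

theorem connected₃_flip {a b : Node₃ w.size x.size y.size z.size} :
    Connected₃ U.star S.star T.star a.flip b.flip ↔ Connected₃ T S U a b :=
  ⟨Connected₃.of_flip, Connected₃.flip⟩

theorem Connected.ofLower {a b : Node w.size x.size y.size} (h : Connected T S a b) :
    Connected₃ T S U (.ofLower _ a) (.ofLower _ b) := by
  refine reflTransGen_map (Node₃.ofLower z.size) (fun a b h => ?_) h
  have e1 : ∀ u : Bd w.size x.size, Node₃.ofLower z.size (.ofInside y.size u) = .ofFirst _ _ u := by
    rintro (u | u) <;> rfl
  have e2 : ∀ u : Bd x.size y.size, Node₃.ofLower z.size (.ofOutside w.size u) = .ofSecond _ _ u := by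
    rintro (u | u) <;> rfl
  cases h with
  | inside u => rw [e1, e1]; exact .first u
  | outside u => rw [e2, e2]; exact .second u

variable {P : LiftedTangle w y} (hP : IsReducedComposite T S P)

include hP

theorem Connected.ofReduced {a b : Node w.size y.size z.size} (h : Connected P U a b) :
    Connected₃ T S U (.ofReduced _ a) (.ofReduced _ b) := by
  induction h with
  | refl => exact .refl _
  | tail _ h ih =>
    refine ih.trans ?_
    cases h with
    | inside u =>
      have := Connected.ofLower (U := U) (hP.connected u)
      rcases u with u | u <;> rcases h : P.other _ with v | v <;> rw [h] at this <;> exact this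
    | outside u =>
      refine .single ?_
      have := Joined₃.third (T := T) (S := S) (U := U) u
      rcases u with u | u <;> rcases h : U.other _ with v | v <;> rw [h] at this <;> exact this

/-- The induction along the curve keeps track of the boundary point `v` of the two inner tangles at
which the curve last entered their picture. When the curve leaves this picture, it does so at the
other end of the string of `P` through `v`. -/
theorem Connected₃.reduce {a : Node w.size y.size z.size} {b : Node₃ w.size x.size y.size z.size}
    (h : Connected₃ T S U (.ofReduced _ a) b) :
    (∃ c, b = .ofReduced _ c ∧ Connected P U a c) ∨
    (∃ p v, b = .mid₁ p ∧ Connected P U a (.ofInside _ v) ∧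
      Connected T S (.ofBoundary _ v) (.mid p)) := by
  have hstep : ∀ v c, Connected P U a (.ofInside _ v) → Connected T S (.ofBoundary _ v) c →
      (∃ d, Node₃.ofLower z.size c = .ofReduced _ d ∧ Connected P U a d) ∨
      (∃ p v, Node₃.ofLower z.size c = .mid₁ p ∧ Connected P U a (.ofInside _ v) ∧
      Connected T S (.ofBoundary _ v) (.mid p)) := by
    intro v c h1 h2
    -- Arriving at a boundary point `v'` means having returned to `v` or having followed the string
    -- of `P` that starts there.
    have hb : ∀ v', Connected T S (.ofBoundary _ v) (.ofBoundary _ v') →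
        Connected P U a (.ofInside _ v') := by
      intro v' h3
      by_cases e : v = v'
      · exact e ▸ h1
      · rw [← (hP.1 v v').2 ⟨e, h3⟩]
        exact h1.trans (.inside v)
    rcases c with p | p | p
    · exact Or.inl ⟨.inner p, rfl, hb (.inl p) h2⟩
    · exact Or.inr ⟨p, v, rfl, h1, h2⟩
    · exact Or.inl ⟨.mid p, rfl, hb (.inr p) h2⟩
  induction h with
  | refl => exact Or.inl ⟨a, rfl, .refl _⟩
  | @tail b c _ h ih =>
    have lower : ∀ d d' : Node w.size x.size y.size, b = .ofLower _ d → c = .ofLower _ d' →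
        Joined T S d d' → ∃ v, Connected P U a (.ofInside _ v) ∧
          Connected T S (.ofBoundary _ v) d' := by
      rintro d d' rfl rfl hd
      rcases ih with ⟨e, he, h1⟩ | ⟨p, v, he, h1, h2⟩
      · rcases d with p | p | p <;> rcases e with q | q | q <;> cases he
        · exact ⟨.inl p, h1, .single hd⟩
        · exact ⟨.inr p, h1, .single hd⟩
      · rcases d with q | q | q <;> cases he
        exact ⟨v, h1, h2.tail hd⟩
    cases h with
    | first u =>
      obtain ⟨v, h1, h2⟩ := lower (.ofInside _ u) (.ofInside _ (T.other u))
        (by rcases u with u | u <;> rfl) (by rcases T.other u with u | u <;> rfl) (.inside u)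
      have := hstep v _ h1 h2
      rcases h : T.other u with u | u <;> rw [h] at this <;> exact this
    | second u =>
      obtain ⟨v, h1, h2⟩ := lower (.ofOutside _ u) (.ofOutside _ (S.other u))
        (by rcases u with u | u <;> rfl) (by rcases S.other u with u | u <;> rfl) (.outside u)
      have := hstep v _ h1 h2
      rcases h : S.other u with u | u <;> rw [h] at this <;> exact this
    | third u =>
      have h3 : Connected P U a (.ofOutside _ u) := by
        rcases ih with ⟨e, he, h1⟩ | ⟨p, v, he, -⟩
        · rcases u with u | u <;> rcases e with q | q | q <;> cases he <;> exact h1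
        · rcases u with u | u <;> cases he
      have h4 := h3.trans (.outside u)
      refine Or.inl ⟨_, ?_, h4⟩
      rcases U.other u with u | u <;> rfl

theorem connected₃_ofReduced {a b : Node w.size y.size z.size} :
    Connected₃ T S U (.ofReduced _ a) (.ofReduced _ b) ↔ Connected P U a b := by
  refine ⟨fun h => ?_, fun h => h.ofReduced hP⟩
  rcases h.reduce hP with ⟨c, hc, h⟩ | ⟨p, v, hp, -⟩
  · have : b = c := by rcases b with b | b | b <;> rcases c with c | c | c <;> cases hc <;> rfl
    exact this ▸ h
  · rcases b with b | b | b <;> cases hp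

omit hP

/-- A loop of `S ∘ T` never reaches the second circle, so the strings of `U` add nothing to its
component. -/
theorem OnLoop.connected₃ {p : Pt x.size} (hp : OnLoop T S p)
    {b : Node₃ w.size x.size y.size z.size} (h : Connected₃ T S U (.mid₁ p) b) :
    ∃ q, b = .mid₁ q ∧ Connected T S (.mid p) (.mid q) := by
  have hstep : ∀ c, Connected T S (.mid p) c →
      ∃ q, Node₃.ofLower z.size c = .mid₁ q ∧ Connected T S (.mid p) (.mid q) := by
    rintro (q | q | q) h
    · exact absurd h (hp (.inl q))
    · exact ⟨q, rfl, h⟩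
    · exact absurd h (hp (.inr q))
  induction h with
  | refl => exact ⟨p, rfl, .refl _⟩
  | tail _ h ih =>
    obtain ⟨q, he, hq⟩ := ih
    cases h with
    | first u =>
      obtain ⟨u, rfl⟩ : ∃ v, u = .inr v := by rcases u with u | u <;> cases he; exact ⟨_, rfl⟩
      rw [show q = u by cases he; rfl] at hq
      have := hstep _ (hq.trans (.inside (.inr u)))
      rcases h : T.other (.inr u) with v | v <;> rw [h] at this <;> exact this
    | second u =>
      obtain ⟨u, rfl⟩ : ∃ v, u = .inl v := by rcases u with u | u <;> cases he; exact ⟨_, rfl⟩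
      rw [show q = u by cases he; rfl] at hq
      have := hstep _ (hq.trans (.outside (.inl u)))
      rcases h : S.other (.inl u) with v | v <;> rw [h] at this <;> exact this
    | third u => rcases u with u | u <;> cases he

variable (T S U)

/-- The point `a` lies on a loop. -/
def OnLoop₃ (a : Node₃ w.size x.size y.size z.size) : Prop :=
  ∀ u, ¬ Connected₃ T S U a (.ofBoundary _ _ u)

/-- The curve through `a` winds around the annulus. -/
def Winds₃ (a : Node₃ w.size x.size y.size z.size) : Prop :=
  ∃ k : ℤ, k ≠ 0 ∧ Connected₃ T S U a (a.shift k)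

/-- The kind of the loop through `a`; for contractible loops it is read off the leftmost
intersection with one of the two circles. -/
def HasKind₃ : Option Bool → Node₃ w.size x.size y.size z.size → Prop
  | none, a => Winds₃ T S U a
  | some b, a => ¬ Winds₃ T S U a ∧
      ((∃ p, Connected₃ T S U a (.mid₁ p) ∧ (∀ q, Connected₃ T S U a (.mid₁ q) → ¬ q.lt p) ∧
        (Even p.idx ↔ b = true)) ∨
      (∃ p, Connected₃ T S U a (.mid₂ p) ∧ (∀ q, Connected₃ T S U a (.mid₂ q) → ¬ q.lt p) ∧
        (Even p.idx ↔ b = true)))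

/-- The intersections of the curve through `a` with the first circle. -/
def trace₁ (a : Node₃ w.size x.size y.size z.size) : Set ℕ :=
  {j | ∃ q : Pt x.size, q.idx = j ∧ Connected₃ T S U a (.mid₁ q)}

/-- The intersections of the curve through `a` with the second circle. -/
def trace₂ (a : Node₃ w.size x.size y.size z.size) : Set ℕ :=
  {j | ∃ q : Pt y.size, q.idx = j ∧ Connected₃ T S U a (.mid₂ q)}

/-- The loops of a given kind of a picture of three tangles. -/
def loopSet₃ (κ : Option Bool) : Set (Set ℕ × Set ℕ) :=
  {L | ∃ a, OnLoop₃ T S U a ∧ HasKind₃ T S U κ a ∧ L = (trace₁ T S U a, trace₂ T S U a)}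

variable {T S U}

theorem winds₃_congr {a b : Node₃ w.size x.size y.size z.size} (h : Connected₃ T S U a b) :
    Winds₃ T S U a ↔ Winds₃ T S U b :=
  ⟨fun ⟨k, hk, h2⟩ => ⟨k, hk, h.symm.trans (h2.trans (h.shift k))⟩,
    fun ⟨k, hk, h2⟩ => ⟨k, hk, h.trans (h2.trans (h.symm.shift k))⟩⟩

theorem trace_congr {a b : Node₃ w.size x.size y.size z.size} (h : Connected₃ T S U a b) :
    trace₁ T S U a = trace₁ T S U b ∧ trace₂ T S U a = trace₂ T S U b := by
  constructor <;> ext j <;> exact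
    ⟨fun ⟨q, hq, h2⟩ => ⟨q, hq, h.symm.trans h2⟩, fun ⟨q, hq, h2⟩ => ⟨q, hq, h.trans h2⟩⟩

theorem trace_shift (k : ℤ) (a : Node₃ w.size x.size y.size z.size) :
    trace₁ T S U (a.shift k) = trace₁ T S U a ∧ trace₂ T S U (a.shift k) = trace₂ T S U a := by
  have main : ∀ (k : ℤ) (a : Node₃ w.size x.size y.size z.size),
      trace₁ T S U a ⊆ trace₁ T S U (a.shift k) ∧ trace₂ T S U a ⊆ trace₂ T S U (a.shift k) :=
    fun k a => ⟨fun j ⟨q, hq, h⟩ => ⟨q.shift k, hq, h.shift k⟩,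
      fun j ⟨q, hq, h⟩ => ⟨q.shift k, hq, h.shift k⟩⟩
  have h1 := main k a
  have h2 := main (-k) (a.shift k)
  rw [Node₃.shift_shift, add_neg_cancel, Node₃.shift_zero] at h2
  exact ⟨h2.1.antisymm h1.1, h2.2.antisymm h1.2⟩

/-! ### Contractible loops -/

/-- Two intersections with the same number differ by a deck transformation, and a nontrivial one
would make the curve wind. So each number occurs at most once, which makes leftmost points
available. -/
theorem finite_of_not_winds₃ {a : Node₃ w.size x.size y.size z.size} (ha : ¬ Winds₃ T S U a) :
    {p | Connected₃ T S U a (.mid₁ p)}.Finite ∧ {p | Connected₃ T S U a (.mid₂ p)}.Finite := by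
  have main : ∀ {n : ℕ} (f : Pt n → Node₃ w.size x.size y.size z.size),
      (∀ k p, f (p.shift k) = (f p).shift k) → {p | Connected₃ T S U a (f p)}.Finite := by
    intro n f hf
    refine Set.Finite.of_finite_image (f := Pt.idx)
      ((Set.finite_lt_nat (2 * n)).subset ?_) ?_
    · rintro _ ⟨p, -, rfl⟩
      exact p.idx_lt
    · intro p hp q hq hpq
      have e := Pt.eq_shift_of_idx_eq hpq
      by_contra hne
      refine ha ⟨q.sheet - p.sheet, fun h0 => hne (by rw [e, h0, Pt.shift_zero]), ?_⟩
      have h1 : Connected₃ T S U (a.shift (q.sheet - p.sheet)) (f q) := by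
        rw [e, hf]
        simp only [Pt.shift, add_sub_cancel]
        exact Connected₃.shift _ hp
      exact Connected₃.trans hq h1.symm
  exact ⟨main _ fun _ _ => rfl, main _ fun _ _ => rfl⟩

theorem exists_first {n : ℕ} {A : Set (Pt n)} (hA : A.Finite) (hne : A.Nonempty) :
    ∃ p ∈ A, ∀ q ∈ A, ¬ q.lt p := by
  obtain ⟨p, hp, h⟩ := Set.exists_min_image A Pt.toInt hA hne
  exact ⟨p, hp, fun q hq hlt => absurd ((Pt.lt_iff_toInt _ _).1 hlt) (not_lt.2 (h q hq))⟩

/-- On both circles, the leftmost intersection of a contractible loop has the same parity. -/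
theorem even_first_iff {a : Node₃ w.size x.size y.size z.size} (ha : OnLoop₃ T S U a)
    (hw : ¬ Winds₃ T S U a) {p : Pt x.size} {q : Pt y.size}
    (hp : Connected₃ T S U a (.mid₁ p)) (hp' : ∀ r, Connected₃ T S U a (.mid₁ r) → ¬ r.lt p)
    (hq : Connected₃ T S U a (.mid₂ q)) (hq' : ∀ r, Connected₃ T S U a (.mid₂ r) → ¬ r.lt q) :
    Even p.idx ↔ Even q.idx := by
  obtain ⟨fA, fB⟩ := finite_of_not_winds₃ hw
  set A := fA.toFinset
  set B := fB.toFinset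
  have mA : ∀ r, r ∈ A ↔ Connected₃ T S U a (.mid₁ r) := fun r => by simp [A]
  have mB : ∀ r, r ∈ B ↔ Connected₃ T S U a (.mid₂ r) := fun r => by simp [B]
  -- Since the curve is a loop, strings of `T` that start on it cannot end on the internal boundary;
  -- so the intersection set is stable. The same holds for `S` and `U`.
  have hT : ∀ u ∈ (∅ : Finset (Pt w.size)).disjSum A,
      T.other u ∈ (∅ : Finset (Pt w.size)).disjSum A := by
    rintro (u | u) hu
    · simp at hu
    · simp only [Finset.inr_mem_disjSum, mA] at hu
      have h := hu.tail (.first (.inr u))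
      rcases e : T.other (.inr u) with v | v <;> rw [e] at h
      · exact absurd h (ha (.inl v))
      · rw [Finset.inr_mem_disjSum, mA]; exact h
  have hS : ∀ u ∈ A.disjSum B, S.other u ∈ A.disjSum B := by
    intro u hu
    have h1 : Connected₃ T S U a (.ofSecond _ _ u) := by
      rcases u with u | u
      · rw [Finset.inl_mem_disjSum, mA] at hu; exact hu
      · rw [Finset.inr_mem_disjSum, mB] at hu; exact hu
    have h := h1.tail (.second u)
    rcases e : S.other u with v | v <;> rw [e] at h
    · rw [Finset.inl_mem_disjSum, mA]; exact h
    · rw [Finset.inr_mem_disjSum, mB]; exact h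
  have hU : ∀ u ∈ B.disjSum (∅ : Finset (Pt z.size)),
      U.other u ∈ B.disjSum (∅ : Finset (Pt z.size)) := by
    rintro (u | u) hu
    · simp only [Finset.inl_mem_disjSum, mB] at hu
      have h := hu.tail (.third (.inl u))
      rcases e : U.other (.inl u) with v | v <;> rw [e] at h
      · rw [Finset.inl_mem_disjSum, mB]; exact h
      · exact absurd h (ha (.inr v))
    · simp at hu
  have cA : (A.card : ZMod 2) = 0 := by simpa using T.card_eq_zero _ hT
  have cB : (B.card : ZMod 2) = 0 := by simpa using U.card_eq_zero _ hU
  -- The invariant is transported along the loop; on the second circle it is taken with respect to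
  -- `B`.
  have key : ∀ b, Connected₃ T S U (.mid₁ p) b →
      (∀ r, b = .mid₁ r → Pt.rankParity A r = Pt.rankParity A p) ∧
      (∀ r, b = .mid₂ r → Pt.rankParity B r = Pt.rankParity A p) := by
    intro b hb
    induction hb with
    | refl => exact ⟨fun r h => by cases h; rfl, fun r h => by cases h⟩
    | tail hb h ih =>
      have hab := Connected₃.trans hp hb
      cases h with
      | first u =>
        rcases u with u | u
        · exact absurd hab (ha (.inl u))
        · have hm : Sum.inr u ∈ (∅ : Finset (Pt w.size)).disjSum A := by
            rw [Finset.inr_mem_disjSum, mA]; exact hab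
          have hk := T.rankParity_other ∅ A (by simp) cA hT hm
          have hm' := hT _ hm
          rcases e : T.other (.inr u) with v | v <;> rw [e] at hk hm'
          · simp at hm'
          · exact ⟨fun r h => by cases h; exact hk.trans (ih.1 u rfl), fun r h => by cases h⟩
      | second u =>
        have hm : u ∈ A.disjSum B := by
          rcases u with u | u
          · rw [Finset.inl_mem_disjSum, mA]; exact hab
          · rw [Finset.inr_mem_disjSum, mB]; exact hab
        have hk := S.rankParity_other A B cA cB hS hm
        have hu : Sum.elim (Pt.rankParity A) (Pt.rankParity B) u = Pt.rankParity A p := by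
          rcases u with u | u
          · exact ih.1 u rfl
          · exact ih.2 u rfl
        rw [hu] at hk
        rcases e : S.other u with v | v <;> rw [e] at hk
        · exact ⟨fun r h => by cases h; exact hk, fun r h => by cases h⟩
        · exact ⟨fun r h => (by cases h), fun r h => by cases h; exact hk⟩
      | third u =>
        rcases u with u | u
        · have hm : Sum.inl u ∈ B.disjSum (∅ : Finset (Pt z.size)) := by
            rw [Finset.inl_mem_disjSum, mB]; exact hab
          have hk := U.rankParity_other B ∅ cB (by simp) hU hm
          have hm' := hU _ hm
          rcases e : U.other (.inl u) with v | v <;> rw [e] at hk hm'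
          · exact ⟨fun r h => (by cases h), fun r h => by cases h; exact hk.trans (ih.2 u rfl)⟩
          · simp at hm'
        · exact absurd hab (ha (.inr u))
  have := (key _ (hp.symm.trans hq)).2 q rfl
  -- At the leftmost intersections the ranks vanish and only the parities of the numbers remain.
  rw [Pt.rankParity_of_first fun r hr => hp' r ((mA r).1 hr),
    Pt.rankParity_of_first fun r hr => hq' r ((mB r).1 hr)] at this
  exact (even_iff_of_cast_eq this).symm

end Triple

section Triple

variable {w x y z : Obj} {T : LiftedTangle w x} {S : LiftedTangle x y} {U : LiftedTangle y z}

/-! ### Counting loops -/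

theorem onLoop_iff {p : Pt x.size} : OnLoop T S p ↔
    OnLoop₃ T S U (.mid₁ p) ∧ ∀ q, ¬ Connected₃ T S U (.mid₁ p) (.mid₂ q) := by
  constructor
  · intro h
    refine ⟨fun u hu => ?_, fun q hq => ?_⟩
    · obtain ⟨q, hq, -⟩ := h.connected₃ hu
      rcases u with u | u <;> cases hq
    · obtain ⟨q, hq, -⟩ := h.connected₃ hq
      cases hq
  · rintro ⟨h1, h2⟩ u hu
    have := Connected.ofLower (U := U) hu
    rcases u with u | u
    · exact h1 (.inl u) this
    · exact h2 u this

theorem OnLoop.connected_iff {p : Pt x.size} (hp : OnLoop T S p) (q : Pt x.size) :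
    Connected T S (.mid p) (.mid q) ↔ Connected₃ T S U (.mid₁ p) (.mid₁ q) := by
  refine ⟨fun h => h.ofLower, fun h => ?_⟩
  obtain ⟨r, hr, h⟩ := hp.connected₃ h
  cases hr
  exact h

/-- Loops of the triple picture that miss the second circle are exactly the loops of `S ∘ T`; those
that meet it become loops of `U ∘ P`, where they are remembered by their second trace
(`loopSet_eq_image_snd`). -/
theorem loopSet_eq_image_fst (κ : Option Bool) :
    loopSet T S κ = Prod.fst '' {L ∈ loopSet₃ T S U κ | L.2 = ∅} := by
  have tr : ∀ p, OnLoop T S p → loopThrough T S p = trace₁ T S U (.mid₁ p) := by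
    intro p hp
    ext j
    simp only [loopThrough, trace₁, hp.connected_iff (U := U)]
  have tr2 : ∀ p, OnLoop T S p → trace₂ T S U (.mid₁ p) = ∅ := by
    intro p hp
    ext j
    simp only [trace₂, Set.mem_ofPred_eq, Set.mem_empty_iff_false, iff_false]
    rintro ⟨q, -, h⟩
    exact (onLoop_iff.1 hp).2 q h
  have wd : ∀ p, OnLoop T S p → (Winds T S p ↔ Winds₃ T S U (.mid₁ p)) := by
    intro p hp
    simp only [Winds, Winds₃, hp.connected_iff (U := U)]
    rfl
  ext L
  rw [mem_loopSet]
  constructor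
  · rintro ⟨p, hp, hk, rfl⟩
    refine ⟨(_, _), ⟨⟨.mid₁ p, (onLoop_iff.1 hp).1, ?_, rfl⟩, tr2 p hp⟩, (tr p hp).symm⟩
    rcases κ with _ | b
    · exact (wd p hp).1 hk
    · refine ⟨fun h => hk.1 ((wd p hp).2 h), Or.inl ⟨p, .refl _, fun q hq => ?_, hk.2.2⟩⟩
      exact hk.2.1 q ((hp.connected_iff q).2 hq)
  · rintro ⟨_, ⟨⟨a, ha, hk, rfl⟩, he⟩, rfl⟩
    have h2 : ∀ q, ¬ Connected₃ T S U a (.mid₂ q) := by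
      intro q hq
      have : q.idx ∈ trace₂ T S U a := ⟨q, rfl, hq⟩
      change trace₂ T S U a = ∅ at he
      rw [he] at this
      exact this
    have hl : ∀ p, Connected₃ T S U a (.mid₁ p) → OnLoop T S p := fun p hp =>
      onLoop_iff.2 ⟨fun u hu => ha u (hp.trans hu), fun q hq => h2 q (hp.trans hq)⟩
    rcases κ with _ | b
    · rcases a with p | p | p | p
      · exact absurd (.refl _) (ha (.inl p))
      · have hp := hl p (.refl _)
        exact ⟨p, hp, (wd p hp).2 hk, (tr p hp).symm⟩
      · exact absurd (.refl _) (h2 p)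
      · exact absurd (.refl _) (ha (.inr p))
    · obtain ⟨hw, ⟨p, h3, h4, h5⟩ | ⟨p, h3, -⟩⟩ := hk
      · have hp := hl p h3
        refine ⟨p, hp, ⟨fun h => hw ?_, fun q hq => ?_, h5⟩, ?_⟩
        · exact (winds₃_congr h3).2 ((wd p hp).1 h)
        · exact h4 q (h3.trans ((hp.connected_iff q).1 hq))
        · rw [tr p hp]
          exact (trace_congr h3).1
      · exact absurd h3 (h2 p)

variable {P : LiftedTangle w y} (hP : IsReducedComposite T S P)

include hP

theorem loopSet_eq_image_snd (κ : Option Bool) :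
    loopSet P U κ = Prod.snd '' {L ∈ loopSet₃ T S U κ | L.2 ≠ ∅} := by
  have cn : ∀ p q, Connected P U (.mid p) (.mid q) ↔ Connected₃ T S U (.mid₂ p) (.mid₂ q) :=
    fun p q => (connected₃_ofReduced hP).symm
  have ol : ∀ p, OnLoop P U p ↔ OnLoop₃ T S U (.mid₂ p) := by
    intro p
    refine forall_congr' fun u => not_congr ?_
    rcases u with u | u
    · exact (connected₃_ofReduced hP (a := .mid p) (b := .inner u)).symm
    · exact (connected₃_ofReduced hP (a := .mid p) (b := .outer u)).symm
  have tr : ∀ p, loopThrough P U p = trace₂ T S U (.mid₂ p) := by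
    intro p
    ext j
    simp only [loopThrough, trace₂, cn]
  have wd : ∀ p, Winds P U p ↔ Winds₃ T S U (.mid₂ p) := by
    intro p
    simp only [Winds, Winds₃, cn]
    rfl
  ext L
  rw [mem_loopSet]
  constructor
  · rintro ⟨p, hp, hk, rfl⟩
    refine ⟨(_, _), ⟨⟨.mid₂ p, (ol p).1 hp, ?_, rfl⟩, ?_⟩, (tr p).symm⟩
    · rcases κ with _ | b
      · exact (wd p).1 hk
      · refine ⟨fun h => hk.1 ((wd p).2 h), Or.inr ⟨p, .refl _, fun q hq => ?_, hk.2.2⟩⟩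
        exact hk.2.1 q ((cn _ _).2 hq)
    · exact Set.Nonempty.ne_empty ⟨p.idx, p, rfl, .refl _⟩
  · rintro ⟨_, ⟨⟨a, ha, hk, rfl⟩, he⟩, rfl⟩
    obtain ⟨_, r, -, hr⟩ := Set.nonempty_iff_ne_empty.2 he
    have hl : ∀ p, Connected₃ T S U a (.mid₂ p) → OnLoop P U p := fun p hp =>
      (ol p).2 fun u hu => ha u (hp.trans hu)
    rcases κ with _ | b
    · refine ⟨r, hl r hr, (wd r).2 ((winds₃_congr hr).1 hk), ?_⟩
      rw [tr]
      exact (trace_congr hr).2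
    · obtain ⟨q, h3, h4, h5⟩ : ∃ q, Connected₃ T S U a (.mid₂ q) ∧
          (∀ r, Connected₃ T S U a (.mid₂ r) → ¬ r.lt q) ∧ (Even q.idx ↔ b = true) := by
        obtain ⟨hw, ⟨p, h3, h4, h5⟩ | h⟩ := hk
        · obtain ⟨q, hq, hq'⟩ := exists_first (finite_of_not_winds₃ hw).2 ⟨r, hr⟩
          -- The shading may have been read off the first circle, whereas `U ∘ P` only sees the
          -- second one.
          exact ⟨q, hq, hq', (even_first_iff ha hw h3 h4 hq hq').symm.trans h5⟩
        · exact h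
      refine ⟨q, hl q h3, ⟨fun h => hk.1 ?_, fun r hr => ?_, h5⟩, ?_⟩
      · exact (winds₃_congr h3).2 ((wd q).1 h)
      · exact h4 r (h3.trans ((cn _ _).1 hr))
      · rw [tr]
        exact (trace_congr h3).2

omit hP

/-- Needed because `ncard` is additive only on finite sets. The traces are sets of numbers, hence
insensitive to the infinitely many lifts. -/
theorem loopSet₃_finite (κ : Option Bool) : (loopSet₃ T S U κ).Finite := by
  refine Set.Finite.subset (((Set.finite_lt_nat (2 * x.size)).finite_subsets).prod
    ((Set.finite_lt_nat (2 * y.size)).finite_subsets)) ?_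
  rintro _ ⟨a, -, -, rfl⟩
  refine ⟨?_, ?_⟩ <;> rintro _ ⟨q, rfl, -⟩ <;> exact q.idx_lt

include hP

theorem ncard_loopSet_add (κ : Option Bool) :
    (loopSet T S κ).ncard + (loopSet P U κ).ncard = (loopSet₃ T S U κ).ncard := by
  have f1 : {L ∈ loopSet₃ T S U κ | L.2 = ∅}.Finite := (loopSet₃_finite κ).subset fun L h => h.1
  have f2 : {L ∈ loopSet₃ T S U κ | L.2 ≠ ∅}.Finite := (loopSet₃_finite κ).subset fun L h => h.1
  rw [loopSet_eq_image_fst (U := U), loopSet_eq_image_snd hP, Set.InjOn.ncard_image,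
    Set.InjOn.ncard_image, ← Set.ncard_union_eq _ f1 f2]
  · congr 1
    ext L
    simp only [Set.mem_union, Set.mem_ofPred_eq]
    tauto
  · rw [Set.disjoint_left]
    rintro L ⟨-, h1⟩ ⟨-, h2⟩
    exact h2 h1
  -- Two loops with the same nonempty second trace contain points that differ by a deck
  -- transformation. So one is a translate of the other, and their first traces agree too.
  · rintro _ ⟨⟨a, ha, -, rfl⟩, he⟩ _ ⟨⟨b, hb, -, rfl⟩, -⟩ hab
    obtain ⟨_, r, rfl, hr⟩ := Set.nonempty_iff_ne_empty.2 he
    have : r.idx ∈ trace₂ T S U b := by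
      rw [← show trace₂ T S U a = trace₂ T S U b from hab]
      exact ⟨r, rfl, hr⟩
    obtain ⟨s, hs, h⟩ := this
    have e := Pt.eq_shift_of_idx_eq hs
    have h2 : Connected₃ T S U (b.shift (r.sheet - s.sheet)) a := by
      refine Connected₃.trans (h.shift _) (Connected₃.trans ?_ hr.symm)
      rw [e]
      simp only [Node₃.shift, Pt.shift, add_sub_cancel]
      exact .refl _
    exact Prod.ext ((trace_congr h2).1.symm.trans (trace_shift _ _).1) hab
  · rintro L ⟨-, h1⟩ M ⟨-, h2⟩ h
    exact Prod.ext h (h1.trans h2.symm)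

omit hP

theorem loopSet₃_star_subset (κ : Option Bool) :
    Prod.swap '' loopSet₃ T S U κ ⊆ loopSet₃ U.star S.star T.star κ := by
  have wd : ∀ a, Winds₃ U.star S.star T.star (Node₃.flip a) → Winds₃ T S U a := by
    rintro a ⟨k, hk, h⟩
    refine ⟨k, hk, Connected₃.of_flip ?_⟩
    cases a <;> exact h
  have wd2 : ∀ a, Winds₃ T S U a → Winds₃ U.star S.star T.star (Node₃.flip a) := by
    rintro a ⟨k, hk, h⟩
    refine ⟨k, hk, ?_⟩
    have := h.flip
    cases a <;> exact this
  rintro _ ⟨_, ⟨a, ha, hk, rfl⟩, rfl⟩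
  refine ⟨a.flip, fun u hu => ha u.swap (Connected₃.of_flip ?_), ?_, ?_⟩
  · rcases u with u | u <;> exact hu
  · rcases κ with _ | b
    · exact wd2 a hk
    · refine ⟨fun h => hk.1 (wd a h), ?_⟩
      refine hk.2.symm.imp ?_ ?_
      · rintro ⟨p, h1, h2, h3⟩
        exact ⟨p, h1.flip, fun q hq => h2 q (Connected₃.of_flip hq), h3⟩
      · rintro ⟨p, h1, h2, h3⟩
        exact ⟨p, h1.flip, fun q hq => h2 q (Connected₃.of_flip hq), h3⟩
  · refine Prod.ext ?_ ?_
    · ext j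
      exact exists_congr fun q => and_congr_right fun _ => (connected₃_flip (b := .mid₂ q)).symm
    · ext j
      exact exists_congr fun q => and_congr_right fun _ => (connected₃_flip (b := .mid₁ q)).symm

theorem ncard_loopSet₃_star (κ : Option Bool) :
    (loopSet₃ U.star S.star T.star κ).ncard = (loopSet₃ T S U κ).ncard := by
  have h1 := loopSet₃_star_subset (T := T) (S := S) (U := U) κ
  have h2 := loopSet₃_star_subset (T := U.star) (S := S.star) (U := T.star) κ
  rw [T.star_star, S.star_star, U.star_star] at h2
  have e : loopSet₃ U.star S.star T.star κ = Prod.swap '' loopSet₃ T S U κ := by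
    refine Set.Subset.antisymm (fun L hL => ?_) h1
    exact ⟨L.swap, h2 ⟨L, hL, rfl⟩, Prod.swap_swap L⟩
  rw [e, Set.ncard_image_of_injective _ Prod.swap_injective]

variable {Q : LiftedTangle x z} {R : LiftedTangle w z}

include hP

/-- The loops of a triple composite do not depend on the bracketing. -/
theorem ncard_loopSet_assoc (hQ : IsReducedComposite S U Q) (κ : Option Bool) :
    (loopSet T S κ).ncard + (loopSet P U κ).ncard =
      (loopSet S U κ).ncard + (loopSet T Q κ).ncard := by
  -- Reflection exchanges the two intermediate circles and turns the second bracketing into the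
  -- first one for the reflected tangles.
  rw [ncard_loopSet_add hP, ← ncard_loopSet₃_star, ← ncard_loopSet_add hQ.star, loopSet_star,
    loopSet_star]

/-- The right-hand side no longer refers to the bracketing: `P` has disappeared. Associativity is
this statement together with its mirror image. -/
theorem isReducedComposite_iff_connected₃ : IsReducedComposite P U R ↔
    (∀ u v, R.other u = v ↔
      u ≠ v ∧ Connected₃ T S U (.ofBoundary _ _ u) (.ofBoundary _ _ v)) ∧
    R.loops = T.loops + S.loops + U.loops + (loopSet₃ T S U none).ncard := by
  have e : ∀ u : Bd w.size z.size, Node₃.ofReduced x.size (Node.ofBoundary y.size u) =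
      Node₃.ofBoundary _ _ u := by rintro (u | u) <;> rfl
  unfold IsReducedComposite
  refine and_congr ?_ ?_
  · refine forall_congr' fun u => forall_congr' fun v => iff_congr Iff.rfl ?_
    rw [← connected₃_ofReduced hP, e, e]
  · rw [← ncard_loopSet_add hP, hP.2]
    simp only [loopSet]
    constructor <;> intro h <;> omega

theorem isReducedComposite_assoc (hQ : IsReducedComposite S U Q) :
    IsReducedComposite P U R ↔ IsReducedComposite T Q R := by
  have h1 := isReducedComposite_iff_connected₃ (U := U) (R := R) hP
  have h2 := isReducedComposite_iff_connected₃ (U := T.star) (R := R.star) hQ.star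
  have h3 : IsReducedComposite Q.star T.star R.star ↔ IsReducedComposite T Q R :=
    ⟨fun h => h.of_star, fun h => h.star⟩
  rw [h1, ← h3, h2]
  refine and_congr ?_ ?_
  · have e : ∀ u : Bd w.size z.size, (Node₃.ofBoundary y.size x.size u.swap) =
        (Node₃.ofBoundary x.size y.size u).flip := by rintro (u | u) <;> rfl
    have e2 : ∀ u v : Bd w.size z.size, R.star.other u.swap = v.swap ↔ R.other u = v := by
      intro u v
      change (R.other u.swap.swap).swap = _ ↔ _
      rw [Sum.swap_swap]
      exact (Equiv.sumComm _ _).injective.eq_iff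
    constructor
    · intro h u v
      have := h u.swap v.swap
      rw [← e2 u.swap v.swap, Sum.swap_swap, Sum.swap_swap] at this
      rw [this, ← connected₃_flip, ← e, ← e, Sum.swap_swap, Sum.swap_swap]
      exact and_congr_left fun _ => not_congr (Equiv.sumComm _ _).injective.eq_iff
    · intro h u v
      have := h u.swap v.swap
      rw [e2, e, e, connected₃_flip] at this
      rw [this]
      exact and_congr_left fun _ => not_congr (Equiv.sumComm _ _).injective.eq_iff
  · rw [ncard_loopSet₃_star]
    simp only [LiftedTangle.star]
    constructor <;> intro h <;> omega

end Triple

/-! ### Composites in which every curve reaches the boundary -/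

theorem loopSet_eq_empty {x y z : Obj} {T : LiftedTangle x y} {S : LiftedTangle y z}
    (h : ∀ p, ∃ u, Connected T S (.mid p) (.ofBoundary _ u)) (κ : Option Bool) :
    loopSet T S κ = ∅ := by
  ext L
  rw [mem_loopSet]
  simp only [Set.mem_empty_iff_false, iff_false]
  rintro ⟨p, hp, -⟩
  obtain ⟨u, hu⟩ := h p
  exact hp u hu

theorem IsReducedComposite.of_connected_of_ends {x y z : Obj} {T : LiftedTangle x y}
    {S : LiftedTangle y z} {R : LiftedTangle x z}
    (h : ∀ u, Connected T S (.ofBoundary _ u) (.ofBoundary _ (R.other u)))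
    (h2 : ∀ p, ∃ u, Connected T S (.mid p) (.ofBoundary _ u))
    (hl : R.loops = T.loops + S.loops) : IsReducedComposite T S R := by
  refine .of_connected h ?_
  have := loopSet_eq_empty h2 none
  simp only [loopSet] at this
  rw [this, Set.ncard_empty, hl]
  rfl

/-! ## Caps -/

section Cap

variable {i : ℕ} {z y : Obj} (h : IsAlpha i z y)

/-- The marked points which remain when the points with numbers `i` and `i + 1` are joined. -/
def IsAlpha.skip : Pt y.size → Pt z.size
  | ⟨s, j, hj⟩ =>
    if i < 2 * z.size then
      if j + 1 < i then ⟨s, j, by have := h.bounds; omega⟩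
      else ⟨s, j + 2, by have := h.bounds; omega⟩
    else
      if j = 0 then ⟨s - 1, 2 * z.size - 2, by have := h.bounds; omega⟩
      else ⟨s, j, by have := h.bounds; omega⟩

/-- The marked point with number `i`. -/
def IsAlpha.capL (s : ℤ) : Pt z.size := ⟨s, i - 1, by have := h.bounds; omega⟩

/-- The marked point with number `i + 1`. -/
def IsAlpha.capR (s : ℤ) : Pt z.size :=
  if hi : i < 2 * z.size then ⟨s, i, hi⟩ else ⟨s + 1, 0, by have := h.bounds; omega⟩

theorem IsAlpha.other_inr (q : Pt y.size) : (LiftedTangle.a h).other (.inr q) = .inl (h.skip q) := by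
  have := h.bounds
  rcases q with ⟨s, j, hj⟩
  simp only [LiftedTangle.a, capOther, IsAlpha.skip]
  split_ifs <;> rfl

theorem IsAlpha.other_skip (q : Pt y.size) : (LiftedTangle.a h).other (.inl (h.skip q)) = .inr q := by
  rw [← h.other_inr, LiftedTangle.other_other]

theorem IsAlpha.other_capL (s : ℤ) :
    (LiftedTangle.a h).other (.inl (h.capL s)) = .inl (h.capR s) := by
  have := h.bounds
  simp only [LiftedTangle.a, IsAlpha.capL, capOther, IsAlpha.capR]
  split_ifs <;> first | rfl | omega

theorem IsAlpha.other_capR (s : ℤ) :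
    (LiftedTangle.a h).other (.inl (h.capR s)) = .inl (h.capL s) := by
  rw [← h.other_capL, LiftedTangle.other_other]

theorem IsAlpha.capL_shift (s k : ℤ) : (h.capL s).shift k = h.capL (s + k) := rfl

theorem IsAlpha.capR_shift (s k : ℤ) : (h.capR s).shift k = h.capR (s + k) := by
  simp only [capR, Pt.shift]
  split_ifs <;> simp only [Pt.mk.injEq, and_true] <;> ring

theorem IsAlpha.skip_shift (q : Pt y.size) (k : ℤ) : h.skip (q.shift k) = (h.skip q).shift k := by
  rcases q with ⟨s, j, hj⟩
  simp only [skip, Pt.shift]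
  split_ifs <;> simp only [Pt.mk.injEq, *, if_true, if_false, and_true] <;> ring_nf

theorem IsAlpha.skip_lt (p q : Pt y.size) : (h.skip p).lt (h.skip q) ↔ p.lt q := by
  have := h.bounds
  rcases p with ⟨s, j, hj⟩
  rcases q with ⟨s2, j2, hj2⟩
  simp only [skip, Pt.lt]
  split_ifs <;> simp only <;> omega

theorem IsAlpha.skip_injective : Function.Injective h.skip := by
  intro p q e
  have := congrArg (LiftedTangle.a h).other (congrArg Sum.inl e)
  rwa [h.other_skip, h.other_skip, Sum.inr.injEq] at this

theorem IsAlpha.cases (p : Pt z.size) :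
    (∃ q, p = h.skip q) ∨ (∃ s, p = h.capL s) ∨ ∃ s, p = h.capR s := by
  have hb := h.bounds
  rcases e : (LiftedTangle.a h).other (.inl p) with r | q
  · right
    rcases p with ⟨s, j, hj⟩
    simp only [LiftedTangle.a, capOther] at e
    simp only [capL, capR]
    split_ifs at e ⊢ <;> first
      | exact Or.inl ⟨s, by simp only [Pt.mk.injEq, true_and]; omega⟩
      | exact Or.inr ⟨s, by simp only [Pt.mk.injEq, true_and]; omega⟩
      | exact Or.inr ⟨s - 1, by simp only [Pt.mk.injEq]; omega⟩
  · left
    refine ⟨q, ?_⟩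
    rw [LiftedTangle.other_eq_comm, h.other_inr] at e
    exact (Sum.inl.inj e).symm

theorem IsAlpha.skip_ne_capL (q : Pt y.size) (s : ℤ) : h.skip q ≠ h.capL s := by
  intro e
  have := h.other_skip q
  rw [e, h.other_capL] at this
  cases this

theorem IsAlpha.skip_ne_capR (q : Pt y.size) (s : ℤ) : h.skip q ≠ h.capR s := by
  intro e
  have := h.other_skip q
  rw [e, h.other_capR] at this
  cases this

theorem IsAlpha.capL_lt_capR (s : ℤ) : (h.capL s).lt (h.capR s) := by
  have := h.bounds
  simp only [capL, capR, Pt.lt]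
  split_ifs
  · exact Or.inr ⟨rfl, show i - 1 < i by omega⟩
  · exact Or.inl (show s < s + 1 by omega)

theorem IsAlpha.capL_ne_capR (s t : ℤ) : h.capL s ≠ h.capR t := fun e => by
  have := h.bounds
  simp only [IsAlpha.capL, IsAlpha.capR] at e
  split_ifs at e <;> simp only [Pt.mk.injEq] at e <;> omega

theorem IsAlpha.not_between (s : ℤ) (p : Pt z.size) (h1 : (h.capL s).lt p) (h2 : p.lt (h.capR s)) :
    False := by
  have := h.bounds
  rcases p with ⟨s2, j2, hj2⟩
  simp only [capL, capR, Pt.lt] at h1 h2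
  split_ifs at h2 <;> simp only at h2 <;> omega

theorem IsAlpha.capR_lt_iff (s : ℤ) {p : Pt z.size} (hp : p ≠ h.capR s) :
    (h.capR s).lt p ↔ (h.capL s).lt p := by
  constructor
  · exact fun h1 => Pt.lt_trans (h.capL_lt_capR s) h1
  · intro h1
    rcases Pt.lt_trichotomy p (h.capR s) with h2 | h2 | h2
    · exact (h.not_between s p h1 h2).elim
    · exact absurd h2 hp
    · exact h2

theorem IsAlpha.even_skip (q : Pt y.size) : Even (h.skip q).idx ↔ Even q.idx := by
  have := h.bounds
  rcases q with ⟨s, j, hj⟩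
  simp only [skip]
  split_ifs <;> simp only [Nat.even_iff] <;> omega

/-- The interval before a cap and the interval after it bound the same region. So, after removal of
the cap, the first remaining point beyond it takes over the role of its left end. -/
theorem IsAlpha.exists_after_cap (hy : 0 < y.size) (s : ℤ) :
    ∃ q : Pt y.size, (Even q.idx ↔ Even (h.capL s).idx) ∧
      ∀ r, r.lt q ↔ (h.skip r).lt (h.capL s) := by
  have hb := h.bounds
  by_cases h1 : i < 2 * z.size
  · by_cases h2 : i - 1 < 2 * y.size
    · refine ⟨⟨s, i - 1, h2⟩, Iff.rfl, ?_⟩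
      rintro ⟨s2, j2, hj2⟩
      simp only [skip, capL, Pt.lt]
      split_ifs <;> simp only <;> omega
    · obtain rfl : i = 2 * y.size + 1 := by omega
      refine ⟨⟨s + 1, 0, by omega⟩, by simp [capL], ?_⟩
      rintro ⟨s2, j2, hj2⟩
      simp only [skip, capL, Pt.lt]
      split_ifs <;> simp only <;> omega
  -- For `i = 2 * z.size` the point with `idx = 0` is joined to the last point before the cap, so
  -- the first one beyond it has `idx = 1`.
  · refine ⟨⟨s + 1, 1, by omega⟩, by simp only [capL, Nat.even_iff]; omega, ?_⟩
    rintro ⟨s2, j2, hj2⟩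
    simp only [skip, capL, Pt.lt]
    split_ifs <;> simp only <;> omega

/-- `B` is `A` with a cap added. The interval enclosed by the cap is never exposed, and the interval
in front of the cap can be moved behind it without a change of shading. Hence `loop_shading`
survives insertion and removal of caps. -/
theorem isExposed_skip_iff {A : Pt y.size → Pt y.size → Prop} {B : Pt z.size → Pt z.size → Prop}
    (h1 : ∀ q r, B (h.skip q) (h.skip r) ↔ A q r) (h2 : ∀ s p, B (h.capL s) p ↔ p = h.capR s)
    (h3 : ∀ s p, B (h.capR s) p ↔ p = h.capL s)
    (h4 : ∀ q p, B (h.skip q) p → ∃ r, p = h.skip r) (b : Bool) :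
    IsExposed z B b ↔ IsExposed y A b := by
  obtain ⟨k, rfl⟩ : ∃ k, z = .num k := by
    rcases z with k | s
    · exact ⟨k, rfl⟩
    · have := h.bounds.1; simp [Obj.size] at this
  have hz : IsExposed (.num k) B b ↔ ∃ p : Pt (Obj.num k).size,
      (∀ q r : Pt (Obj.num k).size, B q r → q.lt p → r.lt p) ∧ (b = true ↔ Odd p.idx) := Iff.rfl
  have hR : ∀ s, ¬ ∀ q r, B q r → q.lt (h.capR s) → r.lt (h.capR s) := fun s hp =>
    Pt.lt_irrefl _ (hp (h.capL s) (h.capR s) ((h2 _ _).2 rfl) (h.capL_lt_capR s))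
  rcases y with l | σ
  · have hy : IsExposed (.num l) A b ↔ ∃ p : Pt (Obj.num l).size,
      (∀ q r : Pt (Obj.num l).size, A q r → q.lt p → r.lt p) ∧ (b = true ↔ Odd p.idx) := Iff.rfl
    rw [hz, hy]
    constructor
    · rintro ⟨p, hp, hb⟩
      rcases h.cases p with ⟨q, rfl⟩ | ⟨s, rfl⟩ | ⟨s, rfl⟩
      · refine ⟨q, fun r t hrt hr => ?_, ?_⟩
        · exact (h.skip_lt _ _).1 (hp _ _ ((h1 _ _).2 hrt) ((h.skip_lt _ _).2 hr))
        · rw [hb, ← Nat.not_even_iff_odd, ← Nat.not_even_iff_odd, h.even_skip]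
      · obtain ⟨q, hq, hq2⟩ := h.exists_after_cap (Nat.succ_pos l) s
        refine ⟨q, fun r t hrt hr => ?_, ?_⟩
        · exact (hq2 t).2 (hp _ _ ((h1 _ _).2 hrt) ((hq2 r).1 hr))
        · rw [hb, ← Nat.not_even_iff_odd, ← Nat.not_even_iff_odd, hq]
      · exact absurd hp (hR s)
    · rintro ⟨p, hp, hb⟩
      refine ⟨h.skip p, fun q r hqr hq => ?_, ?_⟩
      · rcases h.cases q with ⟨q, rfl⟩ | ⟨s, rfl⟩ | ⟨s, rfl⟩
        · obtain ⟨r, rfl⟩ := h4 _ _ hqr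
          exact (h.skip_lt _ _).2 (hp _ _ ((h1 _ _).1 hqr) ((h.skip_lt _ _).1 hq))
        · rw [h2] at hqr
          subst hqr
          exact (h.capR_lt_iff s (h.skip_ne_capR _ _)).2 hq
        · rw [h3] at hqr
          subst hqr
          exact (h.capR_lt_iff s (h.skip_ne_capR _ _)).1 hq
      · rw [hb, ← Nat.not_even_iff_odd, ← Nat.not_even_iff_odd, h.even_skip]
  · have hk : k = 0 := by
      have := h.bounds.1; simp only [Obj.size] at this; omega
    subst hk
    -- When the last cap is removed there is no remaining point to refer to. Here the convention for
    -- `[0+]` and `[0-]` enters: it matches the interval before the point with number `i`.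
    have hy : ∀ b, IsExposed (.zero σ) A b ↔ (b = true ↔ Odd (i - 1)) := by
      intro b
      rcases σ with _ | _
      · have : i = 1 := h
        subst this
        simp [IsExposed]
      · have : i = 2 := h
        subst this
        simp [IsExposed]
    rw [hz, hy]
    constructor
    · rintro ⟨p, hp, hb⟩
      rcases h.cases p with ⟨q, rfl⟩ | ⟨s, rfl⟩ | ⟨s, rfl⟩
      · exact absurd q.pos (by simp [Obj.size])
      · exact hb
      · exact absurd hp (hR s)
    · intro hb
      refine ⟨h.capL 0, fun q r hqr hq => ?_, hb⟩
      rcases h.cases q with ⟨q, rfl⟩ | ⟨s, rfl⟩ | ⟨s, rfl⟩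
      · exact absurd q.pos (by simp [Obj.size])
      · rw [h2] at hqr
        subst hqr
        exact (h.capR_lt_iff s (h.capL_ne_capR 0 s)).2 hq
      · rw [h3] at hqr
        subst hqr
        exact Pt.lt_trans (h.capL_lt_capR s) hq

/-! ### Insertion and removal of caps -/

variable {x : Obj}

/-- The boundary points of a tangle as boundary points of the tangle with one more cap. -/
def IsAlpha.skipBd (u : Bd x.size y.size) : Bd x.size z.size := Sum.map id h.skip u

/-- `R` is obtained from `T` by insertion of an external cap. -/
structure IsInsertion (T : LiftedTangle x y) (R : LiftedTangle x z) : Prop where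
  other_skip : ∀ u, R.other (h.skipBd u) = h.skipBd (T.other u)
  other_capL : ∀ s, R.other (.inr (h.capL s)) = .inr (h.capR s)
  loops_eq : R.loops = T.loops

theorem IsAlpha.skipBd_injective : Function.Injective (h.skipBd (x := x)) :=
  Function.Injective.sumMap Function.injective_id h.skip_injective

theorem IsAlpha.skipBd_shift (k : ℤ) (u : Bd x.size y.size) :
    h.skipBd (u.shift k) = (h.skipBd u).shift k := by
  rcases u with u | u
  · rfl
  · exact congrArg Sum.inr (h.skip_shift u k)

theorem IsAlpha.skipBd_lt (u v : Bd x.size y.size) : (h.skipBd u).lt (h.skipBd v) ↔ u.lt v := by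
  rcases u with u | u <;> rcases v with v | v
  · exact Iff.rfl
  · exact Iff.rfl
  · exact Iff.rfl
  · exact h.skip_lt v u

theorem IsAlpha.casesBd (u : Bd x.size z.size) :
    (∃ v, u = h.skipBd v) ∨ (∃ s, u = .inr (h.capL s)) ∨ ∃ s, u = .inr (h.capR s) := by
  rcases u with p | p
  · exact Or.inl ⟨.inl p, rfl⟩
  · rcases h.cases p with ⟨q, rfl⟩ | ⟨s, rfl⟩ | ⟨s, rfl⟩
    · exact Or.inl ⟨.inr q, rfl⟩
    · exact Or.inr (Or.inl ⟨s, rfl⟩)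
    · exact Or.inr (Or.inr ⟨s, rfl⟩)

theorem IsAlpha.skipBd_ne_capL (u : Bd x.size y.size) (s : ℤ) : h.skipBd u ≠ .inr (h.capL s) := by
  rcases u with u | u
  · exact fun e => by cases e
  · exact fun e => h.skip_ne_capL u s (Sum.inr.inj e)

theorem IsAlpha.skipBd_ne_capR (u : Bd x.size y.size) (s : ℤ) : h.skipBd u ≠ .inr (h.capR s) := by
  rcases u with u | u
  · exact fun e => by cases e
  · exact fun e => h.skip_ne_capR u s (Sum.inr.inj e)

variable {h}
variable {T : LiftedTangle x y} {R : LiftedTangle x z}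

theorem IsInsertion.other_capR (hR : IsInsertion h T R) (s : ℤ) :
    R.other (.inr (h.capR s)) = .inr (h.capL s) := by
  rw [← hR.other_capL, R.other_other]

/-- The tangle `b_i`. -/
abbrev LiftedTangle.b {i : ℕ} {y z : Obj} (h : IsBeta i y z) : LiftedTangle y z :=
  (LiftedTangle.a h).star

theorem LiftedTangle.b_other_inl (q : Pt y.size) :
    (LiftedTangle.b h).other (.inl q) = .inr (h.skip q) := by
  change ((LiftedTangle.a h).other (.inr q)).swap = _
  rw [h.other_inr]; rfl

theorem LiftedTangle.b_other_skip (q : Pt y.size) :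
    (LiftedTangle.b h).other (.inr (h.skip q)) = .inl q := by
  rw [← LiftedTangle.b_other_inl, LiftedTangle.other_other]

theorem LiftedTangle.b_other_capL (s : ℤ) :
    (LiftedTangle.b h).other (.inr (h.capL s)) = .inr (h.capR s) := by
  change ((LiftedTangle.a h).other (.inl (h.capL s))).swap = _
  rw [h.other_capL]; rfl

theorem LiftedTangle.b_other_capR (s : ℤ) :
    (LiftedTangle.b h).other (.inr (h.capR s)) = .inr (h.capL s) := by
  rw [← LiftedTangle.b_other_capL, LiftedTangle.other_other]

theorem connected_b_skip (q : Pt y.size) :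
    Connected T (.b h) (.mid q) (.ofBoundary _ (.inr (h.skip q))) := by
  have := Connected.outside (T := T) (S := .b h) (.inl q)
  rwa [LiftedTangle.b_other_inl] at this

theorem loopSet_b (T : LiftedTangle x y) (h : IsAlpha i z y) (κ : Option Bool) :
    loopSet T (.b h) κ = ∅ :=
  loopSet_eq_empty (fun p => ⟨_, connected_b_skip p⟩) κ

/-- All points of the common circle continue through `b_i` to the remaining external points, so
gluing relabels these points and adds the cap of `b_i`. -/
theorem IsInsertion.isReducedComposite (hR : IsInsertion h T R) :
    IsReducedComposite T (.b h) R := by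
  have c1 : ∀ u : Bd x.size y.size, Connected T (.b h) (.ofBoundary _ (h.skipBd u))
      (.ofInside _ u) := by
    rintro (u | u)
    · exact .refl _
    · exact (connected_b_skip u).symm
  refine .of_connected_of_ends (fun u => ?_) (fun p => ⟨_, connected_b_skip p⟩) hR.loops_eq
  rcases h.casesBd u with ⟨v, rfl⟩ | ⟨s, rfl⟩ | ⟨s, rfl⟩
  · rw [hR.other_skip]
    exact (c1 v).trans ((Connected.inside v).trans (c1 _).symm)
  · rw [hR.other_capL]
    have := Connected.outside (T := T) (S := .b h) (.inr (h.capL s))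
    rwa [LiftedTangle.b_other_capL] at this
  · rw [hR.other_capR]
    have := Connected.outside (T := T) (S := .b h) (.inr (h.capR s))
    rwa [LiftedTangle.b_other_capR] at this

/-- The condition on the strings of `R` and `T` in `IsInsertion`. -/
structure IsInsertionMap (h : IsAlpha i z y) (f : Bd x.size y.size → Bd x.size y.size)
    (g : Bd x.size z.size → Bd x.size z.size) : Prop where
  skip : ∀ u, g (h.skipBd u) = h.skipBd (f u)
  capL : ∀ s, g (.inr (h.capL s)) = .inr (h.capR s)
  capR : ∀ s, g (.inr (h.capR s)) = .inr (h.capL s)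

theorem IsInsertionMap.isExposed_inl {f : Bd x.size y.size → Bd x.size y.size}
    {g : Bd x.size z.size → Bd x.size z.size} (hg : IsInsertionMap h f g) (b : Bool) :
    IsExposed x (fun p q => g (.inl p) = .inl q) b ↔ IsExposed x (fun p q => f (.inl p) = .inl q) b := by
  have : (fun p q => g (.inl p) = .inl q) = (fun p q => f (.inl p) = .inl q) := by
    funext p q
    have h1 := hg.skip (.inl p)
    change g (.inl p) = _ at h1
    rw [h1]
    exact propext (h.skipBd_injective.eq_iff (b := .inl q))
  rw [this]

theorem IsInsertionMap.isExposed_inr {f : Bd x.size y.size → Bd x.size y.size}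
    {g : Bd x.size z.size → Bd x.size z.size} (hg : IsInsertionMap h f g) (b : Bool) :
    IsExposed z (fun p q => g (.inr p) = .inr q) b ↔ IsExposed y (fun p q => f (.inr p) = .inr q) b := by
  refine isExposed_skip_iff h (fun q r => ?_) (fun s p => ?_) (fun s p => ?_) (fun q p hp => ?_) b
  · have h1 := hg.skip (.inr q)
    change g (.inr (h.skip q)) = _ at h1
    rw [h1]
    exact h.skipBd_injective.eq_iff (b := .inr r)
  · rw [hg.capL, Sum.inr.injEq, eq_comm]
  · rw [hg.capR, Sum.inr.injEq, eq_comm]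
  · have h1 := hg.skip (.inr q)
    change g (.inr (h.skip q)) = _ at h1
    rw [h1] at hp
    rcases e : f (.inr q) with r | r <;> rw [e] at hp
    · cases hp
    · exact ⟨r, (Sum.inr.inj hp).symm⟩

theorem IsInsertionMap.through {f : Bd x.size y.size → Bd x.size y.size}
    {g : Bd x.size z.size → Bd x.size z.size} (hg : IsInsertionMap h f g) {p : Pt x.size}
    {q : Pt z.size} (hq : g (.inl p) = .inr q) : ∃ r, q = h.skip r ∧ f (.inl p) = .inr r := by
  have h1 := hg.skip (.inl p)
  change g (.inl p) = _ at h1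
  rw [h1] at hq
  rcases e : f (.inl p) with r | r <;> rw [e] at hq
  · cases hq
  · exact ⟨r, (Sum.inr.inj hq).symm, rfl⟩

/-- Insertion of an external cap. -/
theorem exists_isInsertion (h : IsAlpha i z y) (T : LiftedTangle x y) : ∃ R, IsInsertion h T R := by
  let g : Bd x.size z.size → Bd x.size z.size
    | .inl p => h.skipBd (T.other (.inl p))
    | .inr p => match (LiftedTangle.a h).other (.inl p) with
      | .inr q => h.skipBd (T.other (.inr q))
      | .inl r => .inr r
  have hg : IsInsertionMap h T.other g := by
    refine ⟨?_, fun s => ?_, fun s => ?_⟩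
    · rintro (u | u)
      · rfl
      · change (match (LiftedTangle.a h).other (.inl (h.skip u)) with
          | .inr q => h.skipBd (T.other (.inr q))
          | .inl r => .inr r) = _
        rw [h.other_skip]
    · change (match (LiftedTangle.a h).other (.inl (h.capL s)) with
          | .inr q => h.skipBd (T.other (.inr q))
          | .inl r => .inr r) = _
      rw [h.other_capL]
    · change (match (LiftedTangle.a h).other (.inl (h.capR s)) with
          | .inr q => h.skipBd (T.other (.inr q))
          | .inl r => .inr r) = _
      rw [h.other_capR]
  refine ⟨⟨g, T.loops, fun u => ?_, fun u => ?_, fun k u => ?_, fun u v => ?_, fun p q hpq => ?_,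
    fun p q hpq => ?_, fun h0 b c hb hc => ?_⟩, ⟨hg.skip, hg.capL, rfl⟩⟩
  · rcases h.casesBd u with ⟨v, rfl⟩ | ⟨s, rfl⟩ | ⟨s, rfl⟩
    · rw [hg.skip, hg.skip, T.other_other]
    · rw [hg.capL, hg.capR]
    · rw [hg.capR, hg.capL]
  · rcases h.casesBd u with ⟨v, rfl⟩ | ⟨s, rfl⟩ | ⟨s, rfl⟩
    · rw [hg.skip]
      exact fun e => T.other_ne v (h.skipBd_injective e)
    · rw [hg.capL]
      exact fun e => Pt.lt_irrefl (h.capL s) (by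
        have := h.capL_lt_capR s; rwa [Sum.inr.inj e] at this)
    · rw [hg.capR]
      exact fun e => Pt.lt_irrefl (h.capR s) (by
        have := h.capL_lt_capR s; rwa [Sum.inr.inj e] at this)
  · rcases h.casesBd u with ⟨v, rfl⟩ | ⟨s, rfl⟩ | ⟨s, rfl⟩
    · rw [← h.skipBd_shift, hg.skip, hg.skip, T.other_shift, h.skipBd_shift]
    · rw [hg.capL]
      change g (.inr ((h.capL s).shift k)) = .inr ((h.capR s).shift k)
      rw [h.capL_shift, h.capR_shift, hg.capL]
    · rw [hg.capR]
      change g (.inr ((h.capR s).shift k)) = .inr ((h.capL s).shift k)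
      rw [h.capL_shift, h.capR_shift, hg.capR]
  -- No point lies between the ends of a cap, so both ends are on the same side of any other string.
  · intro c1 c2 c3
    rcases h.casesBd u with ⟨u, rfl⟩ | ⟨s, rfl⟩ | ⟨s, rfl⟩
    · rcases h.casesBd v with ⟨v, rfl⟩ | ⟨t, rfl⟩ | ⟨t, rfl⟩
      · rw [hg.skip] at c2 c3
        rw [hg.skip] at c3
        rw [h.skipBd_lt] at c1 c2 c3
        exact T.planar u v c1 c2 c3
      · rw [hg.skip] at c2 c3
        rw [hg.capL] at c3
        rcases e : T.other u with w | w <;> rw [e] at c2 c3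
        · exact c2
        · exact Pt.lt_irrefl _ (Pt.lt_trans ((h.capR_lt_iff t (h.skip_ne_capR w t)).1 c3) c2)
      · rw [hg.skip] at c2 c3
        rw [hg.capR] at c3
        rcases e : T.other u with w | w <;> rw [e] at c2 c3
        · exact c2
        · exact Pt.lt_irrefl _ (Pt.lt_trans ((h.capR_lt_iff t (h.skip_ne_capR w t)).2 c3) c2)
    · rw [hg.capL] at c2
      rcases v with v | v
      · exact c1
      · exact Pt.lt_irrefl _ (Pt.lt_trans (Pt.lt_trans c2 c1) (h.capL_lt_capR s))
    · rw [hg.capR] at c2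
      rcases v with v | v
      · exact c1
      · exact h.not_between s v c2 c1
  · obtain ⟨r, -, hr⟩ := hg.through hpq
    exact T.loops_eq_zero p r hr
  · obtain ⟨r, rfl, hr⟩ := hg.through hpq
    exact (T.through_shading p r hr).trans (h.even_skip r).symm
  · refine T.loop_shading (fun p q e => h0 p (h.skip q) ?_) b c ((hg.isExposed_inl b).1 hb)
      ((hg.isExposed_inr c).1 hc)
    exact (hg.skip (.inl p)).trans (by rw [e]; rfl)

/-- Removal of an external cap. -/
theorem exists_isInsertion_of_cap (h : IsAlpha i z y) (R : LiftedTangle x z)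
    (hR : ∃ s, R.other (.inr (h.capL s)) = .inr (h.capR s)) : ∃ T, IsInsertion h T R := by
  -- One lift of the cap suffices, by equivariance under deck transformations.
  have hL : ∀ s, R.other (.inr (h.capL s)) = .inr (h.capR s) := by
    intro s
    obtain ⟨s0, h0⟩ := hR
    have := R.other_shift (s - s0) (.inr (h.capL s0))
    rw [h0] at this
    have e1 : Bd.shift (m := x.size) (s - s0) (.inr (h.capL s0)) = .inr (h.capL s) := by
      change Sum.inr ((h.capL s0).shift (s - s0)) = _
      rw [h.capL_shift, add_sub_cancel]
    have e2 : Bd.shift (m := x.size) (s - s0) (.inr (h.capR s0)) = .inr (h.capR s) := by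
      change Sum.inr ((h.capR s0).shift (s - s0)) = _
      rw [h.capR_shift, add_sub_cancel]
    rwa [e1, e2] at this
  have hR : ∀ s, R.other (.inr (h.capR s)) = .inr (h.capL s) := fun s => by
    rw [← hL, R.other_other]
  have hex : ∀ u, ∃ v, R.other (h.skipBd u) = h.skipBd v := by
    intro u
    rcases h.casesBd (R.other (h.skipBd u)) with ⟨v, hv⟩ | ⟨s, hs⟩ | ⟨s, hs⟩
    · exact ⟨v, hv⟩
    · rw [R.other_eq_comm, hL] at hs
      exact absurd hs.symm (h.skipBd_ne_capR _ _)
    · rw [R.other_eq_comm, hR] at hs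
      exact absurd hs.symm (h.skipBd_ne_capL _ _)
  choose f hf using hex
  have hg : IsInsertionMap h f R.other := ⟨hf, hL, hR⟩
  have thr : ∀ {p q}, f (.inl p) = .inr q → R.other (.inl p) = .inr (h.skip q) := fun {p q} e =>
    (hg.skip (.inl p)).trans (by rw [e]; rfl)
  refine ⟨⟨f, R.loops, fun u => ?_, fun u => ?_, fun k u => ?_, fun u v => ?_, fun p q hpq => ?_,
    fun p q hpq => ?_, fun h0 b c hb hc => ?_⟩, ⟨hg.skip, hg.capL, rfl⟩⟩
  · apply h.skipBd_injective
    rw [← hf, ← hf, R.other_other]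
  · intro e
    exact R.other_ne (h.skipBd u) (by rw [hf, e])
  · apply h.skipBd_injective
    rw [← hf, h.skipBd_shift, R.other_shift, hf, h.skipBd_shift]
  · rw [← h.skipBd_lt, ← h.skipBd_lt, ← h.skipBd_lt, ← hf, ← hf]
    exact R.planar _ _
  · exact R.loops_eq_zero p _ (thr hpq)
  · exact (R.through_shading p _ (thr hpq)).trans (h.even_skip q)
  · refine R.loop_shading (fun p q e => ?_) b c ((hg.isExposed_inl b).2 hb)
      ((hg.isExposed_inr c).2 hc)
    obtain ⟨r, -, hr⟩ := hg.through e
    exact h0 p r hr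

end Cap

/-! ## Rotations -/

/-- The marked point `c` places after `p`. -/
def Pt.add {n : ℕ} (c : ℤ) (p : Pt n) : Pt n := Pt.ofInt p.pos (p.toInt + c)

theorem Pt.toInt_add {n : ℕ} (c : ℤ) (p : Pt n) : (p.add c).toInt = p.toInt + c :=
  Pt.toInt_ofInt _ _

theorem Pt.add_add {n : ℕ} (c d : ℤ) (p : Pt n) : (p.add c).add d = p.add (c + d) :=
  Pt.toInt_injective (by simp only [Pt.toInt_add]; ring)

theorem Pt.add_zero {n : ℕ} (p : Pt n) : p.add 0 = p :=
  Pt.toInt_injective (by simp only [Pt.toInt_add]; ring)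

theorem Pt.add_shift {n : ℕ} (c k : ℤ) (p : Pt n) : (p.shift k).add c = (p.add c).shift k :=
  Pt.toInt_injective (by simp only [Pt.toInt_add, Pt.toInt_shift]; ring)

theorem Pt.add_lt_add {n : ℕ} (c : ℤ) (p q : Pt n) : (p.add c).lt (q.add c) ↔ p.lt q := by
  simp only [Pt.lt_iff_toInt, Pt.toInt_add]; omega

theorem Pt.add_mul {n : ℕ} (k : ℤ) (p : Pt n) : p.add (k * (2 * n)) = p.shift k :=
  Pt.toInt_injective (by simp only [Pt.toInt_add, Pt.toInt_shift])

theorem Pt.even_idx_iff {n : ℕ} (p : Pt n) : Even p.idx ↔ Even p.toInt := by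
  have : p.toInt = 2 * (p.sheet * n) + p.idx := by simp only [Pt.toInt]; ring
  rw [this, Int.even_add, Int.even_coe_nat]
  simp

theorem Pt.even_add {n : ℕ} (c : ℤ) (p : Pt n) : Even (p.add (2 * c)).idx ↔ Even p.idx := by
  rw [Pt.even_idx_iff, Pt.even_idx_iff, Pt.toInt_add, Int.even_add]
  simp

theorem Pt.add_two {n : ℕ} (s : ℤ) (j : ℕ) (hj : j < 2 * n) : (⟨s, j, hj⟩ : Pt n).add 2 =
    if h : j + 2 < 2 * n then ⟨s, j + 2, h⟩ else ⟨s + 1, j + 2 - 2 * n, by omega⟩ := by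
  apply Pt.toInt_injective
  rw [Pt.toInt_add]
  split_ifs with h
  · simp only [Pt.toInt]; push_cast; ring
  · simp only [Pt.toInt]
    rw [Nat.cast_sub (by omega)]
    push_cast
    ring

section Rotate

variable {x y : Obj}

/-- The rotation of the external boundary points. -/
def Bd.rotate {m n : ℕ} (c : ℤ) : Bd m n → Bd m n := Sum.map id (Pt.add (2 * c))

theorem Bd.rotate_rotate {m n : ℕ} (c d : ℤ) (u : Bd m n) :
    (u.rotate c).rotate d = u.rotate (c + d) := by
  rcases u with u | u
  · rfl
  · simp only [Bd.rotate, Sum.map_inr, Pt.add_add, mul_add]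

theorem Bd.rotate_zero {m n : ℕ} (u : Bd m n) : u.rotate 0 = u := by
  rcases u with u | u
  · rfl
  · simp only [Bd.rotate, Sum.map_inr, mul_zero, Pt.add_zero]

theorem Bd.rotate_neg_rotate {m n : ℕ} (c : ℤ) (u : Bd m n) : (u.rotate (-c)).rotate c = u := by
  rw [Bd.rotate_rotate, neg_add_cancel, Bd.rotate_zero]

theorem Bd.rotate_shift {m n : ℕ} (c k : ℤ) (u : Bd m n) :
    (u.shift k).rotate c = (u.rotate c).shift k := by
  rcases u with u | u
  · rfl
  · exact congrArg Sum.inr (Pt.add_shift _ _ _)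

theorem Bd.rotate_lt {m n : ℕ} (c : ℤ) (u v : Bd m n) :
    (u.rotate c).lt (v.rotate c) ↔ u.lt v := by
  rcases u with u | u <;> rcases v with v | v
  · exact Iff.rfl
  · exact Iff.rfl
  · exact Iff.rfl
  · exact Pt.add_lt_add _ _ _

/-- Moving an exposed interval by an even number of places keeps its shading. -/
theorem isExposed_add {A B : Pt y.size → Pt y.size → Prop} (c : ℤ)
    (h : ∀ p q, B (p.add (2 * c)) (q.add (2 * c)) ↔ A p q) {b : Bool} (hB : IsExposed y B b) :
    IsExposed y A b := by
  rcases y with k | s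
  · obtain ⟨p, hp, hb⟩ : ∃ p : Pt (Obj.num k).size,
      (∀ q r : Pt (Obj.num k).size, B q r → q.lt p → r.lt p) ∧ (b = true ↔ Odd p.idx) := hB
    refine ⟨p.add (2 * -c), fun q r hqr hq => ?_, ?_⟩
    · have e : p = (p.add (2 * -c)).add (2 * c) := by
        rw [Pt.add_add]
        exact (p.add_zero).symm.trans (congrArg p.add (by ring))
      have := hp _ _ ((h q r).2 hqr)
      rw [e] at this
      exact (Pt.add_lt_add _ _ _).1 (this ((Pt.add_lt_add _ _ _).2 hq))
    · rw [hb, ← Nat.not_even_iff_odd, ← Nat.not_even_iff_odd]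
      exact not_congr (Pt.even_add _ _).symm
  · cases s <;> exact hB

/-- The tangle `T` with its external boundary points rotated. -/
def LiftedTangle.rotate (c : ℤ) (T : LiftedTangle x y) : LiftedTangle x y where
  other u := (T.other (u.rotate (-c))).rotate c
  loops := T.loops
  other_other u := by
    simp only [Bd.rotate_rotate, add_neg_cancel, Bd.rotate_zero, T.other_other, neg_add_cancel]
  other_ne u e := T.other_ne (u.rotate (-c)) (by
    have := congrArg (Bd.rotate (-c)) e
    rwa [Bd.rotate_rotate, add_neg_cancel, Bd.rotate_zero] at this)
  other_shift k u := by rw [Bd.rotate_shift, T.other_shift, Bd.rotate_shift]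
  planar u v := by
    have e : ∀ u v : Bd x.size y.size, u.lt (v.rotate c) ↔ (u.rotate (-c)).lt v := fun u v => by
      rw [← Bd.rotate_lt c (u.rotate (-c)), Bd.rotate_neg_rotate]
    rw [← Bd.rotate_lt (-c) u, e, Bd.rotate_lt c]
    exact T.planar _ _
  loops_eq_zero p q h := T.loops_eq_zero p (q.add (2 * -c)) (by
    have := congrArg (Bd.rotate (-c)) h
    rwa [Bd.rotate_rotate, add_neg_cancel, Bd.rotate_zero] at this)
  through_shading p q h := by
    rw [T.through_shading p (q.add (2 * -c)), Pt.even_add]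
    have := congrArg (Bd.rotate (-c)) h
    rwa [Bd.rotate_rotate, add_neg_cancel, Bd.rotate_zero] at this
  loop_shading := by
    intro h b d hb hd
    refine T.loop_shading (fun p q e => h p (q.add (2 * c)) ?_) b d ?_ (isExposed_add c ?_ hd)
    · change (T.other (.inl p)).rotate c = _
      rw [e]; rfl
    · convert hb using 3 with p q
      change T.other (.inl p) = _ ↔ (T.other (.inl p)).rotate c = _
      rcases T.other (.inl p) with r | r
      · exact Iff.rfl
      · exact ⟨fun e => (by cases e), fun e => (by cases e)⟩
    · intro p q
      change (T.other (.inr ((p.add (2 * c)).add (2 * -c)))).rotate c = _ ↔ _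
      rw [Pt.add_add, show 2 * c + 2 * -c = 0 by ring, Pt.add_zero]
      constructor
      · intro e
        have := congrArg (Bd.rotate (-c)) e
        rw [Bd.rotate_rotate, add_neg_cancel, Bd.rotate_zero] at this
        rw [this]
        change Sum.inr ((q.add (2 * c)).add (2 * -c)) = _
        rw [Pt.add_add, show 2 * c + 2 * -c = 0 by ring, Pt.add_zero]
      · intro e
        rw [e]; rfl

/-- The rotation by `2 * c` places. -/
def LiftedTangle.rot (x : Obj) (c : ℤ) : LiftedTangle x x := (LiftedTangle.idt x).rotate c

theorem LiftedTangle.rot_other_inl (c : ℤ) (p : Pt x.size) :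
    (LiftedTangle.rot x c).other (.inl p) = .inr (p.add (2 * c)) := rfl

theorem LiftedTangle.rot_other_inr (c : ℤ) (p : Pt x.size) :
    (LiftedTangle.rot x c).other (.inr p) = .inl (p.add (2 * -c)) := rfl

theorem LiftedTangle.rotate_zero (T : LiftedTangle x y) : T.rotate 0 = T := by
  ext1
  · funext u
    change (T.other (u.rotate (-0))).rotate 0 = _
    rw [neg_zero, Bd.rotate_zero, Bd.rotate_zero]
  · rfl

theorem LiftedTangle.rotate_rotate (c d : ℤ) (T : LiftedTangle x y) :
    (T.rotate c).rotate d = T.rotate (c + d) := by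
  ext1
  · funext u
    change ((T.other ((u.rotate (-d)).rotate (-c))).rotate c).rotate d = _
    rw [Bd.rotate_rotate, Bd.rotate_rotate, ← neg_add, add_comm d c]
    rfl
  · rfl

theorem LiftedTangle.rot_zero : LiftedTangle.rot x 0 = .idt x := LiftedTangle.rotate_zero _

theorem LiftedTangle.rot_star (c : ℤ) : (LiftedTangle.rot x c).star = .rot x (-c) := by
  ext1
  · funext u
    rcases u with u | u
    · rfl
    · change Sum.inl (u.add (2 * c)) = Sum.inl (u.add (2 * - -c))
      rw [neg_neg]
  · rfl

theorem LiftedTangle.t_eq_rot (hx : 1 ≤ x.size) : LiftedTangle.t x hx = .rot x 1 := by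
  ext1
  · funext u
    have key : ∀ p : Pt x.size, (LiftedTangle.t x hx).other (.inl p) = .inr (p.add 2) := by
      rintro ⟨s, j, hj⟩
      rw [Pt.add_two]
      simp only [LiftedTangle.t, rotOther]
      split_ifs <;> rfl
    rcases u with p | p
    · exact key p
    · rw [LiftedTangle.other_eq_comm, LiftedTangle.rot_other_inr, key, Pt.add_add]
      exact congrArg Sum.inr (p.add_zero)
  · rfl

theorem connected_rot (T : LiftedTangle x y) (c : ℤ) (p : Pt y.size) :
    Connected T (.rot y c) (.mid p) (.ofBoundary _ (.inr (p.add (2 * c)))) :=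
  Connected.outside (T := T) (S := .rot y c) (.inl p)

theorem loopSet_rot (T : LiftedTangle x y) (c : ℤ) (κ : Option Bool) :
    loopSet T (.rot y c) κ = ∅ :=
  loopSet_eq_empty (fun p => ⟨_, connected_rot T c p⟩) κ

theorem isReducedComposite_rot (T : LiftedTangle x y) (c : ℤ) :
    IsReducedComposite T (.rot y c) (T.rotate c) := by
  have c1 : ∀ u : Bd x.size y.size, Connected T (.rot y c) (.ofBoundary _ (u.rotate c))
      (.ofInside _ u) := by
    rintro (u | u)
    · exact .refl _
    · exact (connected_rot T c u).symm
  refine .of_connected_of_ends (fun u => ?_) (fun p => ⟨_, connected_rot T c p⟩) rfl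
  have := (c1 (u.rotate (-c))).trans ((Connected.inside _).trans (c1 _).symm)
  rwa [Bd.rotate_neg_rotate] at this

theorem isReducedComposite_idt (T : LiftedTangle x y) : IsReducedComposite T (.idt y) T := by
  have := isReducedComposite_rot T 0
  rwa [T.rotate_zero, LiftedTangle.rot_zero] at this

/-- Rotating by `2 * n` places is a full turn, that is, a Dehn twist. This is the source of `τ ^ n =
id`. -/
theorem LiftedTangle.rot_equivalent (c k : ℤ) :
    (LiftedTangle.rot x c).Equivalent (.rot x (c + k * x.size)) := by
  refine ⟨rfl, k, fun u => ?_⟩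
  rcases u with p | p
  · change Sum.inr (p.add (2 * (c + k * x.size))) = Sum.inr ((p.add (2 * c)).shift k)
    rw [← Pt.add_mul, Pt.add_add]
    congr 2; ring
  · change Sum.inl ((p.shift k).add (2 * -(c + k * x.size))) = Sum.inl (p.add (2 * -c))
    rw [← Pt.add_mul, Pt.add_add]
    congr 2; ring

end Rotate

/-! ## Tangles without marked points -/

section Zero

variable {x : Obj} {s s' : Sign}

theorem isEmpty_zero (s : Sign) : IsEmpty (Pt (Obj.zero s).size) :=
  ⟨fun p => absurd p.pos (by simp [Obj.size])⟩

theorem LiftedTangle.odd_loops_iff (S : LiftedTangle (.zero s) (.zero s')) :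
    Odd S.loops ↔ s ≠ s' := by
  have e : ∀ (s : Sign) (A : Pt (Obj.zero s).size → Pt (Obj.zero s).size → Prop),
      IsExposed (.zero s) A (match s with | .plus => false | .minus => true) := by
    intro s A; cases s <;> rfl
  rw [S.loop_shading (fun p => (isEmpty_zero s).elim p) _ _ (e _ _) (e _ _)]
  cases s <;> cases s' <;> simp

theorem LiftedTangle.ext_zero {S S' : LiftedTangle (.zero s) (.zero s')}
    (h : S.loops = S'.loops) : S = S' := by
  ext1
  · funext u
    rcases u with p | p
    · exact (isEmpty_zero s).elim p
    · exact (isEmpty_zero s').elim p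
  · exact h

theorem loopSet_of_zero {T : LiftedTangle x (.zero s)} {S : LiftedTangle (.zero s) (.zero s')}
    (κ : Option Bool) : loopSet T S κ = ∅ :=
  loopSet_eq_empty (fun p => (isEmpty_zero s).elim p) κ

/-- Nothing is glued along a circle without points; only the loops add up. The parity condition is
checked by passing through the region at the common circle, whose shading is its sign. -/
theorem exists_isReducedComposite_zero (T : LiftedTangle x (.zero s))
    (S : LiftedTangle (.zero s) (.zero s')) : ∃ R, IsReducedComposite T S R := by
  refine ⟨⟨T.other, T.loops + S.loops, T.other_other, T.other_ne, T.other_shift, T.planar,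
    fun p q => (isEmpty_zero s').elim q, fun p q => (isEmpty_zero s').elim q, ?_⟩, ?_⟩
  · intro h b c hb hc
    have h1 := fun c' => T.loop_shading h b c' hb
    have h2 := S.odd_loops_iff
    rw [Nat.odd_add, ← Nat.not_odd_iff_even, h2]
    cases s <;> cases s' <;> cases b <;> cases c <;> simp_all [IsExposed]
  · refine .of_connected_of_ends (fun u => ?_) (fun p => (isEmpty_zero s).elim p) rfl
    have := Connected.inside (T := T) (S := S) u
    change Connected T S _ (Node.ofBoundary (Obj.zero s).size (T.other u))
    rcases u with p | p
    · rcases h : T.other (.inl p) with q | q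
      · have h2 := (congrArg (fun v => Connected T S (.inner p) (.ofInside (Obj.zero s').size v))
          h).mp this
        exact (congrArg (fun v : Bd x.size (Obj.zero s').size => Connected T S (.inner p)
          (.ofBoundary (Obj.zero s).size v)) h).mpr h2
      · exact (isEmpty_zero s).elim q
    · exact (isEmpty_zero s').elim p

end Zero

/-! ## Innermost caps and tangles without caps -/

section Peel

variable {x y z : Obj}

theorem IsAlpha.toInt_capR {i : ℕ} (h : IsAlpha i z y) (s : ℤ) :
    (h.capR s).toInt = (h.capL s).toInt + 1 := by
  have := h.bounds
  simp only [capL, capR, Pt.toInt]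
  split_ifs
  · push_cast [Nat.cast_sub this.2.1]; ring
  · have e : (i : ℤ) = 2 * z.size := by omega
    push_cast [Nat.cast_sub this.2.1]
    rw [e]; ring

/-- Every point is the left end of a possible cap, with `i = p.idx + 1`. On `[1]`, the parity of the
point decides between the targets `[0+]` and `[0-]`. -/
theorem exists_isAlpha_capL (p : Pt z.size) : ∃ (i : ℕ) (y : Obj) (h : IsAlpha i z y),
    p = h.capL p.sheet ∧ p.add 1 = h.capR p.sheet := by
  obtain ⟨i, y, h, hi⟩ : ∃ (i : ℕ) (y : Obj), ∃ _ : IsAlpha i z y, i = p.idx + 1 := by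
    rcases z with (_ | k) | s
    · have := p.idx_lt
      simp only [Obj.size] at this
      have : p.idx = 0 ∨ p.idx = 1 := by omega
      rcases this with h | h
      · exact ⟨1, .zero .plus, rfl, by omega⟩
      · exact ⟨2, .zero .minus, rfl, by omega⟩
    · have := p.idx_lt
      simp only [Obj.size] at this
      exact ⟨p.idx + 1, .num k, ⟨rfl, by omega, by omega⟩, rfl⟩
    · exact (isEmpty_zero s).elim p
  refine ⟨i, y, h, ?_⟩
  have e : p = h.capL p.sheet := by
    ext
    · rfl
    · simp [IsAlpha.capL, hi]
  refine ⟨e, Pt.toInt_injective ?_⟩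
  rw [h.toInt_capR, Pt.toInt_add, ← e]

/-- A tangle with a string that joins two external points has an external cap. -/
theorem exists_cap (R : LiftedTangle x z) {p q : Pt z.size} (hpq : R.other (.inr p) = .inr q) :
    ∃ (i : ℕ) (y : Obj) (h : IsAlpha i z y) (T : LiftedTangle x y), IsInsertion h T R := by
  -- Induction on the number `d` of points strictly between the ends: by planarity the string at the
  -- next point `p.add 1` stays inside and encloses fewer points.
  have main : ∀ (d : ℕ) (p q : Pt z.size), R.other (.inr p) = .inr q →
      q.toInt = p.toInt + 1 + d → ∃ p : Pt z.size, R.other (.inr p) = .inr (p.add 1) := by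
    intro d
    induction d using Nat.strong_induction_on with
    | _ d ih =>
      intro p q hpq hd
      rcases Nat.eq_zero_or_pos d with rfl | hd0
      · refine ⟨p, ?_⟩
        rw [hpq, show q = p.add 1 from Pt.toInt_injective (by rw [Pt.toInt_add, hd]; simp)]
      · have hqp := R.other_eq_comm.1 hpq
        have h1 : (p.add 1).lt q := by rw [Pt.lt_iff_toInt, Pt.toInt_add]; omega
        have h2 : p.lt (p.add 1) := by rw [Pt.lt_iff_toInt, Pt.toInt_add]; omega
        -- The external line is ordered backwards in `Bd.lt`, so the string is entered at `q`.
        have := R.other_between (u := .inr q) (v := .inr (p.add 1)) h1 (by rw [hqp]; exact h2)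
        rw [hqp] at this
        rcases e : R.other (.inr (p.add 1)) with r | r <;> rw [e] at this
        · exact this.1.elim
        · have h3 : r.toInt < q.toInt := (Pt.lt_iff_toInt _ _).1 this.1
          have h4 : p.toInt < r.toInt := (Pt.lt_iff_toInt _ _).1 this.2
          have h5 : r.toInt ≠ (p.add 1).toInt := fun h => R.other_ne _ (Pt.toInt_injective h ▸ e)
          rw [Pt.toInt_add] at h5
          exact ih (r.toInt - p.toInt - 2).toNat (by omega) _ _ e (by rw [Pt.toInt_add]; omega)
  obtain ⟨p, hp⟩ : ∃ p : Pt z.size, R.other (.inr p) = .inr (p.add 1) := by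
    rcases Pt.lt_trichotomy p q with h | h | h
    · rw [Pt.lt_iff_toInt] at h
      exact main (q.toInt - p.toInt - 1).toNat p q hpq (by omega)
    · exact absurd (h ▸ hpq) (R.other_ne _)
    · rw [Pt.lt_iff_toInt] at h
      exact main (p.toInt - q.toInt - 1).toNat q p (R.other_eq_comm.1 hpq) (by omega)
  obtain ⟨i, y, h, e1, e2⟩ := exists_isAlpha_capL p
  refine ⟨i, y, h, exists_isInsertion_of_cap h R ⟨p.sheet, ?_⟩⟩
  rw [← e1, ← e2, hp]

/-- All strings connect the internal and the external boundary. -/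
def LiftedTangle.IsThrough (S : LiftedTangle x y) : Prop :=
  (∀ p q, S.other (.inl p) ≠ .inl q) ∧ ∀ p q, S.other (.inr p) ≠ .inr q

/-- The strings define an order-preserving bijection between two copies of the integers, hence a
translation. Compatibility with deck transformations forces equal numbers of points, and the shading
forces the translation to be even. -/
theorem LiftedTangle.IsThrough.exists_add {S : LiftedTangle x y} (hS : S.IsThrough) :
    x.size = y.size ∧ ∀ e : x = y, 0 < x.size → ∃ c, S = e ▸ LiftedTangle.rot x c := by
  have hf : ∀ p, ∃ q, S.other (.inl p) = .inr q := fun p => by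
    rcases h : S.other (.inl p) with q | q
    · exact absurd h (hS.1 p q)
    · exact ⟨q, rfl⟩
  have hg : ∀ q, ∃ p, S.other (.inl p) = .inr q := fun q => by
    rcases h : S.other (.inr q) with p | p
    · exact ⟨p, S.other_eq_comm.1 h⟩
    · exact absurd h (hS.2 q p)
  choose f hf using hf
  have hsurj : Function.Surjective f := fun q => by
    obtain ⟨p, hp⟩ := hg q
    exact ⟨p, Sum.inr.inj ((hf p).symm.trans hp)⟩
  have hmono : ∀ p q, p.lt q → (f p).lt (f q) := by
    intro p q hpq
    have := S.planar (.inl p) (.inl q) hpq (by rw [hf]; trivial)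
    rw [hf, hf] at this
    rcases Pt.lt_trichotomy (f p) (f q) with h | h | h
    · exact h
    · have h2 : (Sum.inl p : Bd x.size y.size) = .inl q :=
        S.other_injective (by rw [hf, hf, h])
      exact absurd (Sum.inl.inj h2 ▸ hpq) (Pt.lt_irrefl _)
    · exact absurd h this
  rcases Nat.eq_zero_or_pos x.size with hx | hx
  · have hy : y.size = 0 := by
      by_contra hy
      obtain ⟨p, -⟩ := hg ⟨0, 0, by omega⟩
      have := p.pos
      omega
    exact ⟨hx.trans hy.symm, fun _ h => absurd h (by omega)⟩
  · set o : Pt x.size := Pt.ofInt hx 0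
    -- A monotone bijection commutes with the successor: the preimage `q` of the successor of `f p`
    -- lies beyond `p`, and nothing fits between.
    have hadd : ∀ p : Pt x.size, f (p.add 1) = (f p).add 1 := by
      intro p
      obtain ⟨q, hq⟩ := hsurj ((f p).add 1)
      have h1 : (f p).lt (f (p.add 1)) :=
        hmono _ _ (by rw [Pt.lt_iff_toInt, Pt.toInt_add]; omega)
      have h2 : p.lt q := by
        rcases Pt.lt_trichotomy p q with h | h | h
        · exact h
        · exfalso
          rw [← h] at hq
          have := congrArg Pt.toInt hq
          rw [Pt.toInt_add] at this; omega
        · exfalso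
          have := hmono _ _ h
          rw [hq, Pt.lt_iff_toInt, Pt.toInt_add] at this; omega
      rw [Pt.lt_iff_toInt] at h1 h2
      rcases Pt.lt_trichotomy (p.add 1) q with h | h | h
      · have := hmono _ _ h
        rw [hq, Pt.lt_iff_toInt, Pt.toInt_add] at this; omega
      · rw [h, hq]
      · rw [Pt.lt_iff_toInt, Pt.toInt_add] at h; omega
    have haddn : ∀ (n : ℕ) (p : Pt x.size), f (p.add n) = (f p).add n := by
      intro n p
      induction n with
      | zero => simp only [Nat.cast_zero, Pt.add_zero]
      | succ n ih =>
        push_cast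
        rw [← Pt.add_add, hadd, ih, Pt.add_add]
    have haddz : ∀ (c : ℤ) (p : Pt x.size), f (p.add c) = (f p).add c := by
      intro c p
      rcases Int.eq_nat_or_neg c with ⟨n, rfl | rfl⟩
      · exact haddn n p
      · have := haddn n (p.add (-n))
        rw [Pt.add_add, neg_add_cancel, Pt.add_zero] at this
        rw [this, Pt.add_add, add_neg_cancel, Pt.add_zero]
    -- One deck transformation translates by `2 * x.size` on one line and by `2 * y.size` on the
    -- other.
    have hsz : x.size = y.size := by
      have h1 := S.other_shift 1 (.inl o)
      rw [hf] at h1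
      change S.other (.inl (o.shift 1)) = .inr ((f o).shift 1) at h1
      rw [hf, ← Pt.add_mul, haddz] at h1
      have h2 := congrArg Pt.toInt (Sum.inr.inj h1)
      rw [Pt.toInt_add, Pt.toInt_shift] at h2
      omega
    refine ⟨hsz, ?_⟩
    rintro rfl -
    have hev : Even ((f o).toInt - o.toInt) := by
      have := S.through_shading o (f o) (hf o)
      rw [Pt.even_idx_iff, Pt.even_idx_iff] at this
      rw [Int.even_sub]
      exact this.symm
    obtain ⟨c, hc⟩ := hev
    have hfo : ∀ p, f p = p.add (2 * c) := by
      intro p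
      have h1 : p = o.add (p.toInt - o.toInt) :=
        Pt.toInt_injective (by rw [Pt.toInt_add]; ring)
      have h2 : f o = o.add (2 * c) := Pt.toInt_injective (by rw [Pt.toInt_add]; omega)
      rw [h1, haddz, h2, Pt.add_add, Pt.add_add, add_comm]
    refine ⟨c, ?_⟩
    ext1
    · funext u
      rcases u with p | p
      · rw [hf, hfo]; rfl
      · rw [S.other_eq_comm, LiftedTangle.rot_other_inr, hf, hfo, Pt.add_add]
        rw [show 2 * -c + 2 * c = 0 by ring, Pt.add_zero]
    · exact S.loops_eq_zero o _ (hf o)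

end Peel

/-! ## Composites of caps -/

section Skip

variable {i j : ℕ} {x y z : Obj}

theorem IsAlpha.capR_eq (h : IsAlpha i z y) (s : ℤ) : h.capR s = (h.capL s).add 1 :=
  Pt.toInt_injective (by rw [h.toInt_capR, Pt.toInt_add])

/-- The case distinction in linear arithmetic. With this form `omega` settles all identities between
composites of `skip`, including those where a cap crosses `*`. -/
theorem IsAlpha.skip_spec (h : IsAlpha i z y) (p : Pt y.size) :
    (i < 2 * z.size ∧ p.idx + 1 < i ∧ (h.skip p).sheet = p.sheet ∧ (h.skip p).idx = p.idx) ∨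
    (i < 2 * z.size ∧ i ≤ p.idx + 1 ∧ (h.skip p).sheet = p.sheet ∧
      (h.skip p).idx = p.idx + 2) ∨
    (i = 2 * z.size ∧ p.idx = 0 ∧ (h.skip p).sheet = p.sheet - 1 ∧
      (h.skip p).idx = 2 * z.size - 2) ∨
    (i = 2 * z.size ∧ 0 < p.idx ∧ (h.skip p).sheet = p.sheet ∧ (h.skip p).idx = p.idx) := by
  have := h.bounds
  rcases p with ⟨s, j, hj⟩
  simp only [skip]
  split_ifs <;> simp only [and_true] <;> omega

theorem IsAlpha.capL_spec (h : IsAlpha i z y) (s : ℤ) :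
    (h.capL s).sheet = s ∧ (h.capL s).idx = i - 1 := ⟨rfl, rfl⟩

theorem IsAlpha.capR_spec (h : IsAlpha i z y) (s : ℤ) :
    (i < 2 * z.size ∧ (h.capR s).sheet = s ∧ (h.capR s).idx = i) ∨
    (i = 2 * z.size ∧ (h.capR s).sheet = s + 1 ∧ (h.capR s).idx = 0) := by
  have := h.bounds
  simp only [capR]
  split_ifs <;> simp only [and_true] <;> omega

theorem Pt.add_two_spec {n : ℕ} (p : Pt n) :
    (p.idx + 2 < 2 * n ∧ (p.add 2).sheet = p.sheet ∧ (p.add 2).idx = p.idx + 2) ∨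
    (2 * n ≤ p.idx + 2 ∧ (p.add 2).sheet = p.sheet + 1 ∧ (p.add 2).idx = p.idx + 2 - 2 * n) := by
  rcases p with ⟨s, j, hj⟩
  rw [Pt.add_two]
  split_ifs <;> simp only [and_true] <;> omega

theorem IsAlpha.skip_skip (ha : IsAlpha i z y) (ha2 : IsAlpha (i - 2) y x) (hb : IsAlpha j z y)
    (hb2 : IsAlpha j y x) (hij : j + 1 < i) (hne : ¬ (i = 2 * z.size ∧ j = 1)) (w : Pt x.size) :
    hb.skip (ha2.skip w) = ha.skip (hb2.skip w) := by
  have := ha.bounds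
  have := ha2.bounds
  have := hb.bounds
  have := w.idx_lt
  have := hb.skip_spec (ha2.skip w)
  have := ha2.skip_spec w
  have := ha.skip_spec (hb2.skip w)
  have := hb2.skip_spec w
  apply Pt.ext <;> omega

theorem IsAlpha.skip_capL (ha : IsAlpha i z y) (ha2 : IsAlpha (i - 2) y x) (hb : IsAlpha j z y)
    (hij : j + 1 < i) (hne : ¬ (i = 2 * z.size ∧ j = 1)) (s : ℤ) :
    hb.skip (ha2.capL s) = ha.capL s ∧ hb.skip (ha2.capR s) = ha.capR s := by
  have := ha.bounds
  have := ha2.bounds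
  have := hb.bounds
  have := hb.skip_spec (ha2.capL s)
  have := hb.skip_spec (ha2.capR s)
  have := ha2.capL_spec s
  have := ha2.capR_spec s
  have := ha.capL_spec s
  have := ha.capR_spec s
  constructor <;> apply Pt.ext <;> omega

theorem IsAlpha.skip_capL' (ha : IsAlpha i z y) (ha2 : IsAlpha (i - 2) y x) (hb : IsAlpha j z y)
    (hb2 : IsAlpha j y x) (hij : j + 1 < i) (hne : ¬ (i = 2 * z.size ∧ j = 1)) (s : ℤ) :
    ha.skip (hb2.capL s) = hb.capL s ∧ ha.skip (hb2.capR s) = hb.capR s := by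
  have := ha.bounds
  have := ha2.bounds
  have := hb.bounds
  have := ha.skip_spec (hb2.capL s)
  have := ha.skip_spec (hb2.capR s)
  have := hb2.capL_spec s
  have := hb2.capR_spec s
  have := hb.capL_spec s
  have := hb.capR_spec s
  constructor <;> apply Pt.ext <;> omega

theorem IsAlpha.skip_add (h : IsAlpha i z y) (h2 : IsAlpha (i - 2) z y) (h3 : 3 ≤ i)
    (p : Pt y.size) : h.skip (p.add 2) = (h2.skip p).add 2 := by
  have := h.bounds
  have := p.idx_lt
  have := p.add_two_spec
  have := (h2.skip p).add_two_spec
  have := h.skip_spec (p.add 2)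
  have := h2.skip_spec p
  apply Pt.ext <;> omega

theorem IsAlpha.capL_add (h : IsAlpha i z y) (h2 : IsAlpha (i - 2) z y) (h3 : 3 ≤ i) (s : ℤ) :
    h.capL s = (h2.capL s).add 2 := by
  have := h.bounds
  have := h.capL_spec s
  have := h2.capL_spec s
  have := (h2.capL s).add_two_spec
  apply Pt.ext <;> omega

theorem IsAlpha.capR_add (h : IsAlpha i z y) (h2 : IsAlpha (i - 2) z y) (h3 : 3 ≤ i) (s : ℤ) :
    h.capR s = (h2.capR s).add 2 := by
  rw [h.capR_eq, h2.capR_eq, h.capL_add h2 h3, Pt.add_add, Pt.add_add, add_comm]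

/-- Two caps that share a point form a zigzag, from `j + 2` back to `j + 1` and on to `j`. Pulling
it straight gives the identity. -/
theorem IsAlpha.skip_succ (ha : IsAlpha i z y) (hb : IsAlpha j z y) (hij : i = j + 1)
    (p : Pt y.size) : hb.skip p = ha.skip p ∨
      ∃ s, hb.skip p = ha.capR s ∧ ha.capL s = hb.capR s ∧ hb.capL s = ha.skip p := by
  have := ha.bounds
  have := p.idx_lt
  have h1 := ha.skip_spec p
  have h2 := hb.skip_spec p
  by_cases h : hb.skip p = ha.skip p
  · exact Or.inl h
  · rw [Pt.ext_iff] at h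
    have key : ∃ s, s = (ha.skip p).sheet := ⟨_, rfl⟩
    obtain ⟨s, hs⟩ := key
    refine Or.inr ⟨s, ?_⟩
    have := ha.capL_spec s
    have := hb.capL_spec s
    have := ha.capR_spec s
    have := hb.capR_spec s
    refine ⟨?_, ?_, ?_⟩ <;> apply Pt.ext <;> omega

/-- Here the zigzag crosses `*`: it runs from the last point through the first to the second one on
the next sheet. Pulling it straight moves the numbering by two places, so the composite is a
rotation and not the identity. -/
theorem IsAlpha.skip_last (ha : IsAlpha i z y) (hb : IsAlpha 1 z y) (hi : i = 2 * z.size)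
    (hy : 0 < y.size) (p : Pt y.size) : hb.skip p = ha.skip (p.add 2) ∨
      ∃ s, hb.skip p = ha.capL s ∧ ha.capR s = hb.capL (s + 1) ∧
        hb.capR (s + 1) = ha.skip (p.add 2) := by
  have := ha.bounds
  have := p.idx_lt
  have h1 := ha.skip_spec (p.add 2)
  have h2 := hb.skip_spec p
  have := p.add_two_spec
  by_cases h : hb.skip p = ha.skip (p.add 2)
  · exact Or.inl h
  · rw [Pt.ext_iff] at h
    have key : ∃ s, s = (hb.skip p).sheet := ⟨_, rfl⟩
    obtain ⟨s, hs⟩ := key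
    refine Or.inr ⟨s, ?_⟩
    have := ha.capL_spec s
    have := hb.capL_spec (s + 1)
    have := ha.capR_spec s
    have := hb.capR_spec (s + 1)
    refine ⟨?_, ?_, ?_⟩ <;> apply Pt.ext <;> omega

end Skip

/-! ### The products of `b_j` with `a_i` -/

section CapCap

variable {i j : ℕ} {y y' z : Obj} {ha : IsAlpha i z y} {hb : IsAlpha j z y'}

theorem connected_ba_inner (q : Pt y'.size) :
    Connected (.b hb) (.a ha) (.inner q) (.mid (hb.skip q)) := by
  have := Connected.inside (T := .b hb) (S := .a ha) (.inl q)
  rwa [LiftedTangle.b_other_inl] at this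

theorem connected_ba_outer (q : Pt y.size) :
    Connected (.b hb) (.a ha) (.mid (ha.skip q)) (.outer q) := by
  have := Connected.outside (T := .b hb) (S := .a ha) (.inl (ha.skip q))
  rwa [ha.other_skip] at this

theorem connected_ba_capB (s : ℤ) :
    Connected (.b hb) (.a ha) (.mid (hb.capL s)) (.mid (hb.capR s)) := by
  have := Connected.inside (T := .b hb) (S := .a ha) (.inr (hb.capL s))
  rwa [LiftedTangle.b_other_capL] at this

theorem connected_ba_capA (s : ℤ) :
    Connected (.b hb) (.a ha) (.mid (ha.capL s)) (.mid (ha.capR s)) := by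
  have := Connected.outside (T := .b hb) (S := .a ha) (.inl (ha.capL s))
  rwa [ha.other_capL] at this

theorem exists_connected_ba (h : ∀ s, (∃ u, Connected (.b hb) (.a ha) (.mid (hb.capL s))
    (.ofBoundary _ u))) (p : Pt z.size) :
    ∃ u, Connected (.b hb) (.a ha) (.mid p) (.ofBoundary _ u) := by
  rcases hb.cases p with ⟨q, rfl⟩ | ⟨s, rfl⟩ | ⟨s, rfl⟩
  · exact ⟨.inl q, (connected_ba_inner q).symm⟩
  · exact h s
  · obtain ⟨u, hu⟩ := h s
    exact ⟨u, (connected_ba_capB s).symm.trans hu⟩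

/-- Composites of caps without loops. -/
structure IsLooplessComposite {x y z : Obj} (T : LiftedTangle x y) (S : LiftedTangle y z)
    (R : LiftedTangle x z) : Prop where
  isReducedComposite : IsReducedComposite T S R
  loopSet_eq : ∀ κ, loopSet T S κ = ∅

theorem IsLooplessComposite.of_connected {x y z : Obj} {T : LiftedTangle x y}
    {S : LiftedTangle y z} {R : LiftedTangle x z}
    (h1 : ∀ p, Connected T S (.inner p) (.ofBoundary _ (R.other (.inl p))))
    (h2 : ∀ p q, R.other (.inr p) = .inr q → Connected T S (.outer p) (.outer q))
    (h3 : ∀ p, ∃ u, Connected T S (.mid p) (.ofBoundary _ u))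
    (hl : R.loops = T.loops + S.loops) : IsLooplessComposite T S R := by
  refine ⟨.of_connected_of_ends (fun u => ?_) h3 hl, loopSet_eq_empty h3⟩
  rcases u with p | p
  · exact h1 p
  · rcases h : R.other (.inr p) with q | q
    · have := h1 q
      rw [R.other_eq_comm.1 h] at this
      exact this.symm
    · exact h2 p q h

theorem IsLooplessComposite.star {x y z : Obj} {T : LiftedTangle x y} {S : LiftedTangle y z}
    {R : LiftedTangle x z} (h : IsLooplessComposite T S R) :
    IsLooplessComposite S.star T.star R.star :=
  ⟨h.1.star, fun κ => by rw [loopSet_star, h.2]⟩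

theorem isLooplessComposite_ba_succ {ha : IsAlpha i z y} {hb : IsAlpha j z y} (hij : i = j + 1)
    (hy : 0 < y.size) : IsLooplessComposite (.b hb) (.a ha) (.idt y) := by
  have hbd := ha.bounds
  have hbd2 := hb.bounds
  refine .of_connected (fun p => ?_) (fun p q h => by cases h)
    (exists_connected_ba fun s => ?_) rfl
  · rcases ha.skip_succ hb hij p with h | ⟨s, h1, h2, h3⟩
    · have := connected_ba_inner (ha := ha) (hb := hb) p
      rw [h] at this
      exact this.trans (connected_ba_outer p)
    · refine (connected_ba_inner p).trans ?_
      rw [h1]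
      refine (connected_ba_capA s).symm.trans ?_
      rw [h2]
      refine (connected_ba_capB s).symm.trans ?_
      rw [h3]
      exact connected_ba_outer p
  · rcases ha.cases (hb.capL s) with ⟨q, h⟩ | ⟨t, h⟩ | ⟨t, h⟩
    · rw [h]
      exact ⟨.inr q, connected_ba_outer q⟩
    · simp only [IsAlpha.capL, Pt.mk.injEq] at h
      omega
    · simp only [IsAlpha.capL, IsAlpha.capR] at h
      split_ifs at h <;> simp only [Pt.mk.injEq] at h <;> omega

theorem isLooplessComposite_ba_last {ha : IsAlpha i z y} {hb : IsAlpha 1 z y}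
    (hi : i = 2 * z.size) (hy : 0 < y.size) :
    IsLooplessComposite (.b hb) (.a ha) (.rot y 1) := by
  have hbd := ha.bounds
  refine .of_connected (fun p => ?_) (fun p q h => by cases h)
    (exists_connected_ba fun s => ?_) rfl
  · rw [LiftedTangle.rot_other_inl, show (2 : ℤ) * 1 = 2 by rfl]
    rcases ha.skip_last hb hi hy p with h | ⟨s, h1, h2, h3⟩
    · have := connected_ba_inner (ha := ha) (hb := hb) p
      rw [h] at this
      exact this.trans (connected_ba_outer _)
    · refine (connected_ba_inner p).trans ?_
      rw [h1]
      refine (connected_ba_capA s).trans ?_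
      rw [h2]
      refine (connected_ba_capB _).trans ?_
      rw [h3]
      exact connected_ba_outer _
  · rcases ha.cases (hb.capR s) with ⟨q, h⟩ | ⟨t, h⟩ | ⟨t, h⟩
    · refine ⟨.inr q, (connected_ba_capB s).trans ?_⟩
      rw [h]
      exact connected_ba_outer q
    · simp only [IsAlpha.capL, IsAlpha.capR] at h
      split_ifs at h <;> simp only [Pt.mk.injEq] at h <;> omega
    · simp only [IsAlpha.capR] at h
      split_ifs at h <;> simp only [Pt.mk.injEq] at h <;> omega

/-- The two caps are disjoint: the cap of `a_i` survives on the inside with number `i - 2`, the cap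
of `b_j` on the outside with number `j`, and all other strings go through. -/
theorem isLooplessComposite_ba_gt {x : Obj} {ha : IsAlpha i z y} {hb : IsAlpha j z y}
    {ha2 : IsAlpha (i - 2) y x} {hb2 : IsAlpha j y x} (hij : j + 1 < i)
    (hne : ¬ (i = 2 * z.size ∧ j = 1)) {R : LiftedTangle y y} (hR : IsInsertion hb2 (.a ha2) R) :
    IsLooplessComposite (.b hb) (.a ha) R := by
  refine .of_connected (fun p => ?_) (fun p q h => ?_)
    (exists_connected_ba fun s => ?_) hR.loops_eq
  · have e := hR.other_skip (.inl p)
    change R.other (.inl p) = _ at e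
    rw [e]
    refine (connected_ba_inner p).trans ?_
    rcases ha2.cases p with ⟨w, rfl⟩ | ⟨s, rfl⟩ | ⟨s, rfl⟩
    · rw [ha2.other_skip, ha.skip_skip ha2 hb hb2 hij hne]
      exact connected_ba_outer _
    · rw [ha2.other_capL, (ha.skip_capL ha2 hb hij hne s).1]
      refine (connected_ba_capA s).trans ?_
      rw [← (ha.skip_capL ha2 hb hij hne s).2]
      exact (connected_ba_inner _).symm
    · rw [ha2.other_capR, (ha.skip_capL ha2 hb hij hne s).2]
      refine (connected_ba_capA s).symm.trans ?_
      rw [← (ha.skip_capL ha2 hb hij hne s).1]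
      exact (connected_ba_inner _).symm
  · rcases hb2.cases p with ⟨w, rfl⟩ | ⟨s, rfl⟩ | ⟨s, rfl⟩
    · have e := hR.other_skip (.inr w)
      change R.other (.inr (hb2.skip w)) = _ at e
      rw [e, ha2.other_inr] at h
      cases h
    · rw [hR.other_capL] at h
      rw [← Sum.inr.inj h]
      refine (connected_ba_outer _).symm.trans (Connected.trans ?_ (connected_ba_outer _))
      rw [(ha.skip_capL' ha2 hb hb2 hij hne s).1, (ha.skip_capL' ha2 hb hb2 hij hne s).2]
      exact connected_ba_capB s
    · rw [hR.other_capR] at h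
      rw [← Sum.inr.inj h]
      refine (connected_ba_outer _).symm.trans (Connected.trans ?_ (connected_ba_outer _))
      rw [(ha.skip_capL' ha2 hb hb2 hij hne s).1, (ha.skip_capL' ha2 hb hb2 hij hne s).2]
      exact (connected_ba_capB s).symm
  · rw [← (ha.skip_capL' ha2 hb hb2 hij hne s).1]
    exact ⟨.inr _, connected_ba_outer _⟩

/-! ### Composites with a loop -/

theorem connected_ba_same {h : IsAlpha i z y} {s : ℤ} {b : Node y.size z.size y.size}
    (hb : Connected (.b h) (.a h) (.mid (h.capL s)) b) :
    b = .mid (h.capL s) ∨ b = .mid (h.capR s) := by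
  induction hb with
  | refl => exact Or.inl rfl
  | tail _ hj ih =>
    cases hj with
    | inside u =>
      rcases u with u | u
      · rcases ih with ih | ih <;> cases ih
      · rcases ih with ih | ih
        · rw [show u = h.capL s by cases ih; rfl, LiftedTangle.b_other_capL]
          exact Or.inr rfl
        · rw [show u = h.capR s by cases ih; rfl, LiftedTangle.b_other_capR]
          exact Or.inl rfl
    | outside u =>
      rcases u with u | u
      · rcases ih with ih | ih
        · rw [show u = h.capL s by cases ih; rfl, h.other_capL]
          exact Or.inr rfl
        · rw [show u = h.capR s by cases ih; rfl, h.other_capR]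
          exact Or.inl rfl
      · rcases ih with ih | ih <;> cases ih

theorem onLoop_ba_same {h : IsAlpha i z y} {p : Pt z.size} :
    OnLoop (.b h) (.a h) p ↔ ∃ s, p = h.capL s ∨ p = h.capR s := by
  constructor
  · intro hp
    rcases h.cases p with ⟨q, rfl⟩ | ⟨s, rfl⟩ | ⟨s, rfl⟩
    · exact absurd (connected_ba_outer q) (hp (.inr q))
    · exact ⟨s, Or.inl rfl⟩
    · exact ⟨s, Or.inr rfl⟩
  · rintro ⟨s, rfl | rfl⟩ u hu
    · rcases connected_ba_same hu with e | e <;> rcases u with u | u <;> cases e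
    · rcases connected_ba_same ((connected_ba_capB s).trans hu) with e | e <;>
        rcases u with u | u <;> cases e

theorem not_winds_ba_same {h : IsAlpha i z y} (s : ℤ) : ¬ Winds (.b h) (.a h) (h.capL s) := by
  rintro ⟨k, hk, h2⟩
  rw [h.capL_shift] at h2
  rcases connected_ba_same h2 with e | e
  · injection e with e
    simp only [IsAlpha.capL, Pt.mk.injEq] at e
    omega
  · injection e with e
    exact h.capL_ne_capR _ _ e

/-- The equal caps close up to a loop that meets the common circle only in their two ends. Its
leftmost point has `idx = i - 1`, so it is shaded exactly for odd `i`. -/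
theorem loopSet_ba_same (h : IsAlpha i z y) :
    loopSet (.b h) (.a h) none = ∅ ∧ ∀ b : Bool, (loopSet (.b h) (.a h) (some b)).ncard =
      if (Odd i ↔ b = true) then 1 else 0 := by
  constructor
  · ext L
    rw [mem_loopSet]
    simp only [Set.mem_empty_iff_false, iff_false]
    rintro ⟨p, hp, ⟨k, hk, h2⟩, -⟩
    obtain ⟨s, rfl | rfl⟩ := onLoop_ba_same.1 hp
    · exact not_winds_ba_same s ⟨k, hk, h2⟩
    · refine not_winds_ba_same s ⟨k, hk, (connected_ba_capB s).trans (h2.trans ?_)⟩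
      rw [h.capL_shift, h.capR_shift]
      exact (connected_ba_capB _).symm
  · intro b
    have hodd : Even (i - 1) ↔ Odd i := by
      have := h.bounds
      rw [Nat.even_iff, Nat.odd_iff]; omega
    have hp : ∀ p, OnLoop (.b h) (.a h) p ∧ HasKind (.b h) (.a h) (some b) p ↔
        (∃ s, p = h.capL s) ∧ (Odd i ↔ b = true) := by
      intro p
      rw [onLoop_ba_same]
      constructor
      · rintro ⟨⟨s, rfl | rfl⟩, -, h2, h3⟩
        · exact ⟨⟨s, rfl⟩, hodd.symm.trans h3⟩
        · exact absurd (h.capL_lt_capR s) (h2 _ (connected_ba_capB s).symm)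
      · rintro ⟨⟨s, rfl⟩, h3⟩
        refine ⟨⟨s, Or.inl rfl⟩, not_winds_ba_same s, fun q hq => ?_, hodd.trans h3⟩
        rcases connected_ba_same hq with e | e
        · injection e with e
          rw [e]; exact Pt.lt_irrefl _
        · injection e with e
          rw [e]
          exact fun h2 => Pt.lt_irrefl _ (Pt.lt_trans h2 (h.capL_lt_capR s))
    -- All lifts of the loop have the same trace, so it is counted once.
    have hl : ∀ s, loopThrough (.b h) (.a h) (h.capL s) =
        loopThrough (.b h) (.a h) (h.capL 0) := by
      intro s
      have hs : ∀ s t : ℤ, loopThrough (.b h) (.a h) (h.capL s) ⊆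
          loopThrough (.b h) (.a h) (h.capL t) := by
        rintro s t _ ⟨q, rfl, hq⟩
        have := hq.shift (t - s)
        simp only [Node.shift] at this
        rw [h.capL_shift, add_sub_cancel] at this
        exact ⟨q.shift (t - s), rfl, this⟩
      exact (hs _ _).antisymm (hs _ _)
    split_ifs with hb
    · rw [Set.ncard_eq_one]
      refine ⟨loopThrough (.b h) (.a h) (h.capL 0), ?_⟩
      ext L
      rw [mem_loopSet, Set.mem_singleton_iff]
      constructor
      · rintro ⟨p, h1, h2, rfl⟩
        obtain ⟨⟨s, rfl⟩, -⟩ := (hp p).1 ⟨h1, h2⟩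
        exact hl s
      · rintro rfl
        obtain ⟨h1, h2⟩ := (hp _).2 ⟨⟨0, rfl⟩, hb⟩
        exact ⟨_, h1, h2, rfl⟩
    · suffices loopSet (.b h) (.a h) (some b) = ∅ by rw [this, Set.ncard_empty]
      ext L
      rw [mem_loopSet]
      simp only [Set.mem_empty_iff_false, iff_false]
      rintro ⟨p, h1, h2, -⟩
      exact hb ((hp p).1 ⟨h1, h2⟩).2

theorem isReducedComposite_ba_same (h : IsAlpha i z y) :
    IsReducedComposite (.b h) (.a h) (.idt y) := by
  refine .of_connected (fun u => ?_) ?_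
  · rcases u with p | p
    · exact (connected_ba_inner p).trans (connected_ba_outer p)
    · exact ((connected_ba_inner p).trans (connected_ba_outer p)).symm
  · have := (loopSet_ba_same h).1
    simp only [loopSet] at this
    rw [this, Set.ncard_empty]
    rfl

section Essential

variable {s s' : Sign} {ha : IsAlpha i (.num 0) (.zero s)} {hb : IsAlpha j (.num 0) (.zero s')}

theorem IsAlpha.eq_of_zero {i : ℕ} {s : Sign} (h : IsAlpha i (.num 0) (.zero s)) :
    i = match s with | .plus => 1 | .minus => 2 := by
  cases s <;> exact h

/-- With different signs the two caps are the two possible ones on `[1]`, and every point is the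
left end of one of them. So the curve runs through all points in order and winds around the annulus.
-/
theorem connected_ba_add_one (hs : s ≠ s') (p : Pt (Obj.num 0).size) :
    Connected (.b hb) (.a ha) (.mid p) (.mid (p.add 1)) := by
  have key : ∀ {i : ℕ} {s : Sign} (h : IsAlpha i (.num 0) (.zero s)), i = p.idx + 1 →
      p = h.capL p.sheet ∧ p.add 1 = h.capR p.sheet := by
    intro i s h hi
    have e : p = h.capL p.sheet := Pt.ext rfl (show p.idx = i - 1 by omega)
    exact ⟨e, by rw [h.capR_eq, ← e]⟩
  have h1 := ha.eq_of_zero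
  have h2 := hb.eq_of_zero
  have h3 : p.idx < 2 * 1 := p.idx_lt
  have h4 : i = p.idx + 1 ∨ j = p.idx + 1 := by
    cases s <;> cases s' <;> first | exact absurd rfl hs | (simp only at h1 h2; omega)
  rcases h4 with h4 | h4
  · obtain ⟨e1, e2⟩ := key ha h4
    rw [e2]
    nth_rw 1 [e1]
    exact connected_ba_capA _
  · obtain ⟨e1, e2⟩ := key hb h4
    rw [e2]
    nth_rw 1 [e1]
    exact connected_ba_capB _

theorem connected_ba_mid (hs : s ≠ s') (p q : Pt (Obj.num 0).size) :
    Connected (.b hb) (.a ha) (.mid p) (.mid q) := by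
  have h : ∀ (n : ℕ) (p : Pt (Obj.num 0).size),
      Connected (.b hb) (.a ha) (.mid p) (.mid (p.add n)) := by
    intro n
    induction n with
    | zero => intro p; rw [Nat.cast_zero, Pt.add_zero]; exact .refl _
    | succ n ih =>
      intro p
      have := (ih p).trans (connected_ba_add_one hs _)
      rwa [Pt.add_add, ← Nat.cast_succ] at this
  have e : ∀ p q : Pt (Obj.num 0).size, p.toInt ≤ q.toInt →
      q = p.add ((q.toInt - p.toInt).toNat : ℕ) := fun p q hpq =>
    Pt.toInt_injective (by rw [Pt.toInt_add]; omega)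
  rcases le_total p.toInt q.toInt with hpq | hpq
  · rw [e p q hpq]
    exact h _ _
  · rw [e q p hpq]
    exact (h _ _).symm

theorem loopSet_ba_essential (hs : s ≠ s') :
    (loopSet (.b hb) (.a ha) none).ncard = 1 ∧
      ∀ b : Bool, loopSet (.b hb) (.a ha) (some b) = ∅ := by
  have hw : ∀ p, Winds (.b hb) (.a ha) p := fun p => ⟨1, one_ne_zero, connected_ba_mid hs _ _⟩
  constructor
  · rw [Set.ncard_eq_one]
    refine ⟨Set.range (Pt.idx (n := (Obj.num 0).size)), ?_⟩
    have hl : ∀ p, loopThrough (.b hb) (.a ha) p =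
        Set.range (Pt.idx (n := (Obj.num 0).size)) := by
      intro p
      ext k
      exact ⟨fun ⟨q, hq, _⟩ => ⟨q, hq⟩, fun ⟨q, hq⟩ => ⟨q, hq, connected_ba_mid hs _ _⟩⟩
    ext L
    rw [mem_loopSet, Set.mem_singleton_iff]
    constructor
    · rintro ⟨p, -, -, rfl⟩
      exact hl p
    · rintro rfl
      refine ⟨⟨0, 0, Nat.zero_lt_succ _⟩, fun u => ?_, hw _, (hl _).symm⟩
      rcases u with u | u
      · exact (isEmpty_zero s').elim u
      · exact (isEmpty_zero s).elim u
  · intro b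
    ext L
    rw [mem_loopSet]
    simp only [Set.mem_empty_iff_false, iff_false]
    rintro ⟨p, -, h, -⟩
    exact h.1 (hw p)

/-- The tangle between circles without marked points with a given number of loops. -/
def LiftedTangle.zero {s s' : Sign} (k : ℕ) (h : Odd k ↔ s ≠ s') :
    LiftedTangle (.zero s) (.zero s') where
  other := id
  loops := k
  other_other _ := rfl
  other_ne u := u.elim (isEmpty_zero s).elim (isEmpty_zero s').elim
  other_shift _ _ := rfl
  planar u := u.elim (isEmpty_zero s).elim (isEmpty_zero s').elim
  loops_eq_zero p := (isEmpty_zero s).elim p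
  through_shading p := (isEmpty_zero s).elim p
  loop_shading := by
    intro _ b c hb hc
    rw [h]
    cases s <;> cases s' <;> simp_all [IsExposed]

theorem isReducedComposite_ba_essential (hs : s' ≠ s) : IsReducedComposite (.b hb) (.a ha)
    (.zero 1 (by simpa using hs)) := by
  refine .of_connected (fun u => ?_) ?_
  · rcases u with u | u
    · exact (isEmpty_zero s').elim u
    · exact (isEmpty_zero s).elim u
  · have := (loopSet_ba_essential (ha := ha) (hb := hb) hs.symm).1
    simp only [loopSet] at this
    rw [this]
    rfl

end Essential

end CapCap

/-! ### Cap insertion commutes with disjoint caps and with rotations -/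

section CapRotate

variable {i j : ℕ} {x y z : Obj}

/-- Two disjoint caps can be inserted in either order, with numbers adjusted, and the result is
literally the same lifted tangle. -/
theorem exists_isInsertion_b_b {ha : IsAlpha i z y} {ha2 : IsAlpha (i - 2) y x}
    {hb : IsAlpha j z y} {hb2 : IsAlpha j y x} (hij : j + 1 < i)
    (hne : ¬ (i = 2 * z.size ∧ j = 1)) :
    ∃ R, IsInsertion hb (.b ha2) R ∧ IsInsertion ha (.b hb2) R := by
  obtain ⟨R, hR⟩ := exists_isInsertion hb (.b ha2)
  have hl : ∀ w, R.other (.inl w) = .inr (ha.skip (hb2.skip w)) := by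
    intro w
    have := hR.other_skip (.inl w)
    rw [LiftedTangle.b_other_inl] at this
    exact this.trans (congrArg Sum.inr (ha.skip_skip ha2 hb hb2 hij hne w))
  refine ⟨R, hR, ⟨?_, fun s => ?_, hR.loops_eq⟩⟩
  · rintro (w | q)
    · rw [LiftedTangle.b_other_inl]
      exact hl w
    · change R.other (.inr (ha.skip q)) = _
      rcases hb2.cases q with ⟨w, rfl⟩ | ⟨s, rfl⟩ | ⟨s, rfl⟩
      · rw [LiftedTangle.b_other_skip, R.other_eq_comm]
        exact hl w
      · rw [LiftedTangle.b_other_capL, (ha.skip_capL' ha2 hb hb2 hij hne s).1, hR.other_capL,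
          ← (ha.skip_capL' ha2 hb hb2 hij hne s).2]
        rfl
      · rw [LiftedTangle.b_other_capR, (ha.skip_capL' ha2 hb hb2 hij hne s).2, hR.other_capR,
          ← (ha.skip_capL' ha2 hb hb2 hij hne s).1]
        rfl
  · have := hR.other_skip (.inr (ha2.capL s))
    rw [LiftedTangle.b_other_capL] at this
    rw [← (ha.skip_capL ha2 hb hij hne s).1, ← (ha.skip_capL ha2 hb hij hne s).2]
    exact this

/-- For `i ≥ 3` a rotation by two places moves the cap `i - 2` to the cap `i` without crossing `*`,
so no Dehn twist is needed. -/
theorem isInsertion_rot_b {h : IsAlpha i z y} {h2 : IsAlpha (i - 2) z y} (h3 : 3 ≤ i) :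
    IsInsertion h (.rot y 1) ((LiftedTangle.b h2).rotate 1) := by
  have hl : ∀ p, ((LiftedTangle.b h2).rotate 1).other (.inl p) = .inr (h.skip (p.add 2)) := by
    intro p
    rw [h.skip_add h2 h3]
    change ((LiftedTangle.b h2).other (.inl p)).rotate 1 = _
    rw [LiftedTangle.b_other_inl]
    rfl
  refine ⟨?_, fun s => ?_, rfl⟩
  · rintro (p | p)
    · exact hl p
    · rw [LiftedTangle.rot_other_inr, LiftedTangle.other_eq_comm]
      change _ = Sum.inr (h.skip p)
      refine (hl _).trans ?_
      change Sum.inr (h.skip ((p.add (2 * -1)).add 2)) = _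
      rw [Pt.add_add, show (2 : ℤ) * -1 + 2 = 0 by rfl, Pt.add_zero]
  · rw [h.capL_add h2 h3, h.capR_add h2 h3]
    change ((LiftedTangle.b h2).other (.inr (((h2.capL s).add 2).add (2 * -1)))).rotate 1 = _
    rw [Pt.add_add, show (2 : ℤ) + 2 * -1 = 0 by rfl, Pt.add_zero, LiftedTangle.b_other_capL]
    rfl

end CapRotate

/-! ## Existence of composites -/

/-- All tangles have a composite with `S`. -/
def LiftedTangle.IsComposable {y z : Obj} (S : LiftedTangle y z) : Prop :=
  ∀ {x : Obj} (T : LiftedTangle x y), ∃ R, IsReducedComposite T S R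

section Existence

variable {i j : ℕ} {x y y' z : Obj}

theorem isComposable_b (h : IsAlpha i z y) : (LiftedTangle.b h).IsComposable := fun T =>
  let ⟨R, hR⟩ := exists_isInsertion h T
  ⟨R, hR.isReducedComposite⟩

theorem isComposable_rot (c : ℤ) : (LiftedTangle.rot x c).IsComposable := fun T =>
  ⟨_, isReducedComposite_rot T c⟩

theorem LiftedTangle.idt_star (x : Obj) : (LiftedTangle.idt x).star = .idt x := by
  rw [← LiftedTangle.rot_zero, LiftedTangle.rot_star, neg_zero]

theorem isComposable_idt : (LiftedTangle.idt x).IsComposable := fun T =>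
  ⟨_, isReducedComposite_idt T⟩

theorem isComposable_zero {s s' : Sign} (S : LiftedTangle (.zero s) (.zero s')) :
    S.IsComposable := fun T => exists_isReducedComposite_zero T S

/-- Associativity makes composability stable under products, which reduces existence of composites
to elementary tangles. -/
theorem IsReducedComposite.isComposable {T : LiftedTangle x y} {S : LiftedTangle y z}
    {R : LiftedTangle x z} (h : IsReducedComposite T S R) (hT : T.IsComposable)
    (hS : S.IsComposable) : R.IsComposable := fun U => by
  obtain ⟨P, hP⟩ := hT U
  obtain ⟨Q, hQ⟩ := hS P
  exact ⟨Q, (isReducedComposite_assoc hP h).1 hQ⟩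

theorem LiftedTangle.IsThrough.induction
    {motive : ∀ {x y : Obj}, LiftedTangle x y → Prop}
    (rot : ∀ k c, motive (LiftedTangle.rot (.num k) c))
    (zero : ∀ {s s'} (S : LiftedTangle (.zero s) (.zero s')), motive S)
    {S : LiftedTangle x y} (hS : S.IsThrough) : motive S := by
  obtain ⟨h1, h2⟩ := hS.exists_add
  rcases x with k | s <;> rcases y with l | s'
  · obtain rfl : k = l := Nat.succ_injective h1
    obtain ⟨c, rfl⟩ := h2 rfl (Nat.succ_pos k)
    exact rot k c
  · exact absurd h1 (Nat.succ_ne_zero k)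
  · exact absurd h1.symm (Nat.succ_ne_zero l)
  · exact zero S

/-- Without internal caps, `S` is a rotation or a tangle of loops followed by some `b_i`, and the
composite with each of these factors is explicit. -/
theorem isComposable_of_inl_ne {S : LiftedTangle x y}
    (hS : ∀ p q, S.other (.inl p) ≠ .inl q) : S.IsComposable := by
  induction hn : y.size using Nat.strong_induction_on generalizing y with
  | _ n ih =>
    subst hn
    by_cases h : ∃ p q, S.other (.inr p) = .inr q
    · obtain ⟨p, q, hpq⟩ := h
      obtain ⟨i, y', h, T, hT⟩ := exists_cap S hpq
      refine hT.isReducedComposite.isComposable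
        (ih _ (by have := h.bounds.1; omega) (fun p q e => ?_) rfl) (isComposable_b h)
      have := hT.other_skip (.inl p)
      rw [e] at this
      exact hS p q this
    · push Not at h
      exact LiftedTangle.IsThrough.induction (motive := fun S => S.IsComposable)
        (fun k c => isComposable_rot c) isComposable_zero ⟨hS, h⟩

theorem IsAlpha.exists_isAlpha (ha : IsAlpha i z y) (hb : IsAlpha j z y') :
    (∃ k, z = .num (k + 1) ∧ y = .num k ∧ y' = .num k) ∨
    ∃ s s', z = .num 0 ∧ y = .zero s ∧ y' = .zero s' := by
  rcases z with (_ | k) | s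
  · rcases y with l | s
    · exact ha.elim
    · rcases y' with l' | s'
      · exact hb.elim
      · exact Or.inr ⟨s, s', rfl, rfl, rfl⟩
  · rcases y with l | s
    · rcases y' with l' | s'
      · exact Or.inl ⟨k, rfl, by rw [ha.1], by rw [hb.1]⟩
      · exact hb.elim
    · exact ha.elim
  · exact ha.elim

theorem IsAlpha.exists_pair {k : ℕ} (hj : 1 ≤ j) (hij : j + 1 < i)
    (hne : ¬ (i = 2 * (k + 2) ∧ j = 1)) (hi : i ≤ 2 * (k + 2)) :
    ∃ x, IsAlpha (i - 2) (.num k) x ∧ IsAlpha j (.num k) x := by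
  rcases k with _ | k
  -- On `[2]` there are only two disjoint pairs of caps, and removing both leaves a circle whose
  -- sign is given by their parity.
  · have : j = 1 ∧ i = 3 ∨ j = 2 ∧ i = 4 := by omega
    rcases this with ⟨rfl, rfl⟩ | ⟨rfl, rfl⟩
    · exact ⟨.zero .plus, rfl, rfl⟩
    · exact ⟨.zero .minus, rfl, rfl⟩
  · exact ⟨.num k, ⟨rfl, by omega, by omega⟩, rfl, by omega, by omega⟩

theorem exists_composite_ba_gt {k : ℕ} {ha : IsAlpha i (.num (k + 1)) (.num k)}
    {hb : IsAlpha j (.num (k + 1)) (.num k)} {x : Obj} (ha2 : IsAlpha (i - 2) (.num k) x)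
    (hb2 : IsAlpha j (.num k) x) (hij : j + 1 < i) (hne : ¬ (i = 2 * (k + 2) ∧ j = 1)) :
    ∃ E, IsLooplessComposite (.b hb) (.a ha) E ∧ IsReducedComposite (.a ha2) (.b hb2) E := by
  obtain ⟨E, hE⟩ := exists_isInsertion hb2 (.a ha2)
  exact ⟨E, isLooplessComposite_ba_gt (z := .num (k + 1)) hij hne hE, hE.isReducedComposite⟩

theorem IsLooplessComposite.star_ba {ha : IsAlpha i z y} {hb : IsAlpha j z y'}
    {R : LiftedTangle y' y} (h : IsLooplessComposite (.b hb) (.a ha) R) :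
    IsLooplessComposite (.b ha) (.a hb) R.star := by
  have := h.star
  rwa [(LiftedTangle.a hb).star_star] at this

/-- In each case of the table the product is a rotation, an identity, a tangle of loops, or the
product of an `a` on a smaller circle with a `b`; for the last, `ih` applies. The cases `i < j` are
reflections of those with `i > j`. -/
theorem exists_composite_ba (ha : IsAlpha i z y) (hb : IsAlpha j z y')
    (ih : ∀ {i x} (h : IsAlpha i y x), (LiftedTangle.a h).IsComposable) :
    ∃ E, IsReducedComposite (.b hb) (.a ha) E ∧ E.IsComposable := by
  rcases ha.exists_isAlpha hb with ⟨k, rfl, rfl, rfl⟩ | ⟨s, s', rfl, rfl, rfl⟩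
  · have ⟨_, i1, i2⟩ := ha
    have ⟨_, j1, j2⟩ := hb
    have hk : 0 < (Obj.num k).size := Nat.succ_pos k
    rcases lt_trichotomy i j with hij | rfl | hij
    · by_cases h1 : j = i + 1
      · have := isLooplessComposite_ba_succ (ha := hb) (hb := ha) h1 hk
        exact ⟨_, this.star_ba.1, by rw [LiftedTangle.idt_star]; exact isComposable_idt⟩
      · by_cases h2 : j = 2 * (k + 2) ∧ i = 1
        · obtain ⟨h2, rfl⟩ := h2
          have := isLooplessComposite_ba_last (ha := hb) (hb := ha) h2 hk
          refine ⟨_, this.star_ba.1, ?_⟩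
          rw [LiftedTangle.rot_star]
          exact isComposable_rot _
        · obtain ⟨x, ha2, hb2⟩ := IsAlpha.exists_pair (i := j) (j := i) (k := k) i1 (by omega) h2 j2
          obtain ⟨E, h3, h4⟩ := exists_composite_ba_gt (ha := hb) (hb := ha) ha2 hb2 (by omega) h2
          have h4 := h4.star
          rw [LiftedTangle.star_star] at h4
          exact ⟨_, h3.star_ba.1, h4.isComposable (ih hb2) (isComposable_b ha2)⟩
    · exact ⟨_, isReducedComposite_ba_same ha, isComposable_idt⟩
    · by_cases h1 : i = j + 1
      · exact ⟨_, (isLooplessComposite_ba_succ h1 hk).1, isComposable_idt⟩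
      · by_cases h2 : i = 2 * (k + 2) ∧ j = 1
        · obtain ⟨h2, rfl⟩ := h2
          exact ⟨_, (isLooplessComposite_ba_last h2 hk).1, isComposable_rot _⟩
        · obtain ⟨x, ha2, hb2⟩ := IsAlpha.exists_pair (k := k) j1 (by omega) h2 i2
          obtain ⟨E, h3, h4⟩ := exists_composite_ba_gt (ha := ha) (hb := hb) ha2 hb2 (by omega) h2
          exact ⟨_, h3.1, h4.isComposable (ih ha2) (isComposable_b hb2)⟩
  · by_cases hs : s' = s
    · subst hs
      obtain rfl : i = j := by cases s' <;> exact Eq.trans ha (Eq.symm hb)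
      exact ⟨_, isReducedComposite_ba_same ha, isComposable_idt⟩
    · exact ⟨_, isReducedComposite_ba_essential hs, isComposable_zero _⟩

/-- If `T` has an external cap, write it as `b_j ∘ T'` and use the table for `a_i ∘ b_j`. If not,
the reflected tangle has no internal caps, so the reflected composite exists by
`isComposable_of_inl_ne`. -/
theorem isComposable_a (h : IsAlpha i z y) : (LiftedTangle.a h).IsComposable := by
  induction hn : z.size using Nat.strong_induction_on generalizing z y i with
  | _ n ih =>
    subst hn
    intro x T
    by_cases hT : ∃ p q, T.other (.inr p) = .inr q
    · obtain ⟨p, q, hpq⟩ := hT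
      obtain ⟨j, y', hb, T', hT'⟩ := exists_cap T hpq
      obtain ⟨E, hE, hE2⟩ := exists_composite_ba h hb
        (fun h2 => ih _ (by have := h.bounds.1; omega) h2 rfl)
      obtain ⟨R, hR⟩ := hE2 T'
      exact ⟨R, (isReducedComposite_assoc hT'.isReducedComposite hE).2 hR⟩
    · push Not at hT
      have : T.star.IsComposable := isComposable_of_inl_ne fun p q e => hT p q (by
        have := congrArg Sum.swap e
        rwa [show (T.star.other (.inl p)).swap = T.other (.inr p) from Sum.swap_swap _] at this)
      obtain ⟨R, hR⟩ := this (LiftedTangle.a h).star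
      refine ⟨R.star, IsReducedComposite.of_star ?_⟩
      rwa [R.star_star]

theorem LiftedTangle.isComposable (S : LiftedTangle x y) : S.IsComposable := by
  induction hn : x.size using Nat.strong_induction_on generalizing x with
  | _ n ih =>
    subst hn
    by_cases h : ∃ p q, S.other (.inl p) = .inl q
    · obtain ⟨p, q, hpq⟩ := h
      obtain ⟨i, x', h, S', hS'⟩ := exists_cap S.star (p := p) (q := q) (by
        change (S.other (.inl p)).swap = _
        rw [hpq]; rfl)
      have := hS'.isReducedComposite.star
      rw [LiftedTangle.star_star, LiftedTangle.star_star] at this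
      exact this.isComposable (isComposable_a h) (ih _ (by have := h.bounds.1; omega) _ rfl)
    · push Not at h
      exact isComposable_of_inl_ne h

end Existence

/-! ## The composition of `Atl` -/

section Atl

variable {w x y z : Obj}

theorem isReducedComposite_idt_left (T : LiftedTangle x y) :
    IsReducedComposite (.idt x) T T := by
  have := (isReducedComposite_idt T.star).star
  rwa [T.star_star, LiftedTangle.idt_star] at this

theorem loopSet_idt (T : LiftedTangle x y) (κ : Option Bool) : loopSet T (.idt y) κ = ∅ := by
  rw [← LiftedTangle.rot_zero]
  exact loopSet_rot T 0 κ

theorem loopSet_idt_left (T : LiftedTangle x y) (κ : Option Bool) :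
    loopSet (.idt x) T κ = ∅ := by
  rw [← loopSet_star, LiftedTangle.idt_star]
  exact loopSet_idt T.star κ

/-- The morphism `(T, a, b)` of `Atl`. -/
def AtlHom.of (T : LiftedTangle x y) (a b : ℕ) : AtlHom x y := ⟨⟦T⟧, a, b⟩

theorem AtlHom.exists_of (f : AtlHom x y) : ∃ T a b, f = .of T a b := by
  obtain ⟨T, a, b⟩ := f
  obtain ⟨T, rfl⟩ := Quotient.exists_rep T
  exact ⟨T, a, b, rfl⟩

theorem AtlHom.of_eq_of_iff {T S : LiftedTangle x y} {a b c d : ℕ} :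
    AtlHom.of T a b = .of S c d ↔ T.Equivalent S ∧ a = c ∧ b = d := by
  rw [AtlHom.ext_iff]
  exact and_congr_left fun _ => Quotient.eq (r := LiftedTangle.setoid x y)

/-- The composition of `Atl`. -/
noncomputable def AtlHom.comp (f : AtlHom x y) (g : AtlHom y z) : AtlHom x z :=
  .of (Classical.choose (g.tangle.out.isComposable f.tangle.out))
    (f.cPlus + g.cPlus + (shadedLoops f.tangle.out g.tangle.out).ncard)
    (f.cMinus + g.cMinus + (unshadedLoops f.tangle.out g.tangle.out).ncard)

/-- `IsComposite` quantifies over all representatives. Existence makes it total, and equivalence of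
composites of equivalent tangles makes it single-valued. -/
theorem AtlHom.isComposite_iff (f : AtlHom x y) (g : AtlHom y z) (h : AtlHom x z) :
    f.IsComposite g h ↔ h = f.comp g := by
  have hR := Classical.choose_spec (g.tangle.out.isComposable f.tangle.out)
  constructor
  · rintro ⟨T, S, R, hT, hS, hR', hc, h1, h2⟩
    have eT : T.Equivalent f.tangle.out := Quotient.exact (hT.symm.trans (Quotient.out_eq _).symm)
    have eS : S.Equivalent g.tangle.out := Quotient.exact (hS.symm.trans (Quotient.out_eq _).symm)
    obtain ⟨eR, el⟩ := hc.equivalent eT eS hR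
    refine AtlHom.ext (hR'.trans (Quotient.sound eR)) (h1.trans ?_) (h2.trans ?_)
    · have := el (some true)
      simp only [loopSet] at this
      rw [← this]; rfl
    · have := el (some false)
      simp only [loopSet] at this
      rw [← this]; rfl
  · rintro rfl
    exact ⟨_, _, _, (Quotient.out_eq _).symm, (Quotient.out_eq _).symm, rfl, hR, rfl, rfl⟩

theorem AtlHom.comp_of {T : LiftedTangle x y} {S : LiftedTangle y z} {R : LiftedTangle x z}
    (h : IsReducedComposite T S R) (a b c d : ℕ) : (AtlHom.of T a b).comp (.of S c d) =
      .of R (a + c + (loopSet T S (some true)).ncard) (b + d + (loopSet T S (some false)).ncard) :=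
  ((AtlHom.isComposite_iff _ _ _).1 ⟨T, S, R, rfl, rfl, rfl, h, rfl, rfl⟩).symm

theorem AtlHom.comp_of_loopless {T : LiftedTangle x y} {S : LiftedTangle y z}
    {R : LiftedTangle x z} (h : IsReducedComposite T S R) (h2 : ∀ κ, loopSet T S κ = ∅)
    (a b c d : ℕ) : (AtlHom.of T a b).comp (.of S c d) = .of R (a + c) (b + d) := by
  rw [AtlHom.comp_of h, h2, h2, Set.ncard_empty]
  rfl

theorem AtlHom.id_comp (f : AtlHom x y) : (AtlHom.idm x).comp f = f := by
  obtain ⟨T, a, b, rfl⟩ := f.exists_of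
  refine (AtlHom.comp_of_loopless (isReducedComposite_idt_left T) (loopSet_idt_left T) 0 0 a
    b).trans ?_
  rw [zero_add, zero_add]

theorem AtlHom.comp_id (f : AtlHom x y) : f.comp (AtlHom.idm y) = f := by
  obtain ⟨T, a, b, rfl⟩ := f.exists_of
  exact AtlHom.comp_of_loopless (isReducedComposite_idt T) (loopSet_idt T) a b 0 0

theorem AtlHom.comp_assoc (f : AtlHom w x) (g : AtlHom x y) (h : AtlHom y z) :
    (f.comp g).comp h = f.comp (g.comp h) := by
  obtain ⟨T, a, b, rfl⟩ := f.exists_of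
  obtain ⟨S, c, d, rfl⟩ := g.exists_of
  obtain ⟨U, e, e', rfl⟩ := h.exists_of
  obtain ⟨P, hP⟩ := S.isComposable T
  obtain ⟨Q, hQ⟩ := U.isComposable S
  obtain ⟨R, hR⟩ := U.isComposable P
  have hR' := (isReducedComposite_assoc hP hQ).1 hR
  rw [AtlHom.comp_of hP, AtlHom.comp_of hR, AtlHom.comp_of hQ, AtlHom.comp_of hR']
  have h1 := ncard_loopSet_assoc hP hQ (some true)
  have h2 := ncard_loopSet_assoc hP hQ (some false)
  congr 1 <;> omega

theorem AtlHom.star_of (T : LiftedTangle x y) (a b : ℕ) :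
    (AtlHom.of T a b).star = .of T.star a b := rfl

theorem AtlHom.star_idm (x : Obj) : (AtlHom.idm x).star = .idm x := by
  change AtlHom.of (LiftedTangle.idt x).star 0 0 = .of (.idt x) 0 0
  rw [LiftedTangle.idt_star]

theorem AtlHom.star_star (f : AtlHom x y) : f.star.star = f := by
  obtain ⟨T, a, b, rfl⟩ := f.exists_of
  rw [AtlHom.star_of, AtlHom.star_of, T.star_star]

theorem AtlHom.star_comp (f : AtlHom x y) (g : AtlHom y z) :
    (f.comp g).star = g.star.comp f.star := by
  obtain ⟨T, a, b, rfl⟩ := f.exists_of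
  obtain ⟨S, c, d, rfl⟩ := g.exists_of
  obtain ⟨R, hR⟩ := S.isComposable T
  rw [AtlHom.comp_of hR, AtlHom.star_of, AtlHom.star_of, AtlHom.star_of, AtlHom.comp_of hR.star,
    loopSet_star, loopSet_star, add_comm a, add_comm b]

/-- The composition of `Atl` with its laws. -/
noncomputable def atlComposition : AtlComposition where
  comp := AtlHom.comp
  isComposite_iff := AtlHom.isComposite_iff
  id_comp := AtlHom.id_comp
  comp_id := AtlHom.comp_id
  assoc := AtlHom.comp_assoc
  star_id := AtlHom.star_idm
  star_star := AtlHom.star_star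
  star_comp := AtlHom.star_comp

end Atl

/-! ## The relations hold in `Atl` -/

section Relations

variable {i j : ℕ} {x y y' z : Obj}

theorem IsLooplessComposite.comp_of {T : LiftedTangle x y} {S : LiftedTangle y z}
    {R : LiftedTangle x z} (h : IsLooplessComposite T S R) :
    (AtlHom.of T 0 0).comp (.of S 0 0) = .of R 0 0 :=
  AtlHom.comp_of_loopless h.1 h.2 0 0 0 0

theorem comp_of_b (T : LiftedTangle x y) (h : IsAlpha i z y) {R : LiftedTangle x z}
    (hR : IsInsertion h T R) (a b c d : ℕ) :
    (AtlHom.of T a b).comp (.of (.b h) c d) = .of R (a + c) (b + d) :=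
  AtlHom.comp_of_loopless hR.isReducedComposite (loopSet_b T h) a b c d

theorem comp_of_rot (T : LiftedTangle x y) (r : ℤ) (a b c d : ℕ) :
    (AtlHom.of T a b).comp (.of (.rot y r) c d) = .of (T.rotate r) (a + c) (b + d) :=
  AtlHom.comp_of_loopless (isReducedComposite_rot T r) (loopSet_rot T r) a b c d

theorem comp_of_idt (f : AtlHom x y) (a b : ℕ) :
    f.comp (.of (.idt y) a b) = ⟨f.tangle, f.cPlus + a, f.cMinus + b⟩ := by
  obtain ⟨T, c, d, rfl⟩ := f.exists_of
  exact AtlHom.comp_of_loopless (isReducedComposite_idt T) (loopSet_idt T) c d a b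

theorem of_idt_comp (f : AtlHom x y) (a b : ℕ) :
    (AtlHom.of (.idt x) a b).comp f = ⟨f.tangle, f.cPlus + a, f.cMinus + b⟩ := by
  obtain ⟨T, c, d, rfl⟩ := f.exists_of
  refine (AtlHom.comp_of_loopless (isReducedComposite_idt_left T) (loopSet_idt_left T) a b c
    d).trans ?_
  rw [add_comm a, add_comm b]
  rfl

theorem star_of_b (h : IsAlpha i z y) :
    (AtlHom.of (.b h) 0 0).star = .of (.a h) 0 0 := by
  rw [AtlHom.star_of, LiftedTangle.star_star]

theorem comp_b_b {ha : IsAlpha i z y} {ha2 : IsAlpha (i - 2) y x}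
    {hb : IsAlpha j z y} {hb2 : IsAlpha j y x} (hij : j + 1 < i)
    (hne : ¬ (i = 2 * z.size ∧ j = 1)) :
    (AtlHom.of (.b ha2) 0 0).comp (.of (.b hb) 0 0) =
      (AtlHom.of (.b hb2) 0 0).comp (.of (.b ha) 0 0) := by
  obtain ⟨R, h1, h2⟩ :=
    exists_isInsertion_b_b (ha := ha) (ha2 := ha2) (hb := hb) (hb2 := hb2) hij hne
  rw [comp_of_b _ _ h1, comp_of_b _ _ h2]

theorem comp_a_a {ha : IsAlpha i z y} {ha2 : IsAlpha (i - 2) y x}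
    {hb : IsAlpha j z y} {hb2 : IsAlpha j y x} (hij : j + 1 < i)
    (hne : ¬ (i = 2 * z.size ∧ j = 1)) :
    (AtlHom.of (.a ha) 0 0).comp (.of (.a hb2) 0 0) =
      (AtlHom.of (.a hb) 0 0).comp (.of (.a ha2) 0 0) := by
  have := congrArg AtlHom.star
    (comp_b_b (ha := ha) (ha2 := ha2) (hb := hb) (hb2 := hb2) hij hne)
  simp only [AtlHom.star_comp, star_of_b] at this
  exact this.symm

theorem of_rot_eq (c k : ℤ) (a b : ℕ) :
    AtlHom.of (.rot x c) a b = .of (.rot x (c + k * x.size)) a b :=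
  AtlHom.of_eq_of_iff.2 ⟨LiftedTangle.rot_equivalent c k, rfl, rfl⟩

theorem comp_rot_rot (c d : ℤ) : (AtlHom.of (.rot x c) 0 0).comp (.of (.rot x d) 0 0) =
    .of (.rot x (c + d)) 0 0 := by
  rw [comp_of_rot]
  exact congrArg (AtlHom.of · 0 0) (LiftedTangle.rotate_rotate c d _)

theorem of_rot_zero : AtlHom.of (.rot x 0) 0 0 = .idm x := by
  rw [LiftedTangle.rot_zero]; rfl

theorem comp_rot_b {h : IsAlpha i z y} {h2 : IsAlpha (i - 2) z y} (h3 : 3 ≤ i) :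
    (AtlHom.of (.rot y 1) 0 0).comp (.of (.b h) 0 0) =
      (AtlHom.of (.b h2) 0 0).comp (.of (.rot z 1) 0 0) := by
  rw [comp_of_b _ _ (isInsertion_rot_b (h2 := h2) h3), comp_of_rot]

theorem comp_rot_a {h : IsAlpha i z y} {h2 : IsAlpha (i - 2) z y} (h3 : 3 ≤ i) :
    (AtlHom.of (.rot z 1) 0 0).comp (.of (.a h) 0 0) =
      (AtlHom.of (.a h2) 0 0).comp (.of (.rot y 1) 0 0) := by
  have := congrArg AtlHom.star (comp_rot_b (h := h) (h2 := h2) h3)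
  simp only [AtlHom.star_comp, star_of_b, AtlHom.star_of (.rot _ _), LiftedTangle.rot_star] at this
  have e : ∀ x, (AtlHom.of (.rot x (-1)) 0 0).comp (.of (.rot x 1) 0 0) = .idm x := fun x => by
    rw [comp_rot_rot, neg_add_cancel, of_rot_zero]
  have e' : ∀ x, (AtlHom.of (.rot x 1) 0 0).comp (.of (.rot x (-1)) 0 0) = .idm x := fun x => by
    rw [comp_rot_rot, add_neg_cancel, of_rot_zero]
  -- The reflected relation involves inverse rotations; they are moved to the other sides.
  rw [← (AtlHom.of (.a h) 0 0).comp_id, ← e, ← AtlHom.comp_assoc (.of (.a h) 0 0), this,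
    ← AtlHom.comp_assoc, ← AtlHom.comp_assoc, e', AtlHom.id_comp]

theorem comp_b_a_same (h : IsAlpha i z y) : (AtlHom.of (.b h) 0 0).comp (.of (.a h) 0 0) =
    .of (.idt y) (if Odd i then 1 else 0) (if Odd i then 0 else 1) := by
  rw [AtlHom.comp_of (isReducedComposite_ba_same h), (loopSet_ba_same h).2,
    (loopSet_ba_same h).2]
  by_cases hi : Odd i <;> simp [hi]

/-- The image of a word in `Atl`. -/
noncomputable def Word.image (w : Word.obj x ⟶ Word.obj y) : AtlHom x y :=
  (wordFunctor atlComposition).map w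

theorem Word.image_comp (v : Word.obj x ⟶ Word.obj y) (w : Word.obj y ⟶ Word.obj z) :
    Word.image (v ≫ w) = (Word.image v).comp (Word.image w) :=
  (wordFunctor atlComposition).map_comp v w

theorem Word.image_id : Word.image (𝟙 (Word.obj x)) = .idm x :=
  (wordFunctor atlComposition).map_id _

theorem Word.image_gen (g : Gen x y) : Word.image (Word.gen g) = genImage g :=
  AtlHom.id_comp _

theorem Word.image_α (h : IsAlpha i z y) : Word.image (Word.α i h) = .of (.a h) 0 0 :=
  Word.image_gen _

theorem Word.image_β (h : IsAlpha i z y) : Word.image (Word.β i h) = .of (.b h) 0 0 :=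
  Word.image_gen _

theorem Word.image_τ (k : ℕ) : Word.image (Word.τ k) = .of (.rot (.num k) 1) 0 0 :=
  (Word.image_gen _).trans (congrArg (AtlHom.of · 0 0) (LiftedTangle.t_eq_rot _))

theorem Word.image_τpow (k r : ℕ) : Word.image (Word.τpow k r) = .of (.rot (.num k) r) 0 0 := by
  induction r with
  | zero => exact Word.image_id.trans of_rot_zero.symm
  | succ r ih =>
    refine (Word.image_comp (Word.τpow k r) (Word.τ k)).trans ?_
    rw [ih, Word.image_τ, comp_rot_rot, Nat.cast_succ]

/-- The exponent of `δ₊` in `δ_s`. -/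
def Sign.plusCount : Sign → ℕ
  | .plus => 1
  | .minus => 0

/-- The exponent of `δ₋` in `δ_s`. -/
def Sign.minusCount : Sign → ℕ
  | .plus => 0
  | .minus => 1

theorem Word.image_δ (s : Sign) (x : Obj) :
    Word.image (Word.δ s x) = .of (.idt x) s.plusCount s.minusCount := by
  cases s <;> exact Word.image_gen _

theorem Word.map_eq_of_image_eq {v w : Word.obj x ⟶ Word.obj y}
    (h : Word.image v = Word.image w) :
    (wordFunctor atlComposition).map v = (wordFunctor atlComposition).map w := h

theorem relationsHold : RelationsHold atlComposition := by
  intro X Y v w h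
  cases h with
  | alpha_alpha i j hj hi hi2 hj2 hij hne =>
    refine Word.map_eq_of_image_eq ?_
    simp only [Word.image_comp, Word.image_α]
    exact comp_a_a hij fun h => hne h.symm
  | beta_beta i j hj hi hi2 hj2 hij hne =>
    refine Word.map_eq_of_image_eq ?_
    simp only [Word.image_comp, Word.image_β]
    have h1 := hi.bounds
    have h2 := hi2.bounds
    exact comp_b_b (i := j + 2) (ha2 := hj) (by omega) (by omega)
  | tau_pow k =>
    refine Word.map_eq_of_image_eq ?_
    rw [Word.image_τpow, Word.image_id, ← of_rot_zero, of_rot_eq 0 1, zero_add, one_mul]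
    rfl
  | alpha_tau k i hi hi2 h3 =>
    refine Word.map_eq_of_image_eq ?_
    simp only [Word.image_comp, Word.image_α, Word.image_τ]
    exact comp_rot_a h3
  | beta_tau k i hi hi2 h3 =>
    refine Word.map_eq_of_image_eq ?_
    simp only [Word.image_comp, Word.image_β, Word.image_τ]
    exact comp_rot_b h3
  | alpha_beta_plus ha hb =>
    refine Word.map_eq_of_image_eq ?_
    simp only [Word.image_comp, Word.image_α, Word.image_β, Word.image_δ]
    exact comp_b_a_same ha
  | alpha_beta_minus ha hb =>
    refine Word.map_eq_of_image_eq ?_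
    simp only [Word.image_comp, Word.image_α, Word.image_β, Word.image_δ]
    exact comp_b_a_same ha
  | alpha_beta_first k ha hb =>
    refine Word.map_eq_of_image_eq ?_
    simp only [Word.image_comp, Word.image_α, Word.image_β, Word.image_τpow]
    have := (isLooplessComposite_ba_last (ha := hb) (hb := ha) rfl (Nat.succ_pos k)).star_ba.comp_of
    -- Adding a full turn turns the exponent `-1` into the exponent `k` of `τpow k k`.
    rw [LiftedTangle.rot_star, of_rot_eq _ 1] at this
    refine this.trans ?_
    congr 2
    simp [Obj.size]
  | alpha_beta_lt k i j ha hb ha2 hb2 hij hne =>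
    refine Word.map_eq_of_image_eq ?_
    simp only [Word.image_comp, Word.image_α, Word.image_β]
    obtain ⟨E, h1, h2⟩ := exists_composite_ba_gt (ha := hb) (hb := ha) hb2 ha2 hij
      (fun h => hne ⟨h.2, h.1⟩)
    rw [h1.star_ba.comp_of]
    have := h2.star
    rw [LiftedTangle.star_star] at this
    refine (AtlHom.comp_of_loopless this (fun κ => ?_) 0 0 0 0).symm
    exact loopSet_b _ hb2 κ
  | alpha_beta_pred k i j ha hb hij =>
    refine Word.map_eq_of_image_eq ?_
    simp only [Word.image_comp, Word.image_α, Word.image_β, Word.image_id]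
    have := (isLooplessComposite_ba_succ (ha := hb) (hb := ha) hij.symm
      (Nat.succ_pos k)).star_ba.comp_of
    rw [LiftedTangle.idt_star] at this
    exact this
  | alpha_beta_odd k i ha hb hi =>
    refine Word.map_eq_of_image_eq ?_
    simp only [Word.image_comp, Word.image_α, Word.image_β, Word.image_δ]
    rw [comp_b_a_same ha, if_pos hi, if_pos hi]
    rfl
  | alpha_beta_even k i ha hb hi =>
    refine Word.map_eq_of_image_eq ?_
    simp only [Word.image_comp, Word.image_α, Word.image_β, Word.image_δ]
    rw [comp_b_a_same ha, if_neg (Nat.not_odd_iff_even.2 hi), if_neg (Nat.not_odd_iff_even.2 hi)]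
    rfl
  | alpha_beta_succ k i j ha hb hij =>
    refine Word.map_eq_of_image_eq ?_
    simp only [Word.image_comp, Word.image_α, Word.image_β, Word.image_id]
    exact (isLooplessComposite_ba_succ (y := .num k) hij (Nat.succ_pos k)).comp_of
  | alpha_beta_gt k i j ha hb ha2 hb2 hij hne =>
    refine Word.map_eq_of_image_eq ?_
    simp only [Word.image_comp, Word.image_α, Word.image_β]
    obtain ⟨E, h1, h2⟩ := exists_composite_ba_gt (ha := ha) (hb := hb) ha2 hb2 hij hne
    rw [h1.comp_of]
    exact (AtlHom.comp_of_loopless h2 (loopSet_b _ hb2) 0 0 0 0).symm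
  | alpha_beta_last k ha hb =>
    refine Word.map_eq_of_image_eq ?_
    simp only [Word.image_comp, Word.image_α, Word.image_β, Word.image_τ]
    exact (isLooplessComposite_ba_last (y := .num k) rfl (Nat.succ_pos k)).comp_of
  | delta_comm s g =>
    refine Word.map_eq_of_image_eq ?_
    simp only [Word.image_comp, Word.image_δ]
    rw [comp_of_idt, of_idt_comp]

end Relations

/-! ## Normal forms in `aΔ` -/

theorem IsAlpha.num_spec {i k : ℕ} {y : Obj} (h : IsAlpha i (.num (k + 1)) y) :
    y = .num k ∧ 1 ≤ i ∧ i ≤ 2 * (k + 2) := by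
  rcases y with l | s
  · have ⟨hl, h1, h2⟩ := h
    exact ⟨congrArg Obj.num hl, h1, h2⟩
  · exact h.elim

theorem isAlpha_num {i k : ℕ} (h1 : 1 ≤ i) (h2 : i ≤ 2 * (k + 2)) :
    IsAlpha i (.num (k + 1)) (.num k) := ⟨rfl, h1, h2⟩

/-! ### Rewriting rules and normal forms in `aΔ` -/

namespace aΔ

variable {i j k l : ℕ} {w x y y' z : Obj}

/-- The morphism `α_i`. -/
def α (h : IsAlpha i z y) : aΔ.obj z ⟶ aΔ.obj y := aΔ.mk (Word.α i h)

/-- The morphism `β_i`. -/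
def β (h : IsAlpha i z y) : aΔ.obj y ⟶ aΔ.obj z := aΔ.mk (Word.β i h)

/-- The morphism `τ`. -/
def τ (k : ℕ) : aΔ.obj (.num k) ⟶ aΔ.obj (.num k) := aΔ.mk (Word.τ k)

/-- The morphism `τ ^ r`. -/
def τpow (k r : ℕ) : aΔ.obj (.num k) ⟶ aΔ.obj (.num k) := aΔ.mk (Word.τpow k r)

/-- The morphisms `δ₊` and `δ₋`. -/
def δ (s : Sign) (x : Obj) : aΔ.obj x ⟶ aΔ.obj x := aΔ.mk (Word.δ s x)

theorem induction {P : ∀ {x y : Obj}, (aΔ.obj x ⟶ aΔ.obj y) → Prop}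
    (id : ∀ x, P (𝟙 (aΔ.obj x)))
    (α : ∀ {i x z y} (f : aΔ.obj x ⟶ aΔ.obj z) (h : IsAlpha i z y), P f → P (f ≫ aΔ.α h))
    (β : ∀ {i x z y} (f : aΔ.obj x ⟶ aΔ.obj y) (h : IsAlpha i z y), P f → P (f ≫ aΔ.β h))
    (τ : ∀ {x k} (f : aΔ.obj x ⟶ aΔ.obj (.num k)), P f → P (f ≫ aΔ.τ k))
    (δ : ∀ {x y} (s : Sign) (f : aΔ.obj x ⟶ aΔ.obj y), P f → P (f ≫ aΔ.δ s y))
    {x y : Obj} (f : aΔ.obj x ⟶ aΔ.obj y) : P f := by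
  have step : ∀ {x y z : Obj} (f : aΔ.obj x ⟶ aΔ.obj y) (g : Gen y z), P f →
      P (f ≫ aΔ.mk (Word.gen g)) := by
    intro x y z f g hf
    cases g with
    | alpha i h => exact α _ h hf
    | beta i h => exact β _ h hf
    | tau k => exact τ _ hf
    | delta s x => exact δ s _ hf
  have main : ∀ {x y : Obj} (w : @Quiver.Path GenQuiver _ x y),
      P (aΔ.mk (x := x) (y := y) w) := by
    intro x y w
    induction w with
    | nil => exact id x
    | @cons b c p g ih => exact step (x := x) (y := b) (z := c) (aΔ.mk (x := x) (y := b) p) g ih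
  obtain ⟨w⟩ := f
  exact main w

theorem τpow_zero (k : ℕ) : τpow k 0 = 𝟙 _ := rfl

theorem τpow_succ (k r : ℕ) : τpow k (r + 1) = τpow k r ≫ τ k := rfl

theorem τpow_succ' (k r : ℕ) : τpow k (r + 1) = τ k ≫ τpow k r := by
  rw [τpow, add_comm, Word.τpow_add, aΔ.mk_comp, Word.τpow_one]
  rfl

theorem τpow_self (k : ℕ) : τpow k (k + 1) = 𝟙 _ := aΔ.sound (.tau_pow k)

theorem τpow_mod (k r : ℕ) : τpow k (r % (k + 1)) = τpow k r := by
  conv_rhs => rw [← Nat.div_add_mod r (k + 1)]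
  rw [τpow, τpow, Word.τpow_add, aΔ.mk_comp, aΔ.τpow_mul, Category.id_comp]

theorem τ_zero : τ 0 = 𝟙 _ := by
  have := τpow_self 0
  rwa [τpow_succ, τpow_zero, Category.id_comp] at this

theorem comp_δ (s : Sign) (f : aΔ.obj x ⟶ aΔ.obj y) : f ≫ δ s y = δ s x ≫ f := by
  have h : ∀ {x y : Obj} (g : Gen x y), aΔ.mk (Word.gen g) ≫ δ s y =
      δ s x ≫ aΔ.mk (Word.gen g) := fun g => aΔ.sound (.delta_comm s g)
  have h2 : ∀ {w x y : Obj} (f : aΔ.obj w ⟶ aΔ.obj x) (g : Gen x y), f ≫ δ s x = δ s w ≫ f →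
      (f ≫ aΔ.mk (Word.gen g)) ≫ δ s y = δ s w ≫ f ≫ aΔ.mk (Word.gen g) := by
    intro w x y f g hf
    rw [Category.assoc, h, ← Category.assoc, hf, Category.assoc]
  refine induction (P := fun {x y} f => f ≫ δ s y = δ s x ≫ f) (fun x => ?_)
    (fun f h hf => h2 f (.alpha _ h) hf) (fun f h hf => h2 f (.beta _ h) hf)
    (fun f hf => h2 f (.tau _) hf) (fun r f hf => h2 f (.delta r _) hf) f
  rw [Category.comp_id, Category.id_comp]

theorem comp_δ_comm (s : Sign) (f : aΔ.obj w ⟶ aΔ.obj x) (g : aΔ.obj x ⟶ aΔ.obj y) :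
    (f ≫ g) ≫ δ s y = (f ≫ δ s x) ≫ g := by
  rw [Category.assoc, comp_δ, Category.assoc]

theorem β_τ (h : IsAlpha i (.num (k + 1)) (.num k)) (h2 : IsAlpha (i + 2) (.num (k + 1)) (.num k)) :
    β h ≫ τ (k + 1) = τ k ≫ β h2 :=
  (aΔ.sound (.beta_tau k (i + 2) h2 h (by have := h.bounds; omega))).symm

theorem β_τpow (r : ℕ) (h : IsAlpha i (.num (k + 1)) (.num k))
    (h2 : IsAlpha (i + 2 * r) (.num (k + 1)) (.num k)) :
    β h ≫ τpow (k + 1) r = τpow k r ≫ β h2 := by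
  induction r with
  | zero => exact (Category.comp_id _).trans (Category.id_comp _).symm
  | succ r ih =>
    have h3 : IsAlpha (i + 2 * r) (.num (k + 1)) (.num k) := by
      obtain ⟨_, h4, h5⟩ := h2
      have := h.bounds
      exact ⟨rfl, by omega, by omega⟩
    rw [τpow_succ, ← Category.assoc, ih h3, Category.assoc, β_τ h3 h2, ← Category.assoc]
    rfl

/-- The cyclic case which the commutation of `β` and `τ` leaves open, `i ∈ {1, 2}`. Commuting `β_i`
past `τ ^ (k + 1)` gives the left-hand `β`, because this power is trivial on `[k + 1]`; one more `τ`
completes a full turn on `[k + 2]`. -/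
theorem β_τ_last (h : IsAlpha i (.num (k + 1)) (.num k))
    (h2 : IsAlpha (i + 2 * (k + 1)) (.num (k + 1)) (.num k)) : β h2 ≫ τ (k + 1) = β h := by
  have := β_τpow (k + 1) h h2
  rw [τpow_self, Category.id_comp] at this
  rw [← this, Category.assoc, ← τpow_succ, τpow_self, Category.comp_id]

/-- The involution of `aΔ`. -/
abbrev star (f : aΔ.obj x ⟶ aΔ.obj y) : aΔ.obj y ⟶ aΔ.obj x := InvolutiveCategory.star f

theorem star_comp (f : aΔ.obj x ⟶ aΔ.obj y) (g : aΔ.obj y ⟶ aΔ.obj z) :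
    star (f ≫ g) = star g ≫ star f := InvolutiveCategory.star_comp f g

theorem star_star (f : aΔ.obj x ⟶ aΔ.obj y) : star (star f) = f := InvolutiveCategory.star_star f

theorem star_id (x : Obj) : star (𝟙 (aΔ.obj x)) = 𝟙 _ := InvolutiveCategory.star_id _

theorem star_gen (g : Gen x y) : star (aΔ.mk (Word.gen g)) = aΔ.mk (Word.starGen g) :=
  congrArg Quiver.Hom.unop (Word.star_gen g)

theorem star_α (h : IsAlpha i z y) : star (α h) = β h := star_gen _

theorem star_β (h : IsAlpha i z y) : star (β h) = α h := star_gen _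

theorem star_τ (k : ℕ) : star (τ k) = τpow k k := star_gen _

theorem star_δ (s : Sign) (x : Obj) : star (δ s x) = δ s x := star_gen _

theorem τ_α (h : IsAlpha (i + 2) (.num (k + 1)) (.num k)) (h2 : IsAlpha i (.num (k + 1)) (.num k)) :
    τ (k + 1) ≫ α h = α h2 ≫ τ k :=
  aΔ.sound (.alpha_tau k (i + 2) h h2 (by have := h2.bounds; omega))

theorem τ_α_first (h : IsAlpha i (.num (k + 1)) (.num k))
    (h2 : IsAlpha (i + 2 * (k + 1)) (.num (k + 1)) (.num k)) : τ (k + 1) ≫ α h = α h2 := by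
  have := congrArg star (β_τ_last h h2)
  rw [star_comp, star_β, star_β, star_τ] at this
  rw [← this, ← Category.assoc, ← τpow_succ', τpow_self, Category.id_comp]

/-! ### Normal forms -/

/-- Products of `τ`, `δ₊`, `δ₋` and of `α_i β_j` on `[0±]` with `i ≠ j`. -/
inductive IsCore : ∀ {x y : Obj}, (aΔ.obj x ⟶ aΔ.obj y) → Prop
  | id (x : Obj) : IsCore (𝟙 (aΔ.obj x))
  | τ {x : Obj} {k : ℕ} {f : aΔ.obj x ⟶ aΔ.obj (.num k)} : IsCore f → IsCore (f ≫ aΔ.τ k)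
  | δ {x y : Obj} (s : Sign) {f : aΔ.obj x ⟶ aΔ.obj y} : IsCore f → IsCore (f ≫ aΔ.δ s y)
  | loop {x : Obj} {i j : ℕ} {s s' : Sign} {f : aΔ.obj x ⟶ aΔ.obj (.zero s')}
      (ha : IsAlpha i (.num 0) (.zero s)) (hb : IsAlpha j (.num 0) (.zero s')) (hs : s' ≠ s) :
      IsCore f → IsCore (f ≫ aΔ.β hb ≫ aΔ.α ha)

/-- Products of a core and of `α_i`. -/
inductive IsAlphaCore : ∀ {x y : Obj}, (aΔ.obj x ⟶ aΔ.obj y) → Prop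
  | core {x y : Obj} {f : aΔ.obj x ⟶ aΔ.obj y} : IsCore f → IsAlphaCore f
  | α {i : ℕ} {x y z : Obj} (h : IsAlpha i x y) {f : aΔ.obj y ⟶ aΔ.obj z} :
      IsAlphaCore f → IsAlphaCore (aΔ.α h ≫ f)

/-- Products of `β_i`, of a core and of `α_i`. -/
inductive IsNormal : ∀ {x y : Obj}, (aΔ.obj x ⟶ aΔ.obj y) → Prop
  | alphaCore {x y : Obj} {f : aΔ.obj x ⟶ aΔ.obj y} : IsAlphaCore f → IsNormal f
  | β {i : ℕ} {x y z : Obj} (h : IsAlpha i z y) {f : aΔ.obj x ⟶ aΔ.obj y} :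
      IsNormal f → IsNormal (f ≫ aΔ.β h)

/-- The cast along `hy` keeps the target a variable, as the induction on the family requires; it
disappears once the target is substituted. Later lemmas use the same device. -/
theorem IsAlphaCore.comp_τ {f : aΔ.obj x ⟶ aΔ.obj y} (hf : IsAlphaCore f) :
    ∀ {k} (hy : y = .num k), IsAlphaCore (f ≫ (hy ▸ aΔ.τ k)) := by
  induction hf with
  | core hf => rintro k rfl; exact .core hf.τ
  | α h _ ih => rintro k rfl; rw [Category.assoc]; exact .α h (ih rfl)

theorem IsAlphaCore.comp_δ {f : aΔ.obj x ⟶ aΔ.obj y} (hf : IsAlphaCore f) (s : Sign) :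
    IsAlphaCore (f ≫ aΔ.δ s y) := by
  induction hf with
  | core hf => exact .core (hf.δ s)
  | α h _ ih => rw [Category.assoc]; exact .α h ih

theorem IsAlphaCore.comp_loop {s s' : Sign} (ha : IsAlpha i (.num 0) (.zero s))
    (hb : IsAlpha j (.num 0) (.zero s')) (hs : s' ≠ s) {f : aΔ.obj x ⟶ aΔ.obj y}
    (hf : IsAlphaCore f) : ∀ hy : y = .zero s',
      IsAlphaCore (f ≫ (hy ▸ (aΔ.β hb ≫ aΔ.α ha) : aΔ.obj y ⟶ aΔ.obj (.zero s))) := by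
  induction hf with
  | core hf => rintro rfl; exact .core (hf.loop ha hb hs)
  | α h _ ih => rintro rfl; rw [Category.assoc]; exact .α h (ih rfl)

/-- `α_i` moves past the core to the side of the `α`s: its index drops by two at each `τ`, or, if it
is at most `2`, it wraps around and absorbs the `τ`. After a loop factor the target is `[0±]`, where
no `α` starts. -/
theorem IsCore.comp_α {f : aΔ.obj x ⟶ aΔ.obj z} (hf : IsCore f) :
    ∀ {i y} (h : IsAlpha i z y), IsAlphaCore (f ≫ α h) := by
  induction hf with
  | id =>
    intro i y h
    rw [Category.id_comp, ← Category.comp_id (aΔ.α h)]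
    exact .α h (.core (.id _))
  | @τ k f hf ih =>
    intro i y h
    rcases k with _ | k
    · rw [τ_zero, Category.comp_id]
      exact ih h
    · obtain ⟨rfl, h1, h2⟩ := h.num_spec
      rw [Category.assoc]
      by_cases hi : 3 ≤ i
      · obtain ⟨i, rfl⟩ : ∃ i', i = i' + 2 := ⟨i - 2, by omega⟩
        rw [τ_α _ (isAlpha_num (by omega) (by omega)), ← Category.assoc]
        exact (ih _).comp_τ rfl
      · rw [τ_α_first _ (isAlpha_num (by omega) (by omega))]
        exact ih _
  | δ s hf ih =>
    intro i y h
    rw [← comp_δ_comm]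
    exact (ih h).comp_δ s
  | loop ha hb hs hf ih =>
    intro i y h
    exact h.elim

theorem IsAlphaCore.comp_α {f : aΔ.obj x ⟶ aΔ.obj z} (hf : IsAlphaCore f) :
    ∀ {i y} (h : IsAlpha i z y), IsAlphaCore (f ≫ aΔ.α h) := by
  induction hf with
  | core hf => intro i y h; exact hf.comp_α h
  | α h0 _ ih => intro i y h; rw [Category.assoc]; exact .α h0 (ih h)

theorem IsNormal.comp_δ {f : aΔ.obj x ⟶ aΔ.obj y} (hf : IsNormal f) (s : Sign) :
    IsNormal (f ≫ aΔ.δ s y) := by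
  induction hf with
  | alphaCore hf => exact .alphaCore (hf.comp_δ s)
  | β h _ ih => rw [comp_δ_comm]; exact .β h ih

/-- `τ` moves inwards past the final `β`s and raises their indices by two; at the two largest
indices it is absorbed instead. -/
theorem IsNormal.comp_τ {f : aΔ.obj x ⟶ aΔ.obj y} (hf : IsNormal f) :
    ∀ {k} (hy : y = .num k), IsNormal (f ≫ (hy ▸ aΔ.τ k)) := by
  induction hf with
  | alphaCore hf => intro k hy; exact .alphaCore (hf.comp_τ hy)
  | @β i x y z h f hf ih =>
    rintro k rfl
    rcases k with _ | k
    · change IsNormal (_ ≫ aΔ.τ 0)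
      rw [τ_zero, Category.comp_id]
      exact .β h hf
    · obtain ⟨rfl, h1, h2⟩ := h.num_spec
      change IsNormal ((f ≫ _) ≫ aΔ.τ (k + 1))
      rw [Category.assoc]
      by_cases hi : i ≤ 2 * (k + 1)
      · rw [β_τ _ (isAlpha_num (by omega) (by omega)), ← Category.assoc]
        exact .β _ (ih rfl)
      · obtain ⟨i, rfl⟩ : ∃ i', i = i' + 2 * (k + 1) := ⟨i - 2 * (k + 1), by omega⟩
        rw [β_τ_last (isAlpha_num (by omega) (by omega))]
        exact .β _ hf

theorem IsNormal.comp_τpow {f : aΔ.obj x ⟶ aΔ.obj (.num k)} (hf : IsNormal f) (r : ℕ) :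
    IsNormal (f ≫ τpow k r) := by
  induction r with
  | zero => rw [τpow_zero, Category.comp_id]; exact hf
  | succ r ih => rw [τpow_succ, ← Category.assoc]; exact ih.comp_τ rfl

theorem IsNormal.alphaCore_of_zero {f : aΔ.obj x ⟶ aΔ.obj y} (hf : IsNormal f) {s : Sign}
    (hy : y = .zero s) : IsAlphaCore f := by
  cases hf with
  | alphaCore hf => exact hf
  | β h _ => subst hy; exact h.elim

/-- Each case of the product of `β_j` with `α_i` either removes the last `β` or exchanges the two
and leaves an `α` for the shorter normal form. -/
theorem IsNormal.comp_α {f : aΔ.obj x ⟶ aΔ.obj z} (hf : IsNormal f) :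
    ∀ {i y} (h : IsAlpha i z y), IsNormal (f ≫ aΔ.α h) := by
  induction hf with
  | alphaCore hf => intro i y h; exact .alphaCore (hf.comp_α h)
  | @β j x y' z hb f hf ih =>
    intro i y ha
    rw [Category.assoc]
    rcases ha.exists_isAlpha hb with ⟨k, rfl, rfl, rfl⟩ | ⟨s, s', rfl, rfl, rfl⟩
    · have ⟨_, i1, i2⟩ := ha
      have ⟨_, j1, j2⟩ := hb
      rcases lt_trichotomy i j with hij | rfl | hij
      · by_cases h1 : i + 1 = j
        · rw [show aΔ.β hb ≫ aΔ.α ha = 𝟙 _ from aΔ.sound (.alpha_beta_pred k i j ha hb h1),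
            Category.comp_id]
          exact hf
        · by_cases h2 : i = 1 ∧ j = 2 * (k + 1) + 2
          · obtain ⟨rfl, rfl⟩ := h2
            rw [show aΔ.β hb ≫ aΔ.α ha = τpow k k from aΔ.sound (.alpha_beta_first k ha hb)]
            exact hf.comp_τpow k
          · obtain ⟨y, hb2, ha2⟩ := IsAlpha.exists_pair (i := j) (j := i) (k := k) i1 (by omega)
              (fun h => h2 ⟨h.2, h.1⟩) j2
            rw [show aΔ.β hb ≫ aΔ.α ha = aΔ.α ha2 ≫ aΔ.β hb2 from
              aΔ.sound (.alpha_beta_lt k i j ha hb ha2 hb2 (by omega) h2), ← Category.assoc]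
            exact .β _ (ih ha2)
      · rcases Nat.even_or_odd i with hi | hi
        · rw [show aΔ.β hb ≫ aΔ.α ha = aΔ.δ .minus _ from
            aΔ.sound (.alpha_beta_even k i ha hb hi)]
          exact hf.comp_δ _
        · rw [show aΔ.β hb ≫ aΔ.α ha = aΔ.δ .plus _ from
            aΔ.sound (.alpha_beta_odd k i ha hb hi)]
          exact hf.comp_δ _
      · by_cases h1 : i = j + 1
        · rw [show aΔ.β hb ≫ aΔ.α ha = 𝟙 _ from aΔ.sound (.alpha_beta_succ k i j ha hb h1),
            Category.comp_id]
          exact hf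
        · by_cases h2 : i = 2 * (k + 1) + 2 ∧ j = 1
          · obtain ⟨rfl, rfl⟩ := h2
            rw [show aΔ.β hb ≫ aΔ.α ha = aΔ.τ k from aΔ.sound (.alpha_beta_last k ha hb)]
            exact hf.comp_τ rfl
          · obtain ⟨y, ha2, hb2⟩ := IsAlpha.exists_pair (k := k) j1 (by omega) h2 i2
            rw [show aΔ.β hb ≫ aΔ.α ha = aΔ.α ha2 ≫ aΔ.β hb2 from
              aΔ.sound (.alpha_beta_gt k i j ha hb ha2 hb2 (by omega) h2), ← Category.assoc]
            exact .β _ (ih ha2)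
    · by_cases hs : s' = s
      · subst hs
        rcases s' with _ | _
        · have hi : i = 1 := ha
          subst hi
          have hj : j = 1 := hb
          subst hj
          rw [show aΔ.β hb ≫ aΔ.α ha = aΔ.δ .plus _ from aΔ.sound (.alpha_beta_plus ha hb)]
          exact hf.comp_δ _
        · have hi : i = 2 := ha
          subst hi
          have hj : j = 2 := hb
          subst hj
          rw [show aΔ.β hb ≫ aΔ.α ha = aΔ.δ .minus _ from aΔ.sound (.alpha_beta_minus ha hb)]
          exact hf.comp_δ _
      -- The only product without a relation is the non-contractible loop. It starts at `[0±]`,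
      -- where no `β` can end, so it joins the core directly.
      · exact .alphaCore ((hf.alphaCore_of_zero rfl).comp_loop ha hb hs rfl)

theorem isNormal (f : aΔ.obj x ⟶ aΔ.obj y) : IsNormal f :=
  induction (P := fun f => IsNormal f) (fun x => .alphaCore (.core (.id x)))
    (fun _ h hf => hf.comp_α h) (fun _ h hf => .β h hf) (fun _ hf => hf.comp_τ rfl)
    (fun s _ hf => hf.comp_δ s) f

/-! ### Cores -/

/-- Products of `r` factors `τ`, respectively `α_i β_j` on `[0±]` with `i ≠ j`. -/
inductive IsTurn : ℕ → ∀ {x y : Obj}, (aΔ.obj x ⟶ aΔ.obj y) → Prop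
  | id (x : Obj) : IsTurn 0 (𝟙 (aΔ.obj x))
  | τ {x : Obj} {r k : ℕ} {f : aΔ.obj x ⟶ aΔ.obj (.num k)} :
      IsTurn r f → IsTurn (r + 1) (f ≫ aΔ.τ k)
  | loop {x : Obj} {r i j : ℕ} {s s' : Sign} {f : aΔ.obj x ⟶ aΔ.obj (.zero s')}
      (ha : IsAlpha i (.num 0) (.zero s)) (hb : IsAlpha j (.num 0) (.zero s')) (hs : s' ≠ s) :
      IsTurn r f → IsTurn (r + 1) (f ≫ aΔ.β hb ≫ aΔ.α ha)

/-- The morphism `δ₊ ^ a δ₋ ^ b`. -/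
def δpow (x : Obj) : ℕ → ℕ → (aΔ.obj x ⟶ aΔ.obj x)
  | 0, 0 => 𝟙 _
  | 0, b + 1 => δpow x 0 b ≫ δ .minus x
  | a + 1, b => δpow x a b ≫ δ .plus x

theorem comp_δpow (f : aΔ.obj x ⟶ aΔ.obj y) (a b : ℕ) : f ≫ δpow y a b = δpow x a b ≫ f := by
  induction a with
  | zero =>
    induction b with
    | zero => rw [δpow, δpow, Category.comp_id, Category.id_comp]
    | succ b ih => rw [δpow, δpow, ← Category.assoc, ih, Category.assoc, comp_δ, Category.assoc]
  | succ a ih => rw [δpow, δpow, ← Category.assoc, ih, Category.assoc, comp_δ, Category.assoc]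

theorem δpow_δ_minus (x : Obj) (a b : ℕ) : δpow x a b ≫ δ .minus x = δpow x a (b + 1) := by
  induction a with
  | zero => rw [δpow.eq_2]
  | succ a ih => rw [δpow.eq_3, δpow.eq_3, comp_δ_comm, ih]

theorem IsCore.exists_isTurn {f : aΔ.obj x ⟶ aΔ.obj y} (hf : IsCore f) :
    ∃ (r a b : ℕ) (g : aΔ.obj x ⟶ aΔ.obj y), IsTurn r g ∧ f = g ≫ δpow y a b := by
  induction hf with
  | id => exact ⟨0, 0, 0, _, .id _, by rw [δpow, Category.comp_id]⟩
  | τ _ ih =>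
    obtain ⟨r, a, b, g, hg, rfl⟩ := ih
    exact ⟨r + 1, a, b, _, hg.τ, by rw [Category.assoc, Category.assoc, comp_δpow]⟩
  | δ s _ ih =>
    obtain ⟨r, a, b, g, hg, rfl⟩ := ih
    cases s
    · exact ⟨r, a + 1, b, g, hg, by rw [Category.assoc, δpow.eq_3]⟩
    · exact ⟨r, a, b + 1, g, hg, by rw [Category.assoc, δpow_δ_minus]⟩
  | loop ha hb hs _ ih =>
    obtain ⟨r, a, b, g, hg, rfl⟩ := ih
    exact ⟨r + 1, a, b, _, hg.loop ha hb hs, by rw [Category.assoc, Category.assoc, comp_δpow]⟩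

/-- On `[k + 1]` this is a power of `τ`. Between circles without points, each loop factor changes
the sign, so the target determines the signs backwards, and a sign determines the index of the cap.
-/
theorem IsTurn.unique {r : ℕ} {f g : aΔ.obj x ⟶ aΔ.obj y} (hf : IsTurn r f) (hg : IsTurn r g) :
    f = g := by
  induction hf with
  | id x => cases hg; rfl
  | τ _ ih =>
    cases hg with
    | τ hg => rw [ih hg]
  | @loop _ r i j s s' f ha hb hs _ ih =>
    cases hg with
    | @loop _ _ i' j' _ t g ha' hb' hs' hg =>
      -- Both differ from `s`, and there are only two signs.
      obtain rfl : s' = t := by cases s <;> cases s' <;> cases t <;> first | rfl | exact absurd rfl ‹_›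
      obtain rfl : i = i' := by cases s <;> exact Eq.trans ha (Eq.symm ha')
      obtain rfl : j = j' := by cases s' <;> exact Eq.trans hb (Eq.symm hb')
      rw [ih hg]

theorem isTurn_τpow (k r : ℕ) : IsTurn r (τpow k r) := by
  induction r with
  | zero => exact .id _
  | succ r ih => exact ih.τ

end aΔ

/-! ## The functor `F` is faithful -/

section Caps

variable {i j : ℕ} {w x y y' z : Obj}

theorem IsAlpha.skipBd_twist (h : IsAlpha i z y) (k : ℤ) (u : Bd x.size y.size) :
    h.skipBd (u.twist k) = (h.skipBd u).twist k := by
  rcases u with u | u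
  · rfl
  · exact congrArg Sum.inr (h.skip_shift u k)

theorem IsInsertion.equivalent {h : IsAlpha i z y} {T T' : LiftedTangle x y}
    {R R' : LiftedTangle x z} (hR : IsInsertion h T R) (hR' : IsInsertion h T' R')
    (e : R.Equivalent R') : T.Equivalent T' := by
  obtain ⟨hl, k, hk⟩ := e
  rw [hR.loops_eq, hR'.loops_eq] at hl
  refine ⟨hl, k, fun u => h.skipBd_injective ?_⟩
  rw [← hR'.other_skip, h.skipBd_twist, hk, hR.other_skip, h.skipBd_twist]

/-- The cap of `b_i` can be removed again: a twist between the enlarged tangles restricts to one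
between the original tangles. -/
theorem comp_b_injective (h : IsAlpha i z y) {f g : AtlHom x y}
    (e : f.comp (.of (.b h) 0 0) = g.comp (.of (.b h) 0 0)) : f = g := by
  obtain ⟨T, a, b, rfl⟩ := f.exists_of
  obtain ⟨T', c, d, rfl⟩ := g.exists_of
  obtain ⟨R, hR⟩ := exists_isInsertion h T
  obtain ⟨R', hR'⟩ := exists_isInsertion h T'
  rw [comp_of_b _ _ hR, comp_of_b _ _ hR', AtlHom.of_eq_of_iff] at e
  exact AtlHom.of_eq_of_iff.2 ⟨hR.equivalent hR' e.1, e.2⟩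

/-- The points with numbers `i` and `i + 1` on the external circle are joined. -/
def AtlHom.HasCap (h : IsAlpha i z y) (f : AtlHom x z) : Prop :=
  ∃ g : AtlHom x y, f = g.comp (.of (.b h) 0 0)

theorem AtlHom.hasCap_of_iff {h : IsAlpha i z y} {T : LiftedTangle x z} {a b : ℕ} :
    (AtlHom.of T a b).HasCap h ↔ ∀ s, T.other (.inr (h.capL s)) = .inr (h.capR s) := by
  constructor
  · rintro ⟨g, hg⟩ s
    obtain ⟨S, c, d, rfl⟩ := g.exists_of
    obtain ⟨R, hR⟩ := exists_isInsertion h S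
    rw [comp_of_b _ _ hR, AtlHom.of_eq_of_iff] at hg
    -- The representative `T` may differ from the one with the inserted cap by a twist, which merely
    -- permutes the lifts of the cap.
    obtain ⟨-, k, hk⟩ := hg.1
    have h1 := hk (.inr (h.capL s))
    change R.other (.inr ((h.capL s).shift k)) = _ at h1
    rw [h.capL_shift, hR.other_capL, ← h.capR_shift] at h1
    rcases e : T.other (.inr (h.capL s)) with p | p <;> rw [e] at h1
    · cases h1
    · have := congrArg (Pt.shift (-k)) (Sum.inr.inj h1)
      rw [Pt.shift_shift_neg, Pt.shift_shift_neg] at this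
      rw [this]
  · intro hT
    obtain ⟨S, hS⟩ := exists_isInsertion_of_cap h T ⟨0, hT 0⟩
    exact ⟨.of S a b, (comp_of_b _ _ hS a b 0 0).symm⟩

theorem LiftedTangle.other_add_one_ne (T : LiftedTangle x z) {p q : Pt z.size} (hq : q = p.add 1)
    (h : T.other (.inr p) = .inr (p.add 1)) (h2 : T.other (.inr q) = .inr (q.add 1)) : False := by
  subst hq
  rw [T.other_eq_comm, h2, Sum.inr.injEq] at h
  have := congrArg Pt.toInt h
  simp only [Pt.toInt_add] at this
  omega

/-- Different caps are disjoint. -/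
theorem IsAlpha.disjoint {ha : IsAlpha i z y} {hb : IsAlpha j z y'} (T : LiftedTangle x z)
    (h1 : ∀ s, T.other (.inr (ha.capL s)) = .inr (ha.capR s))
    (h2 : ∀ s, T.other (.inr (hb.capL s)) = .inr (hb.capR s)) (hij : i < j) :
    i + 1 < j ∧ ¬ (j = 2 * z.size ∧ i = 1) := by
  have b1 := ha.bounds
  have b2 := hb.bounds
  simp only [ha.capR_eq] at h1
  simp only [hb.capR_eq] at h2
  constructor
  · by_contra hij2
    refine T.other_add_one_ne ?_ (h1 0) (h2 0)
    rw [← ha.capR_eq]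
    have := ha.capR_spec 0
    have := hb.capL_spec 0
    apply Pt.ext <;> omega
  · rintro ⟨h3, h4⟩
    refine T.other_add_one_ne ?_ (h2 0) (h1 1)
    rw [← hb.capR_eq]
    have := hb.capR_spec 0
    have := ha.capL_spec 1
    apply Pt.ext <;> omega

/-- Inserting a disjoint cap cannot create cap `i`, so it was present before, with number `i - 2`.
`of_comp_b_lt` treats the cap with the smaller number, which keeps its number. -/
theorem AtlHom.HasCap.of_comp_b_gt {ha : IsAlpha i z y} {ha2 : IsAlpha (i - 2) y w}
    {hb : IsAlpha j z y} (hij : j + 1 < i) (hne : ¬ (i = 2 * z.size ∧ j = 1))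
    {f : AtlHom x y} (hf : (f.comp (.of (.b hb) 0 0)).HasCap ha) : f.HasCap ha2 := by
  obtain ⟨T, a, b, rfl⟩ := f.exists_of
  obtain ⟨R, hR⟩ := exists_isInsertion hb T
  rw [comp_of_b _ _ hR, AtlHom.hasCap_of_iff] at hf
  refine AtlHom.hasCap_of_iff.2 fun s => hb.skipBd_injective ?_
  rw [← hR.other_skip]
  have := hf s
  rwa [← (ha.skip_capL ha2 hb hij hne s).1, ← (ha.skip_capL ha2 hb hij hne s).2] at this

theorem AtlHom.HasCap.of_comp_b_lt {ha : IsAlpha i z y} {ha2 : IsAlpha (i - 2) y w}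
    {hb : IsAlpha j z y} {hb2 : IsAlpha j y w} (hij : j + 1 < i)
    (hne : ¬ (i = 2 * z.size ∧ j = 1))
    {f : AtlHom x y} (hf : (f.comp (.of (.b ha) 0 0)).HasCap hb) : f.HasCap hb2 := by
  obtain ⟨T, a, b, rfl⟩ := f.exists_of
  obtain ⟨R, hR⟩ := exists_isInsertion ha T
  rw [comp_of_b _ _ hR, AtlHom.hasCap_of_iff] at hf
  refine AtlHom.hasCap_of_iff.2 fun s => ha.skipBd_injective ?_
  rw [← hR.other_skip]
  have := hf s
  rwa [← (ha.skip_capL' ha2 hb hb2 hij hne s).1, ← (ha.skip_capL' ha2 hb hb2 hij hne s).2] at this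

theorem AtlHom.HasCap.disjoint {ha : IsAlpha i z y} {hb : IsAlpha j z y'} {f : AtlHom x z}
    (h1 : f.HasCap ha) (h2 : f.HasCap hb) (hij : i < j) :
    i + 1 < j ∧ ¬ (j = 2 * z.size ∧ i = 1) := by
  obtain ⟨T, a, b, rfl⟩ := f.exists_of
  exact IsAlpha.disjoint T (AtlHom.hasCap_of_iff.1 h1) (AtlHom.hasCap_of_iff.1 h2) hij

/-- No external points are joined. -/
def AtlHom.NoCap (f : AtlHom x z) : Prop :=
  ∃ T a b, f = .of T a b ∧ ∀ p q, T.other (.inr p) ≠ .inr q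

theorem AtlHom.NoCap.not_hasCap {f : AtlHom x z} (hf : f.NoCap) (h : IsAlpha i z y) :
    ¬ f.HasCap h := by
  obtain ⟨T, a, b, rfl, hT⟩ := hf
  exact fun h1 => hT _ _ (AtlHom.hasCap_of_iff.1 h1 0)

/-- `a_i` on the inside adds only an internal cap. -/
theorem AtlHom.NoCap.a_comp {f : AtlHom x z} (hf : f.NoCap) (h : IsAlpha i w x) :
    ((AtlHom.of (.a h) 0 0).comp f).NoCap := by
  obtain ⟨T, a, b, rfl, hT⟩ := hf
  obtain ⟨R, hR⟩ := exists_isInsertion h T.star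
  refine ⟨R.star, a, b, ?_, fun p q e => ?_⟩
  · have := congrArg AtlHom.star (comp_of_b _ _ hR a b 0 0)
    rwa [AtlHom.star_comp, star_of_b, AtlHom.star_of, T.star_star, AtlHom.star_of] at this
  · have h1 := hR.other_skip (.inl p)
    have h2 : R.other (.inl p) = .inl q := by
      have := congrArg Sum.swap e
      rwa [show (R.star.other (.inr p)).swap = R.other (.inl p) from Sum.swap_swap _] at this
    have h3 := hT p
    change R.other (.inl p) = h.skipBd ((T.other (.inr p)).swap) at h1
    rw [h2] at h1
    rcases e : T.other (.inr p) with r | r <;> rw [e] at h1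
    · cases h1
    · exact h3 r e

end Caps

/-! ### The functor on cores and on normal forms -/

namespace aΔ

variable {i j k : ℕ} {w x y y' z : Obj}

/-- The image of a morphism under `F`. -/
noncomputable def image (f : aΔ.obj x ⟶ aΔ.obj y) : AtlHom x y :=
  (functorF atlComposition relationsHold).map f

theorem image_comp (f : aΔ.obj x ⟶ aΔ.obj y) (g : aΔ.obj y ⟶ aΔ.obj z) :
    image (f ≫ g) = (image f).comp (image g) :=
  (functorF atlComposition relationsHold).map_comp f g

theorem image_id (x : Obj) : image (𝟙 (aΔ.obj x)) = .idm x :=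
  (functorF atlComposition relationsHold).map_id _

theorem image_α (h : IsAlpha i z y) : image (α h) = .of (.a h) 0 0 := Word.image_α h

theorem image_β (h : IsAlpha i z y) : image (β h) = .of (.b h) 0 0 := Word.image_β h

theorem image_τ (k : ℕ) : image (τ k) = .of (.rot (.num k) 1) 0 0 := Word.image_τ k

theorem image_τpow (k r : ℕ) : image (τpow k r) = .of (.rot (.num k) r) 0 0 :=
  Word.image_τpow k r

theorem image_δ (s : Sign) (x : Obj) :
    image (δ s x) = .of (.idt x) s.plusCount s.minusCount := Word.image_δ s x

theorem image_star (f : aΔ.obj x ⟶ aΔ.obj y) : image (star f) = (image f).star := by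
  have step : ∀ {x y z : Obj} (f : aΔ.obj x ⟶ aΔ.obj y) (g : aΔ.obj y ⟶ aΔ.obj z),
      image (star g) = (image g).star → image (star f) = (image f).star →
        image (star (f ≫ g)) = (image (f ≫ g)).star := by
    intro x y z f g hg hf
    rw [star_comp, image_comp, image_comp, AtlHom.star_comp, hg, hf]
  refine induction (P := fun f => image (star f) = (image f).star) (fun x => ?_)
    (fun f h => step f _ ?_) (fun f h => step f _ ?_) (fun f => step f _ ?_)
    (fun s f => step f _ ?_) f
  · rw [star_id, image_id, AtlHom.star_idm]
  · rw [star_α, image_α, image_β]; rfl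
  · rw [star_β, image_α, image_β, star_of_b]
  · rw [star_τ, image_τ, image_τpow, AtlHom.star_of, LiftedTangle.rot_star, of_rot_eq (-1) 1]
    congr 2
    simp [Obj.size]
  · rw [star_δ, image_δ, AtlHom.star_of, LiftedTangle.idt_star]

theorem image_δpow (x : Obj) (a b : ℕ) : image (δpow x a b) = .of (.idt x) a b := by
  induction a with
  | zero =>
    induction b with
    | zero => rw [δpow, image_id]; rfl
    | succ b ih => rw [δpow, image_comp, ih, image_δ, comp_of_idt]; rfl
  | succ a ih => rw [δpow, image_comp, ih, image_δ, comp_of_idt]; rfl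

/-! ### Images of cores -/

/-- Rotations, and tangles which consist of loops. -/
inductive IsTurnTangle : ℕ → ∀ {x y : Obj}, LiftedTangle x y → Prop
  | rot (k r : ℕ) : IsTurnTangle r (LiftedTangle.rot (.num k) r)
  | zero {s s' : Sign} (r : ℕ) (S : LiftedTangle (.zero s) (.zero s')) (h : S.loops = r) :
      IsTurnTangle r S

theorem comp_zero_zero {s s' s'' : Sign} (S : LiftedTangle (.zero s) (.zero s'))
    (S' : LiftedTangle (.zero s') (.zero s'')) : ∃ R : LiftedTangle (.zero s) (.zero s''),
      R.loops = S.loops + S'.loops ∧ (AtlHom.of S 0 0).comp (.of S' 0 0) = .of R 0 0 := by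
  obtain ⟨R, hR⟩ := exists_isReducedComposite_zero S S'
  refine ⟨R, ?_, AtlHom.comp_of_loopless hR (fun κ => loopSet_of_zero κ) 0 0 0 0⟩
  have h1 : loopSet S S' none = ∅ := loopSet_of_zero none
  have h2 := hR.2
  simp only [loopSet] at h1
  rw [h2, h1, Set.ncard_empty]
  rfl

theorem comp_b_a_essential {s s' : Sign} (ha : IsAlpha i (.num 0) (.zero s))
    (hb : IsAlpha j (.num 0) (.zero s')) (hs : s' ≠ s) :
    (AtlHom.of (.b hb) 0 0).comp (.of (.a ha) 0 0) =
      .of (.zero 1 (by simpa using hs)) 0 0 := by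
  rw [AtlHom.comp_of (isReducedComposite_ba_essential hs),
    (loopSet_ba_essential hs.symm).2, (loopSet_ba_essential hs.symm).2, Set.ncard_empty]

theorem IsTurn.exists_isTurnTangle {r : ℕ} {f : aΔ.obj x ⟶ aΔ.obj y} (hf : IsTurn r f) :
    ∃ T, IsTurnTangle r T ∧ image f = .of T 0 0 := by
  induction hf with
  | id x =>
    rw [image_id]
    rcases x with k | s
    · exact ⟨_, .rot k 0, of_rot_zero.symm⟩
    · exact ⟨.idt _, .zero 0 _ rfl, rfl⟩
  | @τ x r k f _ ih =>
    obtain ⟨T, hT, h⟩ := ih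
    cases hT with
    | rot =>
      refine ⟨_, .rot k (r + 1), ?_⟩
      rw [image_comp, h, image_τ, comp_rot_rot, Nat.cast_succ]
  | @loop x r i j s s' f ha hb hs _ ih =>
    obtain ⟨T, hT, h⟩ := ih
    cases hT with
    | zero _ _ hl =>
      obtain ⟨R, hR, hR2⟩ := comp_zero_zero T (.zero 1 (by simpa using hs))
      refine ⟨R, .zero _ R (hR.trans (congrArg (· + 1) hl)), ?_⟩
      rw [image_comp, image_comp, h, image_β, image_α, comp_b_a_essential ha hb hs, hR2]

theorem IsTurnTangle.isThrough {r : ℕ} {T : LiftedTangle x y} (hT : IsTurnTangle r T) :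
    T.IsThrough := by
  cases hT with
  | rot k => exact ⟨fun p q e => (by cases e), fun p q e => (by cases e)⟩
  | @zero s s' => exact ⟨fun p => (isEmpty_zero s).elim p, fun p => (isEmpty_zero s').elim p⟩

/-- Rotations agree up to twists only if their exponents agree modulo the size, and then the powers
of `τ` agree. Tangles of loops agree only if they have equally many loops. -/
theorem IsTurn.eq_of_equivalent {r r' : ℕ} {f g : aΔ.obj x ⟶ aΔ.obj y} (hf : IsTurn r f)
    (hg : IsTurn r' g) {T T' : LiftedTangle x y} (hT : IsTurnTangle r T)
    (hT' : IsTurnTangle r' T') (h : T.Equivalent T') : f = g := by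
  cases hT with
  | rot k =>
    cases hT' with
    | rot =>
      rw [hf.unique (isTurn_τpow k r), hg.unique (isTurn_τpow k r'), ← τpow_mod k r,
        ← τpow_mod k r']
      congr 1
      obtain ⟨-, j, hj⟩ := h
      have h1 := congrArg Pt.toInt (Sum.inr.inj (hj (.inl ⟨0, 0, Nat.succ_pos _⟩)))
      change (Pt.add (2 * r') _).toInt = ((Pt.add (2 * r) _).shift j).toInt at h1
      rw [Pt.toInt_shift, Pt.toInt_add, Pt.toInt_add] at h1
      -- Both rotations are compared at one marked point; a twist by `j` contributes `j` full turns.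
      have h2 : (r' : ℤ) = r + j * (k + 1 : ℕ) := by
        simp only [Obj.size, _root_.id] at h1
        linarith
      have h3 : ((r : ℤ) % (k + 1 : ℕ)) = (r' : ℤ) % (k + 1 : ℕ) := by
        rw [h2, Int.add_mul_emod_self_right]
      exact_mod_cast h3
  | zero _ _ hl =>
    cases hT' with
    | zero _ _ hl' =>
      obtain rfl : r = r' := by rw [← hl, ← hl']; exact h.1
      exact hf.unique hg

theorem IsCore.exists_of {f : aΔ.obj x ⟶ aΔ.obj y} (hf : IsCore f) :
    ∃ (r a b : ℕ) (g : aΔ.obj x ⟶ aΔ.obj y) (T : LiftedTangle x y), IsTurn r g ∧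
      f = g ≫ δpow y a b ∧ IsTurnTangle r T ∧ image f = .of T a b := by
  obtain ⟨r, a, b, g, hg, rfl⟩ := hf.exists_isTurn
  obtain ⟨T, hT, h⟩ := hg.exists_isTurnTangle
  refine ⟨r, a, b, g, T, hg, rfl, hT, ?_⟩
  rw [image_comp, h, image_δpow, comp_of_idt]
  exact congrArg₂ (AtlHom.of T) (zero_add a) (zero_add b)

theorem IsCore.eq_of_image_eq {f g : aΔ.obj x ⟶ aΔ.obj y} (hf : IsCore f) (hg : IsCore g)
    (h : image f = image g) : f = g := by
  obtain ⟨r, a, b, f, T, h1, rfl, h2, h3⟩ := hf.exists_of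
  obtain ⟨r', a', b', g, T', h1', rfl, h2', h3'⟩ := hg.exists_of
  rw [h3, h3', AtlHom.of_eq_of_iff] at h
  obtain ⟨h, rfl, rfl⟩ := h
  rw [h1.eq_of_equivalent h1' h2 h2' h]

theorem IsAlphaCore.noCap {f : aΔ.obj x ⟶ aΔ.obj y} (hf : IsAlphaCore f) : (image f).NoCap := by
  induction hf with
  | core hf =>
    obtain ⟨r, a, b, f, T, h1, -, h2, h3⟩ := hf.exists_of
    exact ⟨T, a, b, h3, h2.isThrough.2⟩
  | α h _ ih =>
    rw [image_comp, image_α]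
    exact ih.a_comp h

/-! ### Faithfulness -/

/-- If the last `β_j` is not the wanted one, the two caps are disjoint, so the wanted cap is already
present in the image of the shorter factor. By induction this factor ends in the corresponding `β`,
and the relation between two `β`s brings it to the end. -/
theorem IsNormal.exists_comp_β {f : aΔ.obj x ⟶ aΔ.obj z} (hf : IsNormal f) :
    ∀ {i y} (h : IsAlpha i z y), (image f).HasCap h → ∃ g, f = g ≫ aΔ.β h := by
  induction hf with
  | alphaCore hf => exact fun h hc => absurd hc (hf.noCap.not_hasCap h)
  | @β j x y' z hb f hf ih =>
    intro i y ha hc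
    rw [image_comp, image_β] at hc
    have hb' : ((image f).comp (.of (.b hb) 0 0)).HasCap hb := ⟨_, rfl⟩
    rcases ha.exists_isAlpha hb with ⟨k, rfl, rfl, rfl⟩ | ⟨s, s', rfl, rfl, rfl⟩
    · have b1 := ha.bounds
      have b2 := hb.bounds
      rcases lt_trichotomy i j with hij | rfl | hij
      · obtain ⟨h1, h2⟩ := hc.disjoint hb' hij
        obtain ⟨w, hb2, ha2⟩ := IsAlpha.exists_pair (i := j) (j := i) (k := k) b1.2.1 h1 h2 b2.2.2
        obtain ⟨g, rfl⟩ := ih ha2 (hc.of_comp_b_lt (ha2 := hb2) h1 h2)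
        obtain ⟨l, rfl⟩ : ∃ l, j = l + 2 := ⟨j - 2, by omega⟩
        have b3 := hb2.bounds
        refine ⟨g ≫ aΔ.β (i := l) hb2, ?_⟩
        rw [Category.assoc, Category.assoc]
        congr 1
        exact (aΔ.sound (.beta_beta i l hb2 ha ha2 hb (by omega) (by omega))).symm
      · exact ⟨f, rfl⟩
      · obtain ⟨h1, h2⟩ := hb'.disjoint hc hij
        obtain ⟨w, ha2, hb2⟩ := IsAlpha.exists_pair (k := k) b2.2.1 h1 h2 b1.2.2
        obtain ⟨g, rfl⟩ := ih ha2 (hc.of_comp_b_gt h1 h2)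
        obtain ⟨l, rfl⟩ : ∃ l, i = l + 2 := ⟨i - 2, by omega⟩
        have b3 := ha2.bounds
        refine ⟨g ≫ aΔ.β hb2, ?_⟩
        rw [Category.assoc, Category.assoc]
        congr 1
        exact aΔ.sound (.beta_beta j l ha2 hb hb2 ha (by omega) (by omega))
    -- On `[1]` the caps with numbers `1` and `2` overlap, so they cannot both be present.
    · have key : ∀ {i s} (h : IsAlpha i (.num 0) (.zero s)), i = 1 ∨ i = 2 := by
        intro i s h
        cases s
        · exact Or.inl h
        · exact Or.inr h
      have h1 := key ha
      have h2 := key hb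
      rcases lt_trichotomy i j with hij | rfl | hij
      · have := (hc.disjoint hb' hij).1
        omega
      · obtain rfl : s = s' := by
          cases s <;> cases s' <;> first | rfl | exact absurd (Eq.trans (Eq.symm ha) hb) (by decide)
        exact ⟨f, rfl⟩
      · have := (hb'.disjoint hc hij).1
        omega

/-- A cap of the common image allows one to split off and cancel the same `β` from both morphisms,
which reduces the sizes. Internal caps are treated by the involution. Without caps both morphisms
are cores. -/
theorem image_injective {f g : aΔ.obj x ⟶ aΔ.obj y} (h : image f = image g) : f = g := by
  induction hn : x.size + y.size using Nat.strong_induction_on generalizing x y with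
  | _ n ih =>
    subst hn
    -- The endpoints are free, up to the sum of sizes, so that this applies to the reflected
    -- morphisms too.
    have step : ∀ {x' y' : Obj} {f g : aΔ.obj x' ⟶ aΔ.obj y'},
        x'.size + y'.size = x.size + y.size → image f = image g →
        (∃ (i : ℕ) (z : Obj) (h : IsAlpha i y' z), (image f).HasCap h) → f = g := by
      rintro x' y' f g hs hfg ⟨i, z, hz, hc⟩
      have hc' := hc
      rw [hfg] at hc'
      obtain ⟨f', rfl⟩ := (isNormal f).exists_comp_β hz hc
      obtain ⟨g', rfl⟩ := (isNormal g).exists_comp_β hz hc'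
      rw [image_comp, image_comp, image_β] at hfg
      rw [ih (x'.size + z.size) (by have := hz.bounds; omega) (comp_b_injective hz hfg) rfl]
    by_cases h1 : ∃ (i : ℕ) (z : Obj) (h : IsAlpha i y z), (image f).HasCap h
    · exact step rfl h h1
    by_cases h2 : ∃ (i : ℕ) (z : Obj) (h : IsAlpha i x z), (image (star f)).HasCap h
    · have := step (f := star f) (g := star g) (add_comm _ _) (by rw [image_star, image_star, h]) h2
      rw [← star_star f, this, star_star]
    -- A final `β` or an initial `α` in the normal form would show up as a cap of the image.
    have core : ∀ f' : aΔ.obj x ⟶ aΔ.obj y, image f' = image f → IsCore f' := by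
      intro f' hf'
      cases isNormal f' with
      | alphaCore hf =>
        cases hf with
        | core hf => exact hf
        | @α i _ z _ hz f' hf =>
          refine absurd ⟨i, z, hz, image (star f'), ?_⟩ h2
          rw [image_star, ← hf', ← image_star, star_comp, star_α, image_comp, image_β]
      | @β i _ z _ hz f' hf =>
        refine absurd ⟨i, z, hz, image f', ?_⟩ h1
        rw [← hf', image_comp, image_β]
    exact (core f rfl).eq_of_image_eq (core g h.symm) h

end aΔ

/-! ## The functor `F` is an isomorphism -/

namespace aΔ

variable {x y : Obj}

theorem exists_image_zero (k : ℕ) {s s' : Sign} (S : LiftedTangle (.zero s) (.zero s'))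
    (hS : S.loops = k) : ∃ f, image f = .of S 0 0 := by
  induction k generalizing s' with
  | zero =>
    have h := S.odd_loops_iff
    rw [hS] at h
    obtain rfl : s = s' := by
      by_contra hs
      exact absurd (h.2 hs) (by decide)
    exact ⟨𝟙 _, (image_id _).trans (congrArg (AtlHom.of · 0 0) (LiftedTangle.ext_zero hS.symm))⟩
  | succ k ih =>
    -- The outermost loop is split off; the region just inside it has the other sign.
    obtain ⟨t, ht⟩ : ∃ t, t ≠ s' := by
      cases s'
      · exact ⟨.minus, fun h => by cases h⟩
      · exact ⟨.plus, fun h => by cases h⟩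
    have hcap : ∀ s, ∃ i, IsAlpha i (.num 0) (.zero s) := by
      rintro (_ | _)
      · exact ⟨1, rfl⟩
      · exact ⟨2, rfl⟩
    obtain ⟨i, ha⟩ := hcap s'
    obtain ⟨j, hb⟩ := hcap t
    have h := S.odd_loops_iff
    rw [hS, Nat.odd_add_one] at h
    have hk : Odd k ↔ s ≠ t := by
      rw [← not_iff_not, h]
      cases s <;> cases s' <;> cases t <;> simp_all
    obtain ⟨f, hf⟩ := ih (.zero k hk) rfl
    obtain ⟨R, hR, hR2⟩ := comp_zero_zero (.zero k hk) (.zero 1 (by simpa using ht))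
    refine ⟨f ≫ β hb ≫ α ha, ?_⟩
    rw [image_comp, image_comp, hf, image_β, image_α, comp_b_a_essential ha hb ht, hR2]
    exact congrArg (AtlHom.of · 0 0) (LiftedTangle.ext_zero (hR.trans hS.symm))

theorem exists_image_rot (k : ℕ) (c : ℤ) : ∃ f, image f = .of (.rot (.num k) c) 0 0 := by
  have h : (0 : ℤ) < (Obj.num k).size := Nat.cast_pos.2 (Nat.succ_pos k)
  refine ⟨τpow k (c % (Obj.num k).size).toNat, ?_⟩
  rw [image_τpow, Int.toNat_of_nonneg (Int.emod_nonneg _ h.ne'),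
    of_rot_eq _ (c / (Obj.num k).size), mul_comm, Int.emod_add_mul_ediv]

/-- Peeling caps at either boundary leaves a rotation or a tangle of loops, and both are products of
images of generators. -/
theorem exists_image_of (T : LiftedTangle x y) : ∃ f, image f = .of T 0 0 := by
  induction hn : x.size + y.size using Nat.strong_induction_on generalizing x y with
  | _ n ih =>
    subst hn
    have step : ∀ {x' y' : Obj} (T : LiftedTangle x' y') {p q : Pt y'.size},
        x'.size + y'.size = x.size + y.size → T.other (.inr p) = .inr q →
        ∃ f, image f = .of T 0 0 := by
      intro x' y' T p q hs hpq
      obtain ⟨i, z, h, S, hS⟩ := exists_cap T hpq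
      obtain ⟨f, hf⟩ := ih _ (by have := h.bounds; omega) S rfl
      exact ⟨f ≫ β h, by rw [image_comp, hf, image_β, comp_of_b _ _ hS]⟩
    by_cases h1 : ∃ p q, T.other (.inr p) = .inr q
    · obtain ⟨p, q, hpq⟩ := h1
      exact step T rfl hpq
    by_cases h2 : ∃ p q, T.other (.inl p) = .inl q
    · obtain ⟨p, q, hpq⟩ := h2
      obtain ⟨f, hf⟩ := step T.star (p := p) (q := q) (add_comm _ _) (by
        change (T.other (.inl p)).swap = _
        rw [hpq]; rfl)
      exact ⟨star f, by rw [image_star, hf, AtlHom.star_of, T.star_star]⟩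
    push Not at h1 h2
    exact LiftedTangle.IsThrough.induction (motive := fun S => ∃ f, image f = .of S 0 0)
      exists_image_rot (fun S => exists_image_zero _ S rfl) ⟨h2, h1⟩

theorem image_surjective (g : AtlHom x y) : ∃ f, image f = g := by
  obtain ⟨T, a, b, rfl⟩ := g.exists_of
  obtain ⟨f, hf⟩ := exists_image_of T
  refine ⟨f ≫ δpow y a b, ?_⟩
  rw [image_comp, hf, image_δpow, comp_of_idt]
  exact congrArg₂ (AtlHom.of T) (zero_add a) (zero_add b)

/-- The inverse of `F`. -/
noncomputable def functorG : Atl atlComposition ⥤ aΔ where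
  obj x := aΔ.obj x
  map g := Classical.choose (image_surjective g)
  map_id x := image_injective ((Classical.choose_spec (image_surjective _)).trans (image_id x).symm)
  map_comp f g := image_injective (by
    refine (Classical.choose_spec (image_surjective _)).trans ?_
    refine Eq.trans ?_ (image_comp _ _).symm
    exact congrArg₂ AtlHom.comp (Classical.choose_spec (image_surjective f)).symm
      (Classical.choose_spec (image_surjective g)).symm)

end aΔ

/-- Since `F` is bijective on objects and morphisms, the chosen preimages form a functor, and both
composites are identities on the nose. -/
theorem isIsomorphism_functorF : IsIsomorphism (functorF atlComposition relationsHold) := by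
  exact ⟨aΔ.functorG,
    CategoryTheory.Functor.hext (fun _ => rfl) fun _ _ _ =>
      heq_of_eq (aΔ.image_injective (Classical.choose_spec (aΔ.image_surjective _))),
    CategoryTheory.Functor.hext (fun _ => rfl) fun _ _ _ =>
      heq_of_eq (Classical.choose_spec (aΔ.image_surjective _))⟩

theorem isInvolutive_functorF : IsInvolutive (functorF atlComposition relationsHold) :=
  fun f => aΔ.image_star f

end AnnularTL

theorem mainTheorem1 :
    ∃ (C : AnnularTL.AtlComposition) (H : AnnularTL.RelationsHold C),
      AnnularTL.IsIsomorphism (AnnularTL.functorF C H) ∧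
      AnnularTL.IsInvolutive (AnnularTL.functorF C H) :=
  ⟨AnnularTL.atlComposition, AnnularTL.relationsHold, AnnularTL.isIsomorphism_functorF,
    AnnularTL.isInvolutive_functorF⟩
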